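/- Let $k$ be a field and $S$ a finite-dimensional semisimple $k$-algebra such that $S\otimes_k S^{op}$ is semisimple. Tensor products are over $S$; "graded" means $\mathbb Z$-graded; tensor products of homogeneous maps follow the Koszul sign rule. For a graded module $M$ let $M[n]_i=M_{i+n}$, let $\sigma_M:M\to M[1]$ be the degree $-1$ map given by the identity, and let $\sigma^{n}_M:M\to M[n]$ be the degree $-n$ map given by the identity. *$A_\infty$-algebras.* Let $A$ be an $A_\infty$-algebra over $S$: a graded $S$-$S$-bimodule, with $k$ acting centrally, with bimodule maps $m_n:A^{\otimes n}\to A$ ($n\ge1$) of degree $2-n$ such that $\sum_{r+s+t=n,\,s\ge1}(-1)^{r+st}m_{r+1+t}(id^{\otimes r}\otimes m_s\otimes id^{\otimes t})=0$ for all $n\ge1$. Its bar bocs $\mathcal B_A=(T_S(A[1]),\mu,\epsilon,\delta)$ is the tensor coalgebra with deconcatenation $\mu$, counit $\epsilon$ the projection to $S$, and $\delta=\sum id^{\otimes r}\otimes\hat m_s\otimes id^{\otimes t}$, where $\hat m_s\,\sigma_A^{\otimes s}=\sigma_A m_s$. *Two DG categories.* Both have the graded right $S$-modules as objects. (a) In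 $\mathrm{GMod}\text{-}\mathcal B_A$ a morphism $M\to N$ of degree $d$ is a right $S$-linear map $f:M\otimes T_S(A[1])\to N$ homogeneous of degree $d$, with $g*f=g(f\otimes id)(id\otimes\mu)$ and $\hat\delta(f)=(-1)^{d+1}f(id_M\otimes\delta)$. Its first component is $f^0(x)=f(x\otimes 1)$. (b) In $\mathrm{GMod}\text{-}A$ a morphism $f:M\to N$ of degree $d$ is a family of right $S$-linear maps $f_n:M\otimes A^{\otimes(n-1)}\to N$ of degree $d+1-n$ ($n\ge1$), with $(g\circ f)_n=\sum_{r+s=n,\,r\ge1,\,s\ge0}(-1)^{(|f|+r+1)s}g_{1+s}(f_r\otimes id^{\otimes s})$ and differential $\delta_\infty(f)_n=\sum_{r+s+t=n,\,r,s\ge1,\,t\ge0}(-1)^{|f|+r+st+1}f_{n-s+1}(id^{\otimes r}\otimes m_s\otimes id^{\otimes t})$, where the first tensor factor of $id^{\otimes r}$ is $id_M$. Its first component is $f_1$. In both, a homogeneous $S$-linear map is regarded as a strict morphism, namely the one with this first component and all other components zero. *Twisted modules.* Let $\mathcal C$ be (a) or (b), with composition $*$ and differential $\delta$. A twisted object is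 a pair $(M,u)$ with $u\in\mathrm{Hom}^1_{\mathcal C}(M,M)$ and $\delta(u)+u*u=0$; a morphism $(M,u)\to(N,v)$ is an $f\in\mathrm{Hom}^0_{\mathcal C}(M,N)$ with $\delta(f)+v*f-f*u=0$. This gives the category $\mathrm{TGMod}^0\text{-}\mathcal B_A$ in case (a) and the category $\mathrm{Mod}_\infty\text{-}A$ of $A_\infty$-modules in case (b). Two morphisms $f,g:(M,u)\to(N,v)$ are homotopic if $f-g=\delta(h)+v*h+h*u$ for some $h\in\mathrm{Hom}^{-1}_{\mathcal C}(M,N)$; the homotopy category has the homotopy classes as morphisms. The shifts are $T^n(M,u)=(M[n],(-1)^n\sigma^n_M*u*(\sigma^n_M)^{-1})$, with $T^n(f)=\sigma^n_N*f*(\sigma^n_M)^{-1}$; write $T=T^1$ and $T(M,u)=(M[1],-u[1])$. Put $J(M,u)=\left(M\oplus M[1],\begin{pmatrix}u&\sigma_M^{-1}\\0&-u[1]\end{pmatrix}\right)$, with the strict morphisms $\alpha=(id,0)^t:(M,u)\to J(M,u)$ and $\beta=(0,id):J(M,u)\to T(M,u)$. *Triangles.* A conflation is a pair $X\xrightarrow{f}E\xrightarrow{g}Y$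 of morphisms of twisted objects with $g*f=0$ whose first components form a short exact sequence $0\to X\to E\to Y\to0$ of graded $S$-modules. A canonical triangle is the image in the homotopy category of $X\xrightarrow{f}E\xrightarrow{g}Y\xrightarrow{h}TX$, where $(f,g)$ is a conflation and there is a morphism $e:E\to J(X)$ of twisted objects with $e*f=\alpha_X$ and $\beta_X*e=h*g$. Let $\mathcal T_\infty$ (case (b)) and $\mathcal T$ (case (a)) be the classes of the triangles $X\to Y\to Z\to TX$ in the homotopy categories that are isomorphic to canonical triangles. *The functor $G$.* For $f\in\mathrm{Hom}^d_{\mathrm{GMod}\text{-}A}(M,N)$ let $\hat f:M[1]\otimes T_S(A[1])\to N[1]$ be the map with components $\hat f_n$, $n\ge0$, determined by $\hat f_n(\sigma_M\otimes\sigma_A^{\otimes n})=\sigma_Nf_{n+1}$. Then $G:\mathrm{Mod}_\infty\text{-}A\to\mathrm{TGMod}^0\text{-}\mathcal B_A$ is given by $G(M,m)=(M[1],\hat m)$ and $G(f)=\hat f$. **Theorem.** The homotopy category of $\mathrm{Mod}_\infty\text{-}A$, with the shift $T$ and the class of triangles $\mathcal T_\infty$, is a triangulated category, and so is the homotopy category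 of $\mathrm{TGMod}^0\text{-}\mathcal B_A$ with $T$ and $\mathcal T$. The functor $G$ induces a functor between these homotopy categories which, with the canonical identification $G\,T^n\cong T^n\,G$ given by the identity maps, is an equivalence of triangulated categories: it is an equivalence and it maps $\mathcal T_\infty$ into $\mathcal T$. -/

import Mathlib

open CategoryTheory
open scoped TensorProduct DirectSum

universe w v v' u

namespace AInfty

/-- The sign `(-1)^n`, as an integer. -/
def sgn (n : ℤ) : ℤ := (n.negOnePow : ℤ)

lemma sgn_add (a b : ℤ) : sgn (a + b) = sgn a * sgn b := by
  simp [sgn, Int.negOnePow_add]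

lemma sgn_congr {a b : ℤ} (h : Even (a - b)) : sgn a = sgn b := by
  unfold sgn
  rw [(Int.negOnePow_eq_iff a b).2 h]

@[simp] lemma sgn_zero : sgn 0 = 1 := rfl
@[simp] lemma sgn_one : sgn 1 = -1 := rfl

lemma sgn_mul_self (a : ℤ) : sgn a * sgn a = 1 := by
  rw [← sgn_add, ← sgn_zero]; exact sgn_congr ⟨a, by ring⟩

/-! ### Tensor products over a noncommutative ring -/

section BalTensor

variable (S : Type u) [Ring S]

/-- The tensor product `M ⊗_S N` of a right `S`-module `M` (a module over `Sᵐᵒᵖ`) and a left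
`S`-module `N`: the quotient of `M ⊗_ℤ N` by the elements `ms ⊗ n - m ⊗ sn`. -/
def BalTensor (M : Type v) (N : Type w) [AddCommGroup M] [Module Sᵐᵒᵖ M] [AddCommGroup N]
    [Module S N] : Type (max v w) :=
  (M ⊗[ℤ] N) ⧸ AddSubgroup.closure {z : M ⊗[ℤ] N | ∃ (m : M) (s : S) (n : N),
    z = (MulOpposite.op s • m) ⊗ₜ[ℤ] n - m ⊗ₜ[ℤ] (s • n)}

namespace BalTensor

variable {M : Type v} {N : Type w} [AddCommGroup M] [Module Sᵐᵒᵖ M] [AddCommGroup N] [Module S N]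

instance : AddCommGroup (BalTensor S M N) :=
  inferInstanceAs (AddCommGroup (_ ⧸ AddSubgroup.closure _))

/-- The class of `m ⊗ n` in `M ⊗_S N`. -/
def tmul (m : M) (n : N) : BalTensor S M N := QuotientAddGroup.mk (m ⊗ₜ[ℤ] n)

lemma tmul_add (m : M) (n n' : N) : tmul S m (n + n') = tmul S m n + tmul S m n' := by
  unfold tmul; rw [TensorProduct.tmul_add]; rfl

lemma add_tmul (m m' : M) (n : N) : tmul S (m + m') n = tmul S m n + tmul S m' n := by
  unfold tmul; rw [TensorProduct.add_tmul]; rfl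

lemma smul_tmul (m : M) (s : S) (n : N) :
    tmul S (MulOpposite.op s • m) n = tmul S m (s • n) := by
  refine (QuotientAddGroup.eq_iff_sub_mem).2 (AddSubgroup.subset_closure ⟨m, s, n, rfl⟩)

/-- `tmul` as a biadditive map. -/
def mk : M →+ N →+ BalTensor S M N :=
  AddMonoidHom.mk' (fun m => AddMonoidHom.mk' (fun n => tmul S m n) (tmul_add S m))
    (fun m m' => by ext n; exact add_tmul S m m' n)

@[simp] lemma mk_apply (m : M) (n : N) : mk S m n = tmul S m n := rfl

@[simp] lemma tmul_zero (m : M) : tmul S m (0 : N) = 0 := (mk S m).map_zero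
@[simp] lemma zero_tmul (n : N) : tmul S (0 : M) n = 0 := by
  rw [← mk_apply, map_zero]; rfl
lemma tmul_zsmul (m : M) (z : ℤ) (n : N) : tmul S m (z • n) = z • tmul S m n :=
  map_zsmul (mk S m) z n
lemma zsmul_tmul (m : M) (z : ℤ) (n : N) : tmul S (z • m) n = z • tmul S m n := by
  rw [← mk_apply, map_zsmul]; rfl
lemma tmul_sum {ι : Type*} (t : Finset ι) (m : M) (n : ι → N) :
    tmul S m (∑ i ∈ t, n i) = ∑ i ∈ t, tmul S m (n i) := map_sum (mk S m) n t

lemma sum_tmul {ι : Type*} (t : Finset ι) (m : ι → M) (n : N) :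
    tmul S (∑ i ∈ t, m i) n = ∑ i ∈ t, tmul S (m i) n := by
  rw [← mk_apply, map_sum, AddMonoidHom.finsetSum_apply]
  rfl

variable {S} in
@[elab_as_elim]
lemma induction {P : BalTensor S M N → Prop} (z : BalTensor S M N)
    (tmul : ∀ m n, P (tmul S m n)) (add : ∀ z z', P z → P z' → P (z + z')) : P z := by
  induction z using QuotientAddGroup.induction_on with
  | H z =>
    induction z using TensorProduct.induction_on with
    | zero => have := tmul 0 0; rw [tmul_zero] at this; exact this
    | tmul m n => exact tmul m n
    | add a b ha hb => exact add _ _ ha hb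

/-- The universal property: a balanced biadditive map induces an additive map on `M ⊗_S N`. -/
def lift {P : Type*} [AddCommGroup P] (φ : M →+ N →+ P)
    (h : ∀ m (s : S) n, φ (MulOpposite.op s • m) n = φ m (s • n)) : BalTensor S M N →+ P :=
  QuotientAddGroup.lift _
    (TensorProduct.liftAddHom φ (fun z m n => by simp)) (by
      rw [AddSubgroup.closure_le]
      rintro _ ⟨m, s, n, rfl⟩
      simp [h])

@[simp] lemma lift_tmul {P : Type*} [AddCommGroup P] (φ : M →+ N →+ P) (h) (m : M) (n : N) :
    lift S φ h (tmul S m n) = φ m n := rfl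

lemma hom_ext {P : Type*} [AddCommGroup P] {f g : BalTensor S M N →+ P}
    (h : ∀ m n, f (tmul S m n) = g (tmul S m n)) : f = g := by
  ext z
  induction z using induction with
  | tmul m n => exact h m n
  | add a b ha hb => rw [map_add, map_add, ha, hb]

/-- An additive map `M ⊗_S N → P` given by an additive map in each variable. -/
def lift₂ {P : Type*} [AddCommGroup P] (φ : M → N → P)
    (h₁ : ∀ m m' n, φ (m + m') n = φ m n + φ m' n)
    (h₂ : ∀ m n n', φ m (n + n') = φ m n + φ m n')
    (h : ∀ m (s : S) n, φ (MulOpposite.op s • m) n = φ m (s • n)) : BalTensor S M N →+ P :=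
  lift S (AddMonoidHom.mk' (fun m => AddMonoidHom.mk' (φ m) (h₂ m))
    (fun m m' => by ext n; exact h₁ m m' n)) h

@[simp] lemma lift₂_tmul {P : Type*} [AddCommGroup P] (φ : M → N → P) (h₁ h₂ h) (m : M) (n : N) :
    lift₂ S φ h₁ h₂ h (tmul S m n) = φ m n := rfl

end BalTensor

end BalTensor

/-! ### Bimodules and their morphisms -/

variable {S : Type u} [Ring S]

/-- A morphism of `S`-`S`-bimodules. The right action is an action of `Sᵐᵒᵖ`. -/
structure BiHom (S : Type u) [Ring S] (X : Type v) (Y : Type w) [AddCommGroup X] [Module S X]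
    [Module Sᵐᵒᵖ X] [AddCommGroup Y] [Module S Y] [Module Sᵐᵒᵖ Y] extends X →ₗ[Sᵐᵒᵖ] Y where
  map_lsmul' : ∀ (s : S) (x : X), toFun (s • x) = s • toFun x

section

variable {X : Type*} [AddCommGroup X] [Module S X] [Module Sᵐᵒᵖ X]
  {Y : Type*} [AddCommGroup Y] [Module S Y] [Module Sᵐᵒᵖ Y]
  {Z : Type*} [AddCommGroup Z] [Module S Z] [Module Sᵐᵒᵖ Z]

namespace BiHom

instance : FunLike (BiHom S X Y) X Y where
  coe f := f.toFun
  coe_injective f g h := by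
    rcases f with ⟨f, hf⟩; rcases g with ⟨g, hg⟩
    have : f = g := LinearMap.ext (fun x => congrFun h x)
    subst this; rfl

instance : AddMonoidHomClass (BiHom S X Y) X Y where
  map_add f := f.map_add'
  map_zero f := f.toLinearMap.map_zero

lemma map_lsmul (f : BiHom S X Y) (s : S) (x : X) : f (s • x) = s • f x := f.map_lsmul' s x
lemma map_rsmul (f : BiHom S X Y) (s : Sᵐᵒᵖ) (x : X) : f (s • x) = s • f x := f.map_smul' s x

@[ext] lemma ext {f g : BiHom S X Y} (h : ∀ x, f x = g x) : f = g := DFunLike.ext _ _ h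

@[simp] lemma coe_toLinearMap (f : BiHom S X Y) (x : X) : f.toLinearMap x = f x := rfl

/-- Build a morphism of bimodules from an additive map. -/
def ofAdd (f : X →+ Y) (hl : ∀ (s : S) x, f (s • x) = s • f x)
    (hr : ∀ (s : Sᵐᵒᵖ) x, f (s • x) = s • f x) : BiHom S X Y where
  toFun := f
  map_add' := f.map_add
  map_smul' := hr
  map_lsmul' := hl

@[simp] lemma ofAdd_apply (f : X →+ Y) (hl hr) (x : X) :
    (ofAdd f hl hr : BiHom S X Y) x = f x := rfl

/-- The identity morphism. -/
def id (S : Type u) [Ring S] (X : Type*) [AddCommGroup X] [Module S X] [Module Sᵐᵒᵖ X] :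
    BiHom S X X := ofAdd (AddMonoidHom.id _) (fun _ _ => rfl) (fun _ _ => rfl)

@[simp] lemma id_apply (x : X) : BiHom.id S X x = x := rfl

/-- Composition of morphisms of bimodules. -/
def comp (g : BiHom S Y Z) (f : BiHom S X Y) : BiHom S X Z where
  toLinearMap := g.toLinearMap.comp f.toLinearMap
  map_lsmul' s x := by
    change g (f (s • x)) = s • g (f x)
    rw [map_lsmul, map_lsmul]

@[simp] lemma comp_apply (g : BiHom S Y Z) (f : BiHom S X Y) (x : X) : g.comp f x = g (f x) := rfl

instance : Zero (BiHom S X Y) := ⟨ofAdd 0 (fun _ _ => by simp) (fun _ _ => by simp)⟩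

@[simp] lemma zero_apply (x : X) : (0 : BiHom S X Y) x = 0 := rfl

instance : Add (BiHom S X Y) := ⟨fun f g => ofAdd (f.toLinearMap.toAddMonoidHom +
  g.toLinearMap.toAddMonoidHom) (fun s x => by simp [map_lsmul]) (fun s x => by simp)⟩

@[simp] lemma add_apply (f g : BiHom S X Y) (x : X) : (f + g) x = f x + g x := rfl

instance : AddCommMonoid (BiHom S X Y) where
  add_assoc f g h := by ext x; simp [add_assoc]
  zero_add f := by ext x; simp
  add_zero f := by ext x; simp
  add_comm f g := by ext x; simp [add_comm]
  nsmul := nsmulRec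

/-- Evaluation at `x`. -/
def eval (x : X) : BiHom S X Y →+ Y where
  toFun f := f x
  map_zero' := rfl
  map_add' _ _ := rfl

@[simp] lemma sum_apply {ι : Type*} (t : Finset ι) (f : ι → BiHom S X Y) (x : X) :
    (∑ i ∈ t, f i) x = ∑ i ∈ t, f i x := map_sum (eval x) f t

end BiHom

end

namespace BalTensor

section

variable {M : Type*} [AddCommGroup M] [Module Sᵐᵒᵖ M]
  {X : Type*} [AddCommGroup X] [Module S X] [Module Sᵐᵒᵖ X] [SMulCommClass S Sᵐᵒᵖ X]
  {N : Type*} [AddCommGroup N] [Module S N]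

/-- The right `S`-module structure on `M ⊗_S X`, for a bimodule `X`: `(m ⊗ x)s = m ⊗ xs`. -/
instance instModuleR : Module Sᵐᵒᵖ (BalTensor S M X) where
  smul s := lift₂ S (fun m (x : X) => tmul S m (s • x)) (fun _ _ _ => add_tmul ..)
    (fun _ _ _ => by rw [smul_add, tmul_add]) (fun m t x => by rw [smul_tmul, smul_comm])
  one_smul z := by
    change lift₂ S _ _ _ _ z = z
    induction z using induction with
    | tmul m x => simp
    | add a b ha hb => rw [map_add, ha, hb]
  mul_smul s t z := by
    change lift₂ S _ _ _ _ z = lift₂ S _ _ _ _ (lift₂ S _ _ _ _ z)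
    induction z using induction with
    | tmul m x => simp [mul_smul]
    | add a b ha hb => simp only [map_add, ha, hb]
  smul_zero s := map_zero (lift₂ S _ _ _ _)
  smul_add s := map_add (lift₂ S _ _ _ _)
  add_smul s t z := by
    change lift₂ S _ _ _ _ z = lift₂ S _ _ _ _ z + lift₂ S _ _ _ _ z
    induction z using induction with
    | tmul m x => simp [add_smul, tmul_add]
    | add a b ha hb => simp only [map_add, ha, hb]; abel
  zero_smul z := by
    change lift₂ S _ _ _ _ z = 0
    induction z using induction with
    | tmul m x => simp
    | add a b ha hb => simp only [map_add, ha, hb]; abel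

@[simp] lemma rsmul_tmul (s : Sᵐᵒᵖ) (m : M) (x : X) :
    s • tmul S m x = tmul S m (s • x) := rfl

/-- The left `S`-module structure on `X ⊗_S N`, for a bimodule `X`: `s(x ⊗ y) = sx ⊗ y`. -/
instance instModuleL : Module S (BalTensor S X N) where
  smul s := lift₂ S (fun (x : X) y => tmul S (s • x) y)
    (fun _ _ _ => by rw [smul_add, add_tmul]) (fun _ _ _ => tmul_add ..)
    (fun m t x => by rw [smul_comm, smul_tmul])
  one_smul z := by
    change lift₂ S _ _ _ _ z = z
    induction z using induction with
    | tmul m x => simp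
    | add a b ha hb => rw [map_add, ha, hb]
  mul_smul s t z := by
    change lift₂ S _ _ _ _ z = lift₂ S _ _ _ _ (lift₂ S _ _ _ _ z)
    induction z using induction with
    | tmul m x => simp [mul_smul]
    | add a b ha hb => simp only [map_add, ha, hb]
  smul_zero s := map_zero (lift₂ S _ _ _ _)
  smul_add s := map_add (lift₂ S _ _ _ _)
  add_smul s t z := by
    change lift₂ S _ _ _ _ z = lift₂ S _ _ _ _ z + lift₂ S _ _ _ _ z
    induction z using induction with
    | tmul m x => simp [add_smul, add_tmul]
    | add a b ha hb => simp only [map_add, ha, hb]; abel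
  zero_smul z := by
    change lift₂ S _ _ _ _ z = 0
    induction z using induction with
    | tmul m x => simp
    | add a b ha hb => simp only [map_add, ha, hb]; abel

@[simp] lemma lsmul_tmul (s : S) (x : X) (y : N) :
    s • tmul S x y = tmul S (s • x) y := rfl

end

instance {X Y : Type*} [AddCommGroup X] [Module S X] [Module Sᵐᵒᵖ X] [SMulCommClass S Sᵐᵒᵖ X]
    [AddCommGroup Y] [Module S Y] [Module Sᵐᵒᵖ Y] [SMulCommClass S Sᵐᵒᵖ Y] :
    SMulCommClass S Sᵐᵒᵖ (BalTensor S X Y) :=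
  ⟨fun s t z => by
    induction z using BalTensor.induction with
    | tmul x y => rfl
    | add a b ha hb => simp only [smul_add, ha, hb]⟩

end BalTensor

open BalTensor

section Maps

variable {M : Type*} [AddCommGroup M] [Module Sᵐᵒᵖ M]
  {M' : Type*} [AddCommGroup M'] [Module Sᵐᵒᵖ M']
  {X : Type*} [AddCommGroup X] [Module S X] [Module Sᵐᵒᵖ X] [SMulCommClass S Sᵐᵒᵖ X]
  {X' : Type*} [AddCommGroup X'] [Module S X'] [Module Sᵐᵒᵖ X'] [SMulCommClass S Sᵐᵒᵖ X']
  {Y : Type*} [AddCommGroup Y] [Module S Y] [Module Sᵐᵒᵖ Y] [SMulCommClass S Sᵐᵒᵖ Y]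
  {Y' : Type*} [AddCommGroup Y'] [Module S Y'] [Module Sᵐᵒᵖ Y'] [SMulCommClass S Sᵐᵒᵖ Y']
  {Z : Type*} [AddCommGroup Z] [Module S Z] [Module Sᵐᵒᵖ Z] [SMulCommClass S Sᵐᵒᵖ Z]

lemma tmul_ext {P : Type*} [AddCommGroup P] [Module Sᵐᵒᵖ P] {f g : BalTensor S M X →ₗ[Sᵐᵒᵖ] P}
    (h : ∀ m x, f (tmul S m x) = g (tmul S m x)) : f = g := by
  ext z
  induction z using BalTensor.induction with
  | tmul m x => exact h m x
  | add a b ha hb => rw [map_add, map_add, ha, hb]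

/-- The (unsigned) map `f ⊗ g : m ⊗ x ↦ f m ⊗ g x`. -/
def tmap (f : M →ₗ[Sᵐᵒᵖ] M') (g : BiHom S X X') :
    BalTensor S M X →ₗ[Sᵐᵒᵖ] BalTensor S M' X' where
  toFun := lift₂ S (fun m (x : X) => tmul S (f m) (g x))
    (fun _ _ _ => by rw [map_add, add_tmul]) (fun _ _ _ => by rw [map_add, tmul_add])
    (fun m s x => by rw [map_smul, smul_tmul, g.map_lsmul])
  map_add' := map_add _
  map_smul' s z := by
    induction z using BalTensor.induction with
    | tmul m x => simp [g.map_rsmul]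
    | add a b ha hb => simp only [smul_add, map_add, ha, hb]

@[simp] lemma tmap_tmul (f : M →ₗ[Sᵐᵒᵖ] M') (g : BiHom S X X') (m : M) (x : X) :
    tmap f g (tmul S m x) = tmul S (f m) (g x) := rfl

/-- The (unsigned) tensor product `f ⊗ g` of morphisms of bimodules. -/
def BiHom.tensor (f : BiHom S X X') (g : BiHom S Y Y') :
    BiHom S (BalTensor S X Y) (BalTensor S X' Y') where
  toLinearMap := tmap f.toLinearMap g
  map_lsmul' s z := by
    change tmap _ _ (s • z) = s • tmap _ _ z
    induction z using BalTensor.induction with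
    | tmul x y => simp [f.map_lsmul]
    | add a b ha hb => rw [smul_add, map_add, map_add, smul_add, ha, hb]

@[simp] lemma BiHom.tensor_tmul (f : BiHom S X X') (g : BiHom S Y Y') (x : X) (y : Y) :
    f.tensor g (tmul S x y) = tmul S (f x) (g y) := rfl

/-- The canonical map `(M ⊗ X) ⊗ Y → M ⊗ (X ⊗ Y)`. -/
def tassoc : BalTensor S (BalTensor S M X) Y →ₗ[Sᵐᵒᵖ] BalTensor S M (BalTensor S X Y) where
  toFun := lift₂ S (fun (z : BalTensor S M X) (y : Y) =>
      lift₂ S (N := X) (fun m x => tmul S m (tmul S x y))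
        (fun _ _ _ => add_tmul ..) (fun _ _ _ => by rw [add_tmul, tmul_add])
        (fun m s x => smul_tmul ..) z)
    (fun _ _ _ => map_add _ _ _)
    (fun z y y' => by
      induction z using BalTensor.induction with
      | tmul m x =>
        change tmul S m (tmul S x (y + y')) = tmul S m (tmul S x y) + tmul S m (tmul S x y')
        rw [tmul_add, tmul_add]
      | add a b ha hb => simp only [map_add, ha, hb]; abel)
    (fun z s y => by
      induction z using BalTensor.induction with
      | tmul m x =>
        change tmul S m (tmul S (MulOpposite.op s • x) y) = tmul S m (tmul S x (s • y))
        rw [smul_tmul]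
      | add a b ha hb => simp only [smul_add, map_add, ha, hb])
  map_add' := map_add _
  map_smul' s z := by
    induction z using BalTensor.induction with
    | tmul z y =>
      induction z using BalTensor.induction with
      | tmul m x => rfl
      | add a b ha hb => simp only [add_tmul, smul_add, map_add, ha, hb]
    | add a b ha hb => simp only [smul_add, map_add, ha, hb]

@[simp] lemma tassoc_tmul (m : M) (x : X) (y : Y) :
    tassoc (tmul S (tmul S m x) y) = tmul S m (tmul S x y) := rfl

/-- The canonical map `M ⊗ (X ⊗ Y) → (M ⊗ X) ⊗ Y`. -/
def tassocInv : BalTensor S M (BalTensor S X Y) →ₗ[Sᵐᵒᵖ] BalTensor S (BalTensor S M X) Y where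
  toFun := lift₂ S (fun m (z : BalTensor S X Y) =>
      lift₂ S (fun (x : X) (y : Y) => tmul S (tmul S m x) y)
        (fun _ _ _ => by rw [tmul_add, add_tmul]) (fun _ _ _ => tmul_add ..)
        (fun x s y => by rw [← smul_tmul, rsmul_tmul]) z)
    (fun m m' z => by
      induction z using BalTensor.induction with
      | tmul x y => simp only [lift₂_tmul, add_tmul]
      | add a b ha hb => simp only [map_add, ha, hb]; abel)
    (fun _ _ _ => map_add _ _ _)
    (fun m s z => by
      induction z using BalTensor.induction with
      | tmul x y => simp only [lsmul_tmul, lift₂_tmul, smul_tmul]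
      | add a b ha hb => simp only [smul_add, map_add, ha, hb])
  map_add' := map_add _
  map_smul' s z := by
    induction z using BalTensor.induction with
    | tmul m z =>
      induction z using BalTensor.induction with
      | tmul x y => rfl
      | add a b ha hb => simp only [tmul_add, smul_add, map_add, ha, hb]
    | add a b ha hb => simp only [smul_add, map_add, ha, hb]

@[simp] lemma tassocInv_tmul (m : M) (x : X) (y : Y) :
    tassocInv (tmul S m (tmul S x y)) = tmul S (tmul S m x) y := rfl

/-- The associativity morphism `(X ⊗ Y) ⊗ Z → X ⊗ (Y ⊗ Z)` of bimodules. -/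
def BiHom.assoc : BiHom S (BalTensor S (BalTensor S X Y) Z) (BalTensor S X (BalTensor S Y Z)) where
  toLinearMap := tassoc
  map_lsmul' s z := by
    change tassoc (s • z) = s • tassoc z
    induction z using BalTensor.induction with
    | tmul z y =>
      induction z using BalTensor.induction with
      | tmul m x => rfl
      | add a b ha hb => simp only [add_tmul, smul_add, map_add, ha, hb]
    | add a b ha hb => rw [smul_add, map_add, map_add, smul_add, ha, hb]

@[simp] lemma BiHom.assoc_tmul (x : X) (y : Y) (z : Z) :
    BiHom.assoc (tmul S (tmul S x y) z) = tmul S x (tmul S y z) := rfl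

end Maps

/-! ### Gradings -/

section Gradings

variable {S : Type u} [Ring S]

/-- A `ℤ`-grading of a right `S`-module: an internal direct sum decomposition into submodules. -/
structure Grd (S : Type u) [Ring S] (M : Type*) [AddCommGroup M] [Module Sᵐᵒᵖ M] where
  gr : ℤ → Submodule Sᵐᵒᵖ M
  internal : DirectSum.IsInternal gr

/-- A `ℤ`-grading of an `S`-`S`-bimodule, as a direct sum of subbimodules. -/
structure BGrd (S : Type u) [Ring S] (X : Type*) [AddCommGroup X] [Module S X] [Module Sᵐᵒᵖ X]
    extends Grd S X where
  lsmul_mem : ∀ (i : ℤ) (s : S) (x : X), x ∈ gr i → s • x ∈ gr i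

namespace Grd

section

variable {M : Type*} [AddCommGroup M] [Module Sᵐᵒᵖ M] (g : Grd S M)
  {N : Type*} [AddCommGroup N] [Module Sᵐᵒᵖ N]

@[elab_as_elim]
lemma induction {P : M → Prop} (x : M) (mem : ∀ i, ∀ x ∈ g.gr i, P x)
    (add : ∀ x y, P x → P y → P (x + y)) : P x := by
  have h : x ∈ ⨆ i, g.gr i := by rw [g.internal.submodule_iSup_eq_top]; trivial
  exact Submodule.iSup_induction g.gr (motive := P) h mem (mem 0 0 (zero_mem _)) add

lemma hom_ext {N : Type*} [AddCommGroup N] {f f' : M →+ N}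
    (h : ∀ i, ∀ x ∈ g.gr i, f x = f' x) : f = f' := by
  ext x
  induction x using g.induction with
  | mem i x hx => exact h i x hx
  | add x y hx hy => rw [map_add, map_add, hx, hy]

/-- The family of homogeneous components of an element. -/
noncomputable def dec : M ≃ₗ[Sᵐᵒᵖ] (⨁ i, g.gr i) :=
  (LinearEquiv.ofBijective (DirectSum.coeLinearMap g.gr) g.internal).symm

lemma dec_of_mem {i : ℤ} {x : M} (hx : x ∈ g.gr i) :
    g.dec x = DirectSum.of (fun i => g.gr i) i ⟨x, hx⟩ := by
  rw [dec, LinearEquiv.symm_apply_eq]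
  exact (DirectSum.coeLinearMap_of g.gr i ⟨x, hx⟩).symm

/-- The family of homogeneous components, as a finitely supported function. -/
noncomputable def decF : M →+ (ℤ →₀ M) :=
  (DirectSum.toAddMonoid (fun i => (Finsupp.singleAddHom i).comp
    (g.gr i).subtype.toAddMonoidHom)).comp g.dec.toLinearMap.toAddMonoidHom

lemma decF_of_mem {i : ℤ} {x : M} (hx : x ∈ g.gr i) : g.decF x = Finsupp.single i x := by
  change DirectSum.toAddMonoid _ (g.dec x) = _
  rw [g.dec_of_mem hx, DirectSum.toAddMonoid_of]
  rfl

/-- A family of submodules is a grading if it spans and has a compatible map of components. -/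
def ofDec (gr : ℤ → Submodule Sᵐᵒᵖ M) (top : ⨆ i, gr i = ⊤) (D : M →+ (ℤ →₀ M))
    (hD : ∀ i, ∀ x ∈ gr i, D x = Finsupp.single i x) : Grd S M where
  gr := gr
  internal := by
    refine DirectSum.isInternal_submodule_of_iSupIndep_of_iSup_eq_top ?_ top
    intro i
    rw [Submodule.disjoint_def]
    intro x hx hx'
    have h1 : ∀ y ∈ ⨆ j, ⨆ (_ : j ≠ i), gr j, D y i = 0 := by
      intro y hy
      refine Submodule.iSup_induction _ (motive := fun y => D y i = 0) hy (fun j z hz => ?_)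
        (by simp) (fun a b ha hb => by rw [map_add, Finsupp.add_apply, ha, hb, add_zero])
      by_cases hj : j = i
      · subst hj
        have hz0 : z = 0 := by simpa using hz
        simp [hz0]
      · have hz' : z ∈ gr j := by simpa [hj] using hz
        rw [hD j z hz', Finsupp.single_eq_of_ne (Ne.symm hj)]
    have h2 := h1 x hx'
    rw [hD i x hx, Finsupp.single_eq_same] at h2
    exact h2

/-- The operator `τ^n`, acting on elements of degree `i` as `(-1)^{ni}`. -/
noncomputable def par (n : ℤ) : M →ₗ[Sᵐᵒᵖ] M :=
  (DirectSum.toModule Sᵐᵒᵖ ℤ M (fun i => sgn (n * i) • (g.gr i).subtype)).comp g.dec.toLinearMap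

lemma par_of_mem (n : ℤ) {i : ℤ} {x : M} (hx : x ∈ g.gr i) : g.par n x = sgn (n * i) • x := by
  change DirectSum.toModule _ _ _ _ (g.dec x) = _
  rw [g.dec_of_mem hx]
  exact DirectSum.toModule_lof Sᵐᵒᵖ i _

lemma par_par (n n' : ℤ) (x : M) : g.par n (g.par n' x) = g.par (n + n') x := by
  induction x using g.induction with
  | mem i x hx =>
    rw [g.par_of_mem n' hx, map_zsmul, g.par_of_mem n hx, g.par_of_mem _ hx, smul_smul, ← sgn_add]
    congr 2; ring
  | add x y hx hy => simp only [map_add, hx, hy]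

lemma par_congr {n n' : ℤ} (h : Even (n - n')) : g.par n = g.par n' := by
  ext x
  induction x using g.induction with
  | mem i x hx =>
    rw [g.par_of_mem n' hx, g.par_of_mem n hx]
    congr 1
    apply sgn_congr
    rw [← sub_mul]
    exact h.mul_right i
  | add x y hx hy => simp only [map_add, hx, hy]

@[simp] lemma par_zero (x : M) : g.par 0 x = x := by
  induction x using g.induction with
  | mem i x hx => rw [g.par_of_mem _ hx]; simp
  | add x y hx hy => simp only [map_add, hx, hy]

lemma par_mem (n : ℤ) {i : ℤ} {x : M} (hx : x ∈ g.gr i) : g.par n x ∈ g.gr i := by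
  rw [g.par_of_mem n hx]; exact zsmul_mem hx _

/-- A map homogeneous of degree `d` commutes with `τ^n` up to the sign `(-1)^{nd}`. -/
lemma par_comm {g : Grd S M} {h : Grd S N} {F : Type*} [FunLike F M N] [AddMonoidHomClass F M N]
    {f : F} {d : ℤ} (hf : ∀ i, ∀ x ∈ g.gr i, f x ∈ h.gr (i + d)) (n : ℤ) (x : M) :
    h.par n (f x) = sgn (n * d) • f (g.par n x) := by
  induction x using g.induction with
  | mem i x hx =>
    rw [h.par_of_mem n (hf i x hx), g.par_of_mem n hx, map_zsmul, smul_smul, ← sgn_add]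
    congr 2; ring
  | add x y hx hy => simp only [map_add, smul_add, hx, hy]

/-- The grading `M[n]_i = M_{i+n}` of `M[n]`; the underlying module is unchanged. -/
def shift (n : ℤ) : Grd S M where
  gr i := g.gr (i + n)
  internal := by
    refine (ofDec (fun i => g.gr (i + n)) ?_
      ((Finsupp.mapDomain.addMonoidHom (fun i => i - n)).comp g.decF) ?_).internal
    · rw [eq_top_iff]
      intro x _
      induction x using g.induction with
      | mem i x hx =>
        refine Submodule.mem_iSup_of_mem (i - n) ?_
        simpa using hx
      | add x y hx hy => exact add_mem (hx trivial) (hy trivial)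
    · intro i x hx
      simp [g.decF_of_mem hx]

lemma par_shift (a n : ℤ) (x : M) : (g.shift a).par n x = sgn (n * a) • g.par n x := by
  induction x using g.induction with
  | mem i x hx =>
    have hx' : x ∈ (g.shift a).gr (i - a) := by simpa [shift] using hx
    rw [g.par_of_mem n hx, (g.shift a).par_of_mem n hx', smul_smul, ← sgn_add]
    apply congrArg (· • x)
    apply sgn_congr
    exact ⟨- (n * a), by ring⟩
  | add x y hx hy => simp only [map_add, smul_add, hx, hy]

/-- The grading of a direct sum. -/
def prod (h : Grd S N) : Grd S (M × N) where
  gr i := (g.gr i).prod (h.gr i)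
  internal := by
    refine (ofDec (fun i => (g.gr i).prod (h.gr i)) ?_
      (((Finsupp.mapRange.addMonoidHom (AddMonoidHom.inl M N)).comp g.decF).coprod
        ((Finsupp.mapRange.addMonoidHom (AddMonoidHom.inr M N)).comp h.decF)) ?_).internal
    · rw [eq_top_iff]
      rintro ⟨x, y⟩ -
      have hx : ((x, 0) : M × N) ∈ ⨆ i, (g.gr i).prod (h.gr i) := by
        induction x using g.induction with
        | mem i x hx => exact Submodule.mem_iSup_of_mem i ⟨hx, zero_mem _⟩
        | add x x' hx hx' => simpa using add_mem hx hx'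
      have hy : ((0, y) : M × N) ∈ ⨆ i, (g.gr i).prod (h.gr i) := by
        induction y using h.induction with
        | mem i x hx => exact Submodule.mem_iSup_of_mem i ⟨zero_mem _, hx⟩
        | add x x' hx hx' => simpa using add_mem hx hx'
      simpa using add_mem hx hy
    · rintro i ⟨x, y⟩ ⟨hx, hy⟩
      simp only [AddMonoidHom.coprod_apply, AddMonoidHom.comp_apply]
      rw [g.decF_of_mem hx, h.decF_of_mem hy]
      simp [← Finsupp.single_add]

/-- The grading concentrated in degree `0`. -/
def conc (S : Type u) [Ring S] (M : Type*) [AddCommGroup M] [Module Sᵐᵒᵖ M] : Grd S M where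
  gr i := if i = 0 then ⊤ else ⊥
  internal := by
    refine (ofDec (fun i => if i = 0 then ⊤ else ⊥) ?_ (Finsupp.singleAddHom 0) ?_).internal
    · rw [eq_top_iff]
      exact le_trans (by simp) (le_iSup _ (0 : ℤ))
    · intro i x hx
      by_cases hi : i = 0
      · subst hi; rfl
      · simp [hi] at hx; subst hx; simp

end

section

variable {M : Type*} [AddCommGroup M] [Module Sᵐᵒᵖ M] (g : Grd S M)
  {X : Type*} [AddCommGroup X] [Module S X] [Module Sᵐᵒᵖ X] [SMulCommClass S Sᵐᵒᵖ X]
  (h : BGrd S X)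

lemma _root_.AInfty.BGrd.decF_lsmul (s : S) (x : X) :
    h.decF (s • x) = Finsupp.mapRange.addMonoidHom (DistribSMul.toAddMonoidHom X s) (h.decF x) := by
  induction x using h.induction with
  | mem i x hx =>
    rw [h.decF_of_mem hx, h.decF_of_mem (h.lsmul_mem i s x hx)]
    simp
  | add x y hx hy => simp only [smul_add, map_add, hx, hy]

lemma decF_rsmul (s : Sᵐᵒᵖ) (x : M) :
    g.decF (s • x) = Finsupp.mapRange.addMonoidHom (DistribSMul.toAddMonoidHom M s) (g.decF x) := by
  induction x using g.induction with
  | mem i x hx =>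
    rw [g.decF_of_mem hx, g.decF_of_mem (Submodule.smul_mem _ s hx)]
    simp
  | add x y hx hy => simp only [smul_add, map_add, hx, hy]

/-- The part of degree `n` of `M ⊗ X`. -/
def tensorGr (n : ℤ) : Submodule Sᵐᵒᵖ (BalTensor S M X) :=
  Submodule.span Sᵐᵒᵖ {z | ∃ (i j : ℤ) (m : M) (x : X), i + j = n ∧ m ∈ g.gr i ∧ x ∈ h.gr j ∧
    z = tmul S m x}

variable {g h} in
lemma tmul_mem {i j n : ℤ} {m : M} {x : X} (hm : m ∈ g.gr i) (hx : x ∈ h.gr j) (e : i + j = n) :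
    tmul S m x ∈ g.tensorGr h n :=
  Submodule.subset_span ⟨i, j, m, x, e, hm, hx, rfl⟩

variable {g h} in
lemma tensorGr_induction {n : ℤ} {P : BalTensor S M X → Prop}
    (tmul : ∀ i j, i + j = n → ∀ m ∈ g.gr i, ∀ x ∈ h.gr j, P (tmul S m x))
    (zero : P 0)
    (add : ∀ x y, P x → P y → P (x + y)) {z : BalTensor S M X} (hz : z ∈ g.tensorGr h n) :
    P z := by
  have key : ∀ z, z ∈ AddSubmonoid.closure {z : BalTensor S M X | ∃ (i j : ℤ) (m : M) (x : X),
      i + j = n ∧ m ∈ g.gr i ∧ x ∈ h.gr j ∧ z = BalTensor.tmul S m x} → P z := by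
    intro z hz
    induction hz using AddSubmonoid.closure_induction with
    | mem z hz =>
      obtain ⟨i, j, m, x, e, hm, hx, rfl⟩ := hz
      exact tmul i j e m hm x hx
    | zero => exact zero
    | add x y _ _ hx hy => exact add x y hx hy
  apply key
  induction hz using Submodule.span_induction with
  | mem z hz => exact AddSubmonoid.subset_closure hz
  | zero => exact zero_mem _
  | add x y _ _ hx hy => exact add_mem hx hy
  | smul s x h' hx =>
    clear h'
    induction hx using AddSubmonoid.closure_induction with
    | mem z hz =>
      obtain ⟨i, j, m, x, e, hm, hx, rfl⟩ := hz
      exact AddSubmonoid.subset_closure ⟨i, j, m, s • x, e, hm, Submodule.smul_mem _ s hx, rfl⟩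
    | zero => rw [smul_zero]; exact zero_mem _
    | add x y _ _ hx hy => rw [smul_add]; exact add_mem hx hy

lemma tensor_hom_ext {P : Type*} [AddCommGroup P] {f f' : BalTensor S M X →+ P}
    (H : ∀ i, ∀ m ∈ g.gr i, ∀ j, ∀ x ∈ h.gr j, f (tmul S m x) = f' (tmul S m x)) : f = f' := by
  apply BalTensor.hom_ext
  intro m x
  induction m using g.induction with
  | mem i m hm =>
    induction x using h.induction with
    | mem j x hx => exact H i m hm j x hx
    | add x y hx hy => simp only [tmul_add, map_add, hx, hy]
  | add x y hx hy => simp only [add_tmul, map_add, hx, hy]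

/-- The homogeneous components of elements of `M ⊗ X`. -/
noncomputable def tensorDec : BalTensor S M X →+ (ℤ →₀ BalTensor S M X) :=
  lift₂ S (fun m x => (g.decF m).sum fun i a => (h.decF x).sum fun j b =>
      Finsupp.single (i + j) (tmul S a b))
    (fun m m' x => by
      rw [map_add]
      exact Finsupp.sum_add_index' (fun i => by simp)
        (fun i a b => by simp only [add_tmul, Finsupp.single_add, Finsupp.sum_add]))
    (fun m x x' => by
      rw [map_add, ← Finsupp.sum_add]
      refine Finsupp.sum_congr fun i _ => ?_
      exact Finsupp.sum_add_index' (fun i => by simp)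
        (fun i a b => by simp only [tmul_add, Finsupp.single_add]))
    (fun m s x => by
      rw [g.decF_rsmul, h.decF_lsmul]
      rw [Finsupp.mapRange.addMonoidHom_apply, Finsupp.sum_mapRange_index (fun i => by simp)]
      refine Finsupp.sum_congr fun i _ => ?_
      rw [Finsupp.mapRange.addMonoidHom_apply, Finsupp.sum_mapRange_index (fun i => by simp)]
      refine Finsupp.sum_congr fun i _ => ?_
      simp [smul_tmul])

/-- The grading of `M ⊗ X`. -/
def tensor : Grd S (BalTensor S M X) where
  gr := g.tensorGr h
  internal := by
    refine (ofDec (g.tensorGr h) ?_ (g.tensorDec h) ?_).internal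
    · rw [eq_top_iff]
      intro z _
      induction z using BalTensor.induction with
      | tmul m x =>
        induction m using g.induction with
        | mem i m hm =>
          induction x using h.induction with
          | mem j x hx => exact Submodule.mem_iSup_of_mem (i + j) (tmul_mem hm hx rfl)
          | add x y hx hy => rw [tmul_add]; exact add_mem (hx trivial) (hy trivial)
        | add x y hx hy => rw [add_tmul]; exact add_mem (hx trivial) (hy trivial)
      | add a b ha hb => exact add_mem (ha trivial) (hb trivial)
    · intro n z hz
      refine tensorGr_induction (P := fun z => g.tensorDec h z = Finsupp.single n z) ?_ ?_ ?_ hz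
      · intro i j e m hm x hx
        change ((g.decF m).sum fun i a => (h.decF x).sum fun j b =>
          Finsupp.single (i + j) (tmul S a b)) = _
        rw [g.decF_of_mem hm, h.decF_of_mem hx, Finsupp.sum_single_index (by simp),
          Finsupp.sum_single_index (by simp), e]
      · simp
      · intro x y hx hy
        rw [map_add, hx, hy, Finsupp.single_add]

lemma par_tensor (n : ℤ) (m : M) (x : X) :
    (g.tensor h).par n (tmul S m x) = tmul S (g.par n m) (h.par n x) := by
  induction m using g.induction with
  | mem i m hm =>
    induction x using h.induction with
    | mem j x hx =>
      rw [(g.tensor h).par_of_mem n (tmul_mem hm hx rfl), g.par_of_mem n hm, h.par_of_mem n hx,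
        zsmul_tmul, tmul_zsmul, smul_smul, ← sgn_add, mul_add]
    | add x y hx hy => simp only [tmul_add, map_add, hx, hy]
  | add x y hx hy => simp only [add_tmul, map_add, hx, hy]

end

end Grd

namespace BGrd

variable {X : Type*} [AddCommGroup X] [Module S X] [Module Sᵐᵒᵖ X] (g : BGrd S X)

/-- The grading of the bimodule `S`, concentrated in degree `0`. -/
def unit (S : Type u) [Ring S] : BGrd S S where
  toGrd := Grd.conc S S
  lsmul_mem i s x hx := by
    change x ∈ (if i = 0 then ⊤ else ⊥ : Submodule Sᵐᵒᵖ S) at hx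
    change s • x ∈ (if i = 0 then ⊤ else ⊥ : Submodule Sᵐᵒᵖ S)
    split_ifs with h
    · trivial
    · rw [if_neg h] at hx
      rw [(Submodule.mem_bot _).1 hx, smul_zero]
      exact zero_mem _

/-- The grading of the shifted bimodule `X[n]`. -/
def shift (n : ℤ) : BGrd S X where
  toGrd := g.toGrd.shift n
  lsmul_mem i s x hx := g.lsmul_mem (i + n) s x hx

/-- The grading of a tensor product of bimodules. -/
def tensor [SMulCommClass S Sᵐᵒᵖ X] {Y : Type*} [AddCommGroup Y] [Module S Y] [Module Sᵐᵒᵖ Y]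
    [SMulCommClass S Sᵐᵒᵖ Y] (h : BGrd S Y) : BGrd S (BalTensor S X Y) where
  toGrd := g.toGrd.tensor h
  lsmul_mem n s z hz := by
    refine Grd.tensorGr_induction (P := fun z => s • z ∈ g.toGrd.tensorGr h n) ?_ ?_ ?_ hz
    · intro i j e m hm x hx
      exact Grd.tmul_mem (g.lsmul_mem i s m hm) hx e
    · rw [smul_zero]; exact zero_mem _
    · intro x y hx hy
      rw [smul_add]; exact add_mem hx hy

/-- The operator `τ^n` on a graded bimodule. -/
noncomputable def parB (n : ℤ) : BiHom S X X where
  toLinearMap := g.par n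
  map_lsmul' s x := by
    change g.par n (s • x) = s • g.par n x
    induction x using g.induction with
    | mem i x hx => rw [g.par_of_mem n hx, g.par_of_mem n (g.lsmul_mem i s x hx), smul_comm]
    | add x y hx hy => simp only [smul_add, map_add, hx, hy]

@[simp] lemma parB_apply (n : ℤ) (x : X) : g.parB n x = g.par n x := rfl

end BGrd

/-- The maps of right `S`-modules that are homogeneous of degree `d`. -/
def Homog {M N : Type*} [AddCommGroup M] [Module Sᵐᵒᵖ M] [AddCommGroup N] [Module Sᵐᵒᵖ N]
    (g : Grd S M) (h : Grd S N) (d : ℤ) : AddSubgroup (M →ₗ[Sᵐᵒᵖ] N) where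
  carrier := {f | ∀ i, ∀ x ∈ g.gr i, f x ∈ h.gr (i + d)}
  zero_mem' _ _ _ := zero_mem _
  add_mem' hf hf' i x hx := add_mem (hf i x hx) (hf' i x hx)
  neg_mem' hf i x hx := neg_mem (hf i x hx)

/-- The morphisms of bimodules that are homogeneous of degree `d`. -/
def BHomog {X Y : Type*} [AddCommGroup X] [Module S X] [Module Sᵐᵒᵖ X] [AddCommGroup Y]
    [Module S Y] [Module Sᵐᵒᵖ Y] (g : BGrd S X) (h : BGrd S Y) (d : ℤ) (f : BiHom S X Y) : Prop :=
  ∀ i, ∀ x ∈ g.gr i, f x ∈ h.gr (i + d)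

/-- A map on `M ⊗ X` is homogeneous if it is so on pure tensors of homogeneous elements. -/
lemma homog_tensor {M : Type*} [AddCommGroup M] [Module Sᵐᵒᵖ M] {g : Grd S M}
    {X : Type*} [AddCommGroup X] [Module S X] [Module Sᵐᵒᵖ X] [SMulCommClass S Sᵐᵒᵖ X]
    {h : BGrd S X} {N : Type*} [AddCommGroup N] [Module Sᵐᵒᵖ N] {k : Grd S N} {d : ℤ}
    {F : Type*} [FunLike F (BalTensor S M X) N] [AddMonoidHomClass F (BalTensor S M X) N] {f : F}
    (H : ∀ i, ∀ m ∈ g.gr i, ∀ j, ∀ x ∈ h.gr j, f (tmul S m x) ∈ k.gr (i + j + d)) (n : ℤ) :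
    ∀ z ∈ (g.tensor h).gr n, f z ∈ k.gr (n + d) := by
  intro z hz
  refine Grd.tensorGr_induction (P := fun z => f z ∈ k.gr (n + d)) ?_ ?_ ?_ hz
  · rintro i j rfl m hm x hx
    exact H i m hm j x hx
  · rw [map_zero]; exact zero_mem _
  · intro x y hx hy
    rw [map_add]; exact add_mem hx hy

/-- A graded right `S`-module. -/
structure GRMod (S : Type u) [Ring S] where
  carrier : Type v
  [addCommGroup : AddCommGroup carrier]
  [modR : Module Sᵐᵒᵖ carrier]
  grd : Grd S carrier

attribute [instance] GRMod.addCommGroup GRMod.modR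

namespace GRMod

instance : CoeSort (GRMod.{v} S) (Type v) := ⟨GRMod.carrier⟩

/-- The module `M[n]`, with `M[n]_i = M_{i+n}`. -/
@[reducible] def shift (M : GRMod.{v} S) (n : ℤ) : GRMod.{v} S where
  carrier := M
  grd := M.grd.shift n

/-- The direct sum `M ⊕ N`. -/
@[reducible] def prod (M N : GRMod.{v} S) : GRMod.{v} S where
  carrier := M × N
  grd := M.grd.prod N.grd

/-- The zero module. -/
@[reducible] def zero (S : Type u) [Ring S] : GRMod.{v} S where
  carrier := PUnit
  grd := Grd.conc S PUnit

/-- The maps of right `S`-modules `M → N` homogeneous of degree `d`. -/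
abbrev HomD (M N : GRMod.{v} S) (d : ℤ) : Type v := Homog M.grd N.grd d

namespace HomD

variable {M N L : GRMod.{v} S}

@[ext] lemma ext {d : ℤ} {f g : HomD M N d} (h : ∀ x, f.1 x = g.1 x) : f = g :=
  Subtype.ext (LinearMap.ext h)

/-- The identity. -/
def id (M : GRMod.{v} S) : HomD M M 0 := ⟨LinearMap.id, fun i x hx => by simpa using hx⟩

/-- Composition (first `f`, then `g`). -/
def comp {d e n : ℤ} (f : HomD M N d) (g : HomD N L e) (h : d + e = n) : HomD M L n :=
  ⟨g.1.comp f.1, fun i x hx => by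
    have := g.2 _ _ (f.2 i x hx)
    rwa [add_assoc, h] at this⟩

@[simp] lemma id_apply (x : M) : (id M).1 x = x := rfl
@[simp] lemma comp_apply {d e n : ℤ} (f : HomD M N d) (g : HomD N L e) (h : d + e = n) (x : M) :
    (f.comp g h).1 x = g.1 (f.1 x) := rfl

/-- The identity map of `M` as a map `σ : M → M[n]`, of degree `-n`. -/
def sig (M : GRMod.{v} S) (n : ℤ) : HomD M (M.shift n) (-n) :=
  ⟨LinearMap.id, fun i x hx => by
    change x ∈ M.grd.gr (i + -n + n)
    simpa using hx⟩

/-- The inverse `σ⁻¹ : M[n] → M`, of degree `n`. -/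
def sigInv (M : GRMod.{v} S) (n : ℤ) : HomD (M.shift n) M n :=
  ⟨LinearMap.id, fun _ _ hx => hx⟩

@[simp] lemma sig_apply (n : ℤ) (x : M) : (sig M n).1 x = x := rfl
@[simp] lemma sigInv_apply (n : ℤ) (x : M) : (sigInv M n).1 x = x := rfl

/-- The inclusion `M → M ⊕ N`. -/
def inl (M N : GRMod.{v} S) : HomD M (M.prod N) 0 :=
  ⟨LinearMap.inl _ _ _, fun i x hx => ⟨by simpa using hx, zero_mem _⟩⟩

/-- The inclusion `N → M ⊕ N`. -/
def inr (M N : GRMod.{v} S) : HomD N (M.prod N) 0 :=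
  ⟨LinearMap.inr _ _ _, fun i x hx => ⟨zero_mem _, by simpa using hx⟩⟩

/-- The projection `M ⊕ N → M`. -/
def fst (M N : GRMod.{v} S) : HomD (M.prod N) M 0 :=
  ⟨LinearMap.fst _ _ _, fun i x hx => by simpa using hx.1⟩

/-- The projection `M ⊕ N → N`. -/
def snd (M N : GRMod.{v} S) : HomD (M.prod N) N 0 :=
  ⟨LinearMap.snd _ _ _, fun i x hx => by simpa using hx.2⟩

@[simp] lemma inl_apply (x : M) : (inl M N).1 x = (x, 0) := rfl
@[simp] lemma inr_apply (x : N) : (inr M N).1 x = (0, x) := rfl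
@[simp] lemma fst_apply (x : M × N) : (fst M N).1 x = x.1 := rfl
@[simp] lemma snd_apply (x : M × N) : (snd M N).1 x = x.2 := rfl

end HomD

end GRMod

end Gradings

/-! ### The tensor coalgebra -/

section Coalg

variable {S : Type u} [Ring S]

section Amap

variable {M : Type*} [AddCommGroup M] [Module Sᵐᵒᵖ M] {M' : Type*} [AddCommGroup M']
  [Module Sᵐᵒᵖ M'] {N : Type*} [AddCommGroup N] [Module S N] {N' : Type*} [AddCommGroup N']
  [Module S N']

/-- The (unsigned) additive map `f ⊗ g` for `f` right linear and `g` left linear. -/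
def amap (f : M →ₗ[Sᵐᵒᵖ] M') (g : N →ₗ[S] N') : BalTensor S M N →+ BalTensor S M' N' :=
  lift₂ S (fun m x => tmul S (f m) (g x))
    (fun _ _ _ => by rw [map_add, add_tmul]) (fun _ _ _ => by rw [map_add, tmul_add])
    (fun m s x => by rw [map_smul, smul_tmul, map_smul])

@[simp] lemma amap_tmul (f : M →ₗ[Sᵐᵒᵖ] M') (g : N →ₗ[S] N') (m : M) (x : N) :
    amap f g (tmul S m x) = tmul S (f m) (g x) := rfl

end Amap

/-- A bundled `S`-`S`-bimodule. -/
structure SBimod (S : Type u) [Ring S] where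
  carrier : Type u
  [addCommGroup : AddCommGroup carrier]
  [modL : Module S carrier]
  [modR : Module Sᵐᵒᵖ carrier]
  [comm : SMulCommClass S Sᵐᵒᵖ carrier]

attribute [instance] SBimod.addCommGroup SBimod.modL SBimod.modR SBimod.comm

variable (V : Type u) [AddCommGroup V] [Module S V] [Module Sᵐᵒᵖ V] [SMulCommClass S Sᵐᵒᵖ V]

variable (S) in
/-- The tensor powers `V^{⊗n}` over `S`, with `V^{⊗0} = S` and `V^{⊗(n+1)} = V^{⊗n} ⊗ V`. -/
def TPb : ℕ → SBimod S
  | 0 => ⟨S⟩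
  | n + 1 => ⟨BalTensor S (TPb n).carrier V⟩

variable (S) in
/-- The tensor power `V^{⊗n}`. -/
abbrev TP (n : ℕ) : Type u := (TPb S V n).carrier

namespace TP

/-- The identification `S = V^{⊗0}`. -/
def nil : BiHom S S (TP S V 0) := BiHom.id S S

/-- The identification `V^{⊗0} = S`. -/
def unnil : BiHom S (TP S V 0) S := BiHom.id S S

variable {V}

/-- The identification `V^{⊗n} ⊗ V = V^{⊗(n+1)}`. -/
def cons (n : ℕ) : BiHom S (BalTensor S (TP S V n) V) (TP S V (n + 1)) :=
  BiHom.id S (BalTensor S (TP S V n) V)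

/-- The identification `V^{⊗(n+1)} = V^{⊗n} ⊗ V`. -/
def uncons (n : ℕ) : BiHom S (TP S V (n + 1)) (BalTensor S (TP S V n) V) :=
  BiHom.id S (BalTensor S (TP S V n) V)

@[simp] lemma uncons_cons (n : ℕ) (z : BalTensor S (TP S V n) V) : uncons n (cons n z) = z := rfl
@[simp] lemma cons_uncons (n : ℕ) (z : TP S V (n + 1)) : cons n (uncons n z) = z := rfl
@[simp] lemma unnil_nil (s : S) : unnil V (nil V s) = s := rfl
@[simp] lemma nil_unnil (s : TP S V 0) : nil V (unnil V s) = s := rfl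

lemma induction_succ {n : ℕ} {P : TP S V (n + 1) → Prop} (z : TP S V (n + 1))
    (tmul : ∀ w a, P (cons n (tmul S w a))) (add : ∀ z z', P z → P z' → P (z + z')) : P z :=
  BalTensor.induction (P := P) z tmul add

end TP

variable (S) in
/-- The underlying bimodule of the tensor coalgebra, `T = ⨁ₙ V^{⊗n}`. -/
abbrev T : Type u := ⨁ n, TP S V n

namespace T

variable {V}

/-- The inclusion `V^{⊗n} → T`. -/
def ι (n : ℕ) : BiHom S (TP S V n) (T S V) where
  toLinearMap := DirectSum.lof Sᵐᵒᵖ ℕ (fun n => TP S V n) n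
  map_lsmul' s x := (DirectSum.lof S ℕ (fun n => TP S V n) n).map_smul s x

/-- The projection `T → V^{⊗n}`. -/
def π (n : ℕ) : BiHom S (T S V) (TP S V n) where
  toLinearMap := DirectSum.component Sᵐᵒᵖ ℕ (fun n => TP S V n) n
  map_lsmul' s x := (DirectSum.component S ℕ (fun n => TP S V n) n).map_smul s x

@[simp] lemma π_ι (n : ℕ) (x : TP S V n) : π n (ι n x) = x :=
  DirectSum.of_eq_same n x

lemma π_ι_ne {n m : ℕ} (h : n ≠ m) (x : TP S V n) : π m (ι n x) = 0 :=
  DirectSum.of_eq_of_ne n m x h.symm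

lemma induction_ι {P : T S V → Prop} (x : T S V) (h : ∀ n w, P (ι n w))
    (add : ∀ x y, P x → P y → P (x + y)) : P x :=
  DirectSum.induction_on x (by simpa using h 0 0) h add

variable {Y : Type*} [AddCommGroup Y] [Module S Y] [Module Sᵐᵒᵖ Y]

/-- The morphism `T → Y` given by a family of morphisms `V^{⊗n} → Y`. -/
def desc (f : ∀ n, BiHom S (TP S V n) Y) : BiHom S (T S V) Y where
  toLinearMap := DirectSum.toModule Sᵐᵒᵖ ℕ Y (fun n => (f n).toLinearMap)
  map_lsmul' s x := by
    change DirectSum.toModule Sᵐᵒᵖ ℕ Y (fun n => (f n).toLinearMap) (s • x) =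
      s • DirectSum.toModule Sᵐᵒᵖ ℕ Y (fun n => (f n).toLinearMap) x
    induction x using induction_ι with
    | h n w =>
      rw [← (ι n).map_lsmul]
      change DirectSum.toModule Sᵐᵒᵖ ℕ Y _ (DirectSum.lof Sᵐᵒᵖ ℕ _ n (s • w)) =
        s • DirectSum.toModule Sᵐᵒᵖ ℕ Y _ (DirectSum.lof Sᵐᵒᵖ ℕ _ n w)
      rw [DirectSum.toModule_lof, DirectSum.toModule_lof]
      exact (f n).map_lsmul s w
    | add x y hx hy => rw [smul_add, map_add, map_add, smul_add, hx, hy]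

@[simp] lemma desc_ι (f : ∀ n, BiHom S (TP S V n) Y) (n : ℕ) (w : TP S V n) :
    desc f (ι n w) = f n w := DirectSum.toModule_lof Sᵐᵒᵖ n w

/-- Right concatenation with `a`, as an additive map. -/
def catAux (a : V) : T S V →+ T S V :=
  DirectSum.toAddMonoid (fun n => AddMonoidHom.mk'
    (fun w : TP S V n => ι (n + 1) (TP.cons n (tmul S w a)))
    (fun w w' => by rw [add_tmul, map_add, map_add]))

lemma catAux_ι (a : V) (n : ℕ) (w : TP S V n) :
    catAux a (ι n w) = ι (n + 1) (TP.cons n (tmul S w a)) :=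
  DirectSum.toAddMonoid_of _ n w

lemma catAux_add (t : T S V) (a b : V) : catAux (a + b) t = catAux a t + catAux b t := by
  induction t using induction_ι with
  | h n w => simp only [catAux_ι, tmul_add, map_add]
  | add x y hx hy => simp only [map_add, hx, hy]; abel

lemma catAux_smul (t : T S V) (s : S) (a : V) :
    catAux a (MulOpposite.op s • t) = catAux (s • a) t := by
  induction t using induction_ι with
  | h n w => rw [← (ι n).map_rsmul, catAux_ι, catAux_ι, smul_tmul]
  | add x y hx hy => simp only [smul_add, map_add, hx, hy]

lemma catAux_lsmul (t : T S V) (s : S) (a : V) :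
    catAux a (s • t) = s • catAux a t := by
  induction t using induction_ι with
  | h n w =>
    rw [← (ι n).map_lsmul, catAux_ι, catAux_ι, ← lsmul_tmul, (TP.cons n).map_lsmul,
      (ι (n + 1)).map_lsmul]
  | add x y hx hy => simp only [smul_add, map_add, hx, hy]

lemma catAux_rsmul (t : T S V) (s : Sᵐᵒᵖ) (a : V) :
    catAux (s • a) t = s • catAux a t := by
  induction t using induction_ι with
  | h n w =>
    rw [catAux_ι, catAux_ι, ← rsmul_tmul, (TP.cons n).map_rsmul, (ι (n + 1)).map_rsmul]
  | add x y hx hy => simp only [smul_add, map_add, hx, hy]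

/-- Concatenation `T ⊗ V → T`. -/
def cat : BiHom S (BalTensor S (T S V) V) (T S V) :=
  BiHom.ofAdd
    (lift₂ S (fun t a => catAux a t) (fun _ _ _ => map_add _ _ _) catAux_add catAux_smul)
    (fun s z => by
      induction z using BalTensor.induction with
      | tmul t a => rw [lsmul_tmul, lift₂_tmul, lift₂_tmul, catAux_lsmul]
      | add x y hx hy => simp only [smul_add, map_add, hx, hy])
    (fun s z => by
      induction z using BalTensor.induction with
      | tmul t a => rw [rsmul_tmul, lift₂_tmul, lift₂_tmul, catAux_rsmul]
      | add x y hx hy => simp only [smul_add, map_add, hx, hy])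

@[simp] lemma cat_ι (n : ℕ) (w : TP S V n) (a : V) :
    cat (tmul S (ι n w) a) = ι (n + 1) (TP.cons n (tmul S w a)) := catAux_ι a n w

/-- Right concatenation with `a`. -/
def catR (a : V) : T S V →ₗ[S] T S V where
  toFun x := cat (tmul S x a)
  map_add' x y := by rw [add_tmul, map_add]
  map_smul' s x := by rw [← lsmul_tmul, cat.map_lsmul]; rfl

@[simp] lemma catR_apply (a : V) (x : T S V) : catR a x = cat (tmul S x a) := rfl

lemma ind {P : T S V → Prop} (x : T S V) (nil : ∀ s, P (ι 0 (TP.nil V s)))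
    (cat : ∀ x a, P x → P (cat (tmul S x a)))
    (add : ∀ x y, P x → P y → P (x + y)) : P x := by
  induction x using induction_ι with
  | h n w =>
    induction n with
    | zero => exact nil (TP.unnil V w)
    | succ n ih =>
      induction w using TP.induction_succ with
      | tmul w a => rw [← cat_ι]; exact cat _ _ (ih w)
      | add z z' hz hz' => rw [map_add]; exact add _ _ hz hz'
  | add x y hx hy => exact add x y hx hy

variable (S V) in
/-- The element `1 ∈ S = V^{⊗0}` of `T`. -/
def one : T S V := ι 0 (TP.nil V (1 : S))

lemma lsmul_one (s : S) : s • one S V = ι 0 (TP.nil V s) := by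
  rw [one, ← BiHom.map_lsmul, ← BiHom.map_lsmul, smul_eq_mul, mul_one]

lemma rsmul_one (s : S) : MulOpposite.op s • one S V = ι 0 (TP.nil V s) := by
  rw [one, ← BiHom.map_rsmul, ← BiHom.map_rsmul, op_smul_eq_mul, one_mul]

/-- The map `x ↦ x ⊗ 1`. -/
def rOne : BiHom S (T S V) (BalTensor S (T S V) (T S V)) where
  toFun x := tmul S x (one S V)
  map_add' x y := add_tmul ..
  map_smul' s x := by
    rw [← MulOpposite.op_unop s, smul_tmul, lsmul_one, RingHom.id_apply, rsmul_tmul, rsmul_one]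
  map_lsmul' s x := rfl

@[simp] lemma rOne_apply (x : T S V) : rOne x = tmul S x (one S V) := rfl

/-- Deconcatenation on `V^{⊗n}`. -/
def deconcN : ∀ n, BiHom S (TP S V n) (BalTensor S (T S V) (T S V))
  | 0 => rOne.comp (ι 0)
  | n + 1 => rOne.comp (ι (n + 1)) +
      ((BiHom.id S _).tensor cat).comp
        (BiHom.assoc.comp (((deconcN n).tensor (BiHom.id S V)).comp (TP.uncons n)))

/-- The deconcatenation coproduct
`μ(a₁ ⊗ ⋯ ⊗ aₙ) = ∑ (a₁ ⊗ ⋯ ⊗ aᵢ) ⊗ (aᵢ₊₁ ⊗ ⋯ ⊗ aₙ)` of the tensor coalgebra. -/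
def deconc : BiHom S (T S V) (BalTensor S (T S V) (T S V)) := desc deconcN

variable (V) in
/-- The counit: the projection `T → S`. -/
def counit : BiHom S (T S V) S := (TP.unnil V).comp (π 0)

lemma deconc_nil (s : S) : deconc (ι 0 (TP.nil V s)) = tmul S (ι 0 (TP.nil V s)) (one S V) := by
  rw [deconc, desc_ι]; rfl

/-- The map `id ⊗ c` for a left linear map `c`, as a left linear map. -/
def tensorL {N N' : Type*} [AddCommGroup N] [Module S N] [AddCommGroup N'] [Module S N']
    (c : N →ₗ[S] N') : BalTensor S (T S V) N →ₗ[S] BalTensor S (T S V) N' where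
  toFun := amap LinearMap.id c
  map_add' := map_add _
  map_smul' s z := by
    induction z using BalTensor.induction with
    | tmul x y => rfl
    | add x y hx hy => simp only [smul_add, map_add, hx, hy]

@[simp] lemma tensorL_tmul {N N' : Type*} [AddCommGroup N] [Module S N] [AddCommGroup N']
    [Module S N'] (c : N →ₗ[S] N') (x : T S V) (y : N) :
    tensorL c (tmul S x y) = tmul S x (c y) := rfl

lemma assoc_cat (z : BalTensor S (T S V) (T S V)) (a : V) :
    (BiHom.id S _).tensor cat (BiHom.assoc (tmul S z a)) = tensorL (catR a) z := by
  induction z using BalTensor.induction with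
  | tmul x y => rfl
  | add x y hx hy => simp only [add_tmul, map_add, hx, hy]

lemma deconc_cat (x : T S V) (a : V) :
    deconc (cat (tmul S x a)) =
      tmul S (cat (tmul S x a)) (one S V) + tensorL (catR a) (deconc x) := by
  induction x using induction_ι with
  | h n w =>
    rw [cat_ι, deconc, desc_ι, desc_ι, ← assoc_cat]; rfl
  | add x y hx hy =>
    simp only [add_tmul, map_add, hx, hy]
    abel

lemma deconc_one : deconc (one S V) = tmul S (one S V) (one S V) := deconc_nil 1

lemma coassoc (x : T S V) :
    BiHom.assoc (deconc.tensor (BiHom.id S _) (deconc x)) =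
      (BiHom.id S _).tensor deconc (deconc x) := by
  induction x using T.ind with
  | nil s =>
    rw [deconc_nil, BiHom.tensor_tmul, BiHom.tensor_tmul, deconc_nil, deconc_one]; rfl
  | cat x a ih =>
    have h1 : ∀ z : BalTensor S (T S V) (T S V),
        BiHom.assoc (deconc.tensor (BiHom.id S _) (tensorL (catR a) z)) =
          tensorL (tensorL (catR a)) (BiHom.assoc (deconc.tensor (BiHom.id S _) z)) := by
      intro z
      induction z using BalTensor.induction with
      | tmul x y =>
        simp only [tensorL_tmul, BiHom.tensor_tmul, BiHom.id_apply]
        generalize deconc x = w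
        induction w using BalTensor.induction with
        | tmul x y => rfl
        | add x y hx hy => simp only [add_tmul, map_add, hx, hy]
      | add x y hx hy => simp only [map_add, hx, hy]
    have h2 : ∀ z : BalTensor S (T S V) (T S V),
        BiHom.assoc (tmul S (tensorL (catR a) z) (one S V)) +
          tensorL (tensorL (catR a)) ((BiHom.id S _).tensor deconc z) =
          (BiHom.id S _).tensor deconc (tensorL (catR a) z) := by
      intro z
      induction z using BalTensor.induction with
      | tmul x y =>
        simp only [tensorL_tmul, BiHom.tensor_tmul, BiHom.id_apply, catR_apply, deconc_cat,
          tmul_add, BiHom.assoc_tmul]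
      | add x y hx hy =>
        simp only [map_add, add_tmul, ← hx, ← hy]
        abel
    rw [deconc_cat, map_add, map_add, map_add, BiHom.tensor_tmul, BiHom.tensor_tmul, deconc_cat,
      deconc_one, add_tmul, map_add, h1, ih, BiHom.id_apply, BiHom.assoc_tmul, add_assoc, h2]
    rfl
  | add x y hx hy => simp only [map_add, hx, hy]

@[simp] lemma counit_nil (s : S) : counit V (ι 0 (TP.nil V s)) = s := by
  change TP.unnil V (π 0 (ι 0 (TP.nil V s))) = s
  rw [π_ι]; rfl

@[simp] lemma counit_one : counit V (one S V) = 1 := counit_nil 1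

@[simp] lemma counit_cat (z : BalTensor S (T S V) V) : counit V (cat z) = 0 := by
  induction z using BalTensor.induction with
  | tmul x a =>
    induction x using induction_ι with
    | h n w =>
      rw [cat_ι]
      change TP.unnil V (π 0 (ι (n + 1) (TP.cons n (tmul S w a)))) = 0
      rw [π_ι_ne (Nat.succ_ne_zero n), map_zero]
    | add x y hx hy => rw [add_tmul, map_add, map_add, hx, hy, add_zero]
  | add x y hx hy => rw [map_add, map_add, hx, hy, add_zero]

end T

end Coalg

section

variable {S : Type u} [Ring S]

/-- The right action `M ⊗ S → M`. -/
def ract (M : Type*) [AddCommGroup M] [Module Sᵐᵒᵖ M] : BalTensor S M S →ₗ[Sᵐᵒᵖ] M where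
  toFun := lift₂ S (fun m s => MulOpposite.op s • m) (fun _ _ _ => smul_add ..)
    (fun _ _ _ => by rw [MulOpposite.op_add, add_smul])
    (fun m s t => by rw [smul_smul, smul_eq_mul, MulOpposite.op_mul])
  map_add' := map_add _
  map_smul' s z := by
    induction z using BalTensor.induction with
    | tmul m t =>
      rw [rsmul_tmul, lift₂_tmul, lift₂_tmul, RingHom.id_apply, smul_smul]
      rfl
    | add x y hx hy => simp only [smul_add, map_add, hx, hy]

@[simp] lemma ract_tmul (M : Type*) [AddCommGroup M] [Module Sᵐᵒᵖ M] (m : M) (s : S) :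
    ract M (tmul S m s) = MulOpposite.op s • m := rfl

/-- The left action `S ⊗ X → X`. -/
def lact (X : Type*) [AddCommGroup X] [Module S X] : BalTensor S S X →+ X :=
  lift₂ S (fun s x => s • x) (fun _ _ _ => add_smul ..) (fun _ _ _ => smul_add ..)
    (fun m s x => by rw [smul_smul]; rfl)

@[simp] lemma lact_tmul (X : Type*) [AddCommGroup X] [Module S X] (s : S) (x : X) :
    lact X (tmul S s x) = s • x := rfl

lemma BGrd.unit_par (n : ℤ) (s : S) : (BGrd.unit S).par n s = s := by
  have hs : s ∈ (BGrd.unit S).gr 0 := by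
    change s ∈ (if (0 : ℤ) = 0 then ⊤ else ⊥ : Submodule Sᵐᵒᵖ S)
    simp
  rw [(BGrd.unit S).par_of_mem n hs]
  simp

variable {V : Type u} [AddCommGroup V] [Module S V] [Module Sᵐᵒᵖ V] [SMulCommClass S Sᵐᵒᵖ V]

/-- The grading of `V^{⊗n}`. -/
noncomputable def TPgr (g : BGrd S V) : ∀ n, BGrd S (TP S V n)
  | 0 => BGrd.unit S
  | n + 1 => (TPgr g n).tensor g

namespace TP

variable (g : BGrd S V)

lemma par_nil (e : ℤ) (s : S) : (TPgr g 0).par e (nil V s) = nil V s := BGrd.unit_par e s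

lemma nil_mem (s : S) : nil V s ∈ (TPgr g 0).gr 0 := by
  change s ∈ (if (0 : ℤ) = 0 then ⊤ else ⊥ : Submodule Sᵐᵒᵖ S)
  simp

lemma par_cons (n : ℕ) (e : ℤ) (w : TP S V n) (a : V) :
    (TPgr g (n + 1)).par e (cons n (tmul S w a)) =
      cons n (tmul S ((TPgr g n).par e w) (g.par e a)) :=
  (TPgr g n).toGrd.par_tensor g e w a

variable {g} in
lemma cons_mem {n : ℕ} {i j k : ℤ} {w : TP S V n} {a : V} (hw : w ∈ (TPgr g n).gr i)
    (ha : a ∈ g.gr j) (e : i + j = k) : cons n (tmul S w a) ∈ (TPgr g (n + 1)).gr k :=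
  Grd.tmul_mem (g := (TPgr g n).toGrd) (h := g) hw ha e

variable {g} in
lemma mem_succ_induction {n : ℕ} {k : ℤ} {P : TP S V (n + 1) → Prop}
    (tmul : ∀ i j, i + j = k → ∀ w ∈ (TPgr g n).gr i, ∀ a ∈ g.gr j, P (cons n (tmul S w a)))
    (zero : P 0) (add : ∀ x y, P x → P y → P (x + y)) {z : TP S V (n + 1)}
    (hz : z ∈ (TPgr g (n + 1)).gr k) : P z :=
  Grd.tensorGr_induction (g := (TPgr g n).toGrd) (h := g) (P := P) tmul zero add hz

end TP

namespace T

variable (g : BGrd S V)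

/-- The part of degree `i` of `T`. -/
def grT (i : ℤ) : Submodule Sᵐᵒᵖ (T S V) where
  carrier := {x | ∀ n, π n x ∈ (TPgr g n).gr i}
  zero_mem' n := by rw [map_zero]; exact zero_mem _
  add_mem' hx hy n := by rw [map_add]; exact add_mem (hx n) (hy n)
  smul_mem' s x hx n := by rw [BiHom.map_rsmul]; exact Submodule.smul_mem _ _ (hx n)

variable {g} in
lemma ι_mem {n : ℕ} {i : ℤ} {w : TP S V n} (hw : w ∈ (TPgr g n).gr i) : ι n w ∈ grT g i := by
  intro m
  by_cases h : n = m
  · subst h; rwa [π_ι]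
  · rw [π_ι_ne h]; exact zero_mem _

open Classical in
lemma sum_ι_π (x : T S V) : ∃ s : Finset ℕ, x = ∑ n ∈ s, ι n (π n x) :=
  ⟨_, (DirectSum.sum_support_of x).symm⟩

/-- The grading of `T`. -/
noncomputable def grd : BGrd S (T S V) where
  gr := grT g
  internal := by
    refine (Grd.ofDec (grT g) ?_ (DirectSum.toAddMonoid fun n =>
      (Finsupp.mapRange.addMonoidHom (ι n).toLinearMap.toAddMonoidHom).comp
        (TPgr g n).decF) ?_).internal
    · rw [eq_top_iff]
      intro x _
      induction x using induction_ι with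
      | h n w =>
        induction w using (TPgr g n).induction with
        | mem i w hw => exact Submodule.mem_iSup_of_mem i (ι_mem hw)
        | add x y hx hy => rw [map_add]; exact add_mem (hx trivial) (hy trivial)
      | add x y hx hy => exact add_mem (hx trivial) (hy trivial)
    · intro i x hx
      obtain ⟨s, hs⟩ := sum_ι_π x
      rw [hs, map_sum, Finsupp.single_finsetSum]
      refine Finset.sum_congr rfl fun n _ => ?_
      refine (DirectSum.toAddMonoid_of _ n (π n x)).trans ?_
      rw [AddMonoidHom.comp_apply, (TPgr g n).decF_of_mem (hx n)]
      simp
  lsmul_mem i s x hx n := by rw [BiHom.map_lsmul]; exact (TPgr g n).lsmul_mem i s _ (hx n)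

lemma par_ι (e : ℤ) (n : ℕ) (w : TP S V n) :
    (grd g).par e (ι n w) = ι n ((TPgr g n).par e w) := by
  induction w using (TPgr g n).induction with
  | mem i w hw =>
    rw [(TPgr g n).par_of_mem e hw, (grd g).par_of_mem e (i := i) (ι_mem hw), map_zsmul]
  | add x y hx hy => simp only [map_add, hx, hy]

lemma par_nil (e : ℤ) (s : S) : (grd g).par e (ι 0 (TP.nil V s)) = ι 0 (TP.nil V s) := by
  rw [par_ι, TP.par_nil]

lemma par_one (e : ℤ) : (grd g).par e (one S V) = one S V := par_nil g e 1

lemma par_cat (e : ℤ) (x : T S V) (a : V) :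
    (grd g).par e (cat (tmul S x a)) = cat (tmul S ((grd g).par e x) (g.par e a)) := by
  induction x using induction_ι with
  | h n w => rw [cat_ι, par_ι, par_ι, cat_ι, TP.par_cons]
  | add x y hx hy => simp only [add_tmul, map_add, hx, hy]

variable {g} in
lemma cat_mem {i j k : ℤ} {x : T S V} {a : V} (hx : x ∈ (grd g).gr i) (ha : a ∈ g.gr j)
    (e : i + j = k) : cat (tmul S x a) ∈ (grd g).gr k := by
  obtain ⟨s, hs⟩ := sum_ι_π x
  rw [hs, ← mk_apply, map_sum, AddMonoidHom.finsetSum_apply, map_sum]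
  refine sum_mem fun n _ => ?_
  rw [mk_apply, cat_ι]
  exact ι_mem (TP.cons_mem (hx n) ha e)

lemma nil_mem (s : S) : ι 0 (TP.nil V s) ∈ (grd g).gr 0 := ι_mem (TP.nil_mem g s)

lemma one_mem : one S V ∈ (grd g).gr 0 := nil_mem g 1

/-- To check a property of the homogeneous elements of `T`. -/
lemma mem_induction {P : ℤ → T S V → Prop} (nil : ∀ s, P 0 (ι 0 (TP.nil V s)))
    (cat : ∀ i j x a, x ∈ (grd g).gr i → a ∈ g.gr j → P i x → P (i + j) (cat (tmul S x a)))
    (zero : ∀ i, P i 0)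
    (add : ∀ i x y, P i x → P i y → P i (x + y)) {i : ℤ} {x : T S V} (hx : x ∈ (grd g).gr i) :
    P i x := by
  have key : ∀ n i, ∀ w ∈ (TPgr g n).gr i, P i (ι n w) := by
    intro n
    induction n with
    | zero =>
      intro i w hw
      by_cases hi : i = 0
      · subst hi; exact nil (TP.unnil V w)
      · have : w = 0 := by
          change w ∈ (if i = 0 then ⊤ else ⊥ : Submodule Sᵐᵒᵖ S) at hw
          rw [if_neg hi] at hw
          exact (Submodule.mem_bot _).1 hw
        rw [this, map_zero]; exact zero i
    | succ n ih =>
      intro k w hw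
      refine TP.mem_succ_induction (P := fun z => P k (ι (n + 1) z)) ?_ ?_ ?_ hw
      · rintro i j rfl w hw a ha
        rw [← cat_ι]
        exact cat i j _ _ (ι_mem hw) ha (ih i w hw)
      · rw [map_zero]; exact zero k
      · intro x y hx hy
        rw [map_add]; exact add k _ _ hx hy
  obtain ⟨s, hs⟩ := sum_ι_π x
  rw [hs]
  refine Finset.sum_induction _ (P i) (add i) (zero i) fun n _ => key n i _ (hx n)

lemma deconc_mem {i : ℤ} {x : T S V} (hx : x ∈ (grd g).gr i) :
    deconc x ∈ ((grd g).tensor (grd g)).gr i := by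
  refine mem_induction g (P := fun i x => deconc x ∈ ((grd g).tensor (grd g)).gr i)
    ?_ ?_ ?_ ?_ hx
  · intro s
    rw [deconc_nil]
    exact Grd.tmul_mem (nil_mem g s) (one_mem g) (by simp)
  · intro i j x a hx ha h
    rw [deconc_cat]
    refine add_mem (Grd.tmul_mem (cat_mem hx ha rfl) (one_mem g) (by simp)) ?_
    refine Grd.tensorGr_induction (P := fun z => tensorL (catR a) z ∈ _) ?_ ?_ ?_ h
    · rintro p q rfl x hx y hy
      exact Grd.tmul_mem hx (cat_mem hy ha rfl) (by ring)
    · rw [map_zero]; exact zero_mem _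
    · intro x y hx hy
      rw [map_add]; exact add_mem hx hy
  · intro i; rw [map_zero]; exact zero_mem _
  · intro i x y hx hy
    rw [map_add]; exact add_mem hx hy

lemma deconc_par (e : ℤ) (x : T S V) :
    deconc ((grd g).par e x) = ((grd g).parB e).tensor ((grd g).parB e) (deconc x) := by
  have h := Grd.par_comm (g := (grd g).toGrd) (h := ((grd g).tensor (grd g)).toGrd) (f := deconc)
    (d := 0) (fun i x hx => by rw [add_zero]; exact deconc_mem g hx) e x
  rw [mul_zero, sgn_zero, one_smul] at h
  rw [← h]
  generalize deconc x = z
  induction z using BalTensor.induction with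
  | tmul x y => exact (grd g).toGrd.par_tensor (grd g) e x y
  | add x y hx hy => simp only [map_add, hx, hy]

end T
end

section

variable {S : Type u} [Ring S]
variable {V : Type u} [AddCommGroup V] [Module S V] [Module Sᵐᵒᵖ V] [SMulCommClass S Sᵐᵒᵖ V]

/-- The component `V^{⊗n} → V^{⊗q} ⊗ V^{⊗s}` of the deconcatenation. For `n = q + s` this is the
canonical isomorphism; otherwise it is zero. -/
def split (V : Type u) [AddCommGroup V] [Module S V] [Module Sᵐᵒᵖ V] [SMulCommClass S Sᵐᵒᵖ V]
    (n q s : ℕ) : BiHom S (TP S V n) (BalTensor S (TP S V q) (TP S V s)) :=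
  ((T.π q).tensor (T.π s)).comp (T.deconc.comp (T.ι n))

/-- The map `id^{⊗r} ⊗ φ ⊗ id^{⊗t} : V^{⊗n} → V^{⊗(r+1+t)}` for a map `φ : V^{⊗s} → V` of degree
`e`, where `n = r + s + t`, with the Koszul sign rule `(id ⊗ φ)(x ⊗ y) = (-1)^{e|x|} x ⊗ φ(y)`. -/
noncomputable def ins (g : BGrd S V) {s : ℕ} (φ : BiHom S (TP S V s) V) (e : ℤ) (r : ℕ) :
    ∀ t n : ℕ, BiHom S (TP S V n) (TP S V (r + 1 + t))
  | 0, n => (TP.cons r).comp ((((TPgr g r).parB e).tensor φ).comp (split V n r s))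
  | _ + 1, 0 => 0
  | t + 1, n + 1 => (TP.cons (r + 1 + t)).comp
      (((ins g φ e r t n).tensor (BiHom.id S V)).comp (TP.uncons n))

/-- The map `T → T` with components `∑_{r+s+t=n} id^{⊗r} ⊗ h_s ⊗ id^{⊗t}`, for a family of maps
`h_s : V^{⊗s} → V` of degree `1`. -/
noncomputable def coder (g : BGrd S V) (h : ∀ s, BiHom S (TP S V s) V) : BiHom S (T S V) (T S V) :=
  T.desc fun n => ∑ p ∈ Finset.HasAntidiagonal.antidiagonal n, ∑ q ∈ Finset.HasAntidiagonal.antidiagonal p.1,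
    (T.ι (q.1 + 1 + p.2)).comp (ins g (h q.2) 1 q.1 p.2 n)

lemma ins_succ (g : BGrd S V) {s : ℕ} (φ : BiHom S (TP S V s) V) (e : ℤ) (r t n : ℕ)
    (w : TP S V n) (a : V) :
    ins g φ e r (t + 1) (n + 1) (TP.cons n (tmul S w a)) =
      TP.cons (r + 1 + t) (tmul S (ins g φ e r t n w) a) := rfl

namespace T

/-- The part of `T ⊗ T` of weight `n`. -/
def wt (S : Type u) [Ring S] (V : Type u) [AddCommGroup V] [Module S V] [Module Sᵐᵒᵖ V]
    [SMulCommClass S Sᵐᵒᵖ V] (n : ℕ) : AddSubmonoid (BalTensor S (T S V) (T S V)) :=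
  AddSubmonoid.closure {z | ∃ q s u v, q + s = n ∧ z = tmul S (ι q u) (ι s v)}

lemma deconc_mem_wt (n : ℕ) (w : TP S V n) : deconc (ι n w) ∈ wt S V n := by
  induction n with
  | zero =>
    have := deconc_nil (V := V) (TP.unnil V w)
    rw [TP.nil_unnil] at this
    rw [this]
    exact AddSubmonoid.subset_closure ⟨0, 0, _, _, rfl, rfl⟩
  | succ n ih =>
    induction w using TP.induction_succ with
    | tmul w a =>
      rw [← cat_ι, deconc_cat]
      refine add_mem ?_ ?_
      · rw [cat_ι]
        exact AddSubmonoid.subset_closure ⟨n + 1, 0, _, _, rfl, rfl⟩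
      · have := ih w
        generalize deconc (ι n w) = z at this
        induction this using AddSubmonoid.closure_induction with
        | mem z hz =>
          obtain ⟨q, s, u, v, rfl, rfl⟩ := hz
          rw [tensorL_tmul, catR_apply, cat_ι]
          exact AddSubmonoid.subset_closure ⟨q, s + 1, _, _, rfl, rfl⟩
        | zero => rw [map_zero]; exact zero_mem _
        | add x y _ _ hx hy => rw [map_add]; exact add_mem hx hy
    | add x y hx hy => rw [map_add, map_add]; exact add_mem hx hy

lemma wt_sum {n : ℕ} {z : BalTensor S (T S V) (T S V)} (hz : z ∈ wt S V n) :
    z = ∑ p ∈ Finset.HasAntidiagonal.antidiagonal n,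
      (ι p.1).tensor (ι p.2) ((π p.1).tensor (π p.2) z) := by
  induction hz using AddSubmonoid.closure_induction with
  | mem z hz =>
    obtain ⟨q, s, u, v, rfl, rfl⟩ := hz
    rw [Finset.sum_eq_single (q, s)]
    · simp
    · rintro ⟨q', s'⟩ hq hne
      rw [Finset.HasAntidiagonal.mem_antidiagonal] at hq
      have : q ≠ q' := by
        rintro rfl
        apply hne
        have : s' = s := by simpa using hq
        rw [this]
      rw [BiHom.tensor_tmul, π_ι_ne this, zero_tmul, map_zero]
    · intro h
      simp at h
  | zero => simp
  | add x y _ _ hx hy =>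
    conv_lhs => rw [hx, hy]
    simp only [map_add, Finset.sum_add_distrib]

/-- The deconcatenation is the sum of its components. -/
lemma deconc_ι (n : ℕ) (w : TP S V n) :
    deconc (ι n w) = ∑ p ∈ Finset.HasAntidiagonal.antidiagonal n,
      (ι p.1).tensor (ι p.2) (split V n p.1 p.2 w) :=
  wt_sum (deconc_mem_wt n w)

variable (g : BGrd S V) (h : ∀ s, BiHom S (TP S V s) V)

/-- The auxiliary map `x ↦ ∑ τ(x') h(x'')`. -/
noncomputable def psi : BiHom S (T S V) (T S V) :=
  cat.comp ((((grd g).parB 1).tensor (desc h)).comp deconc)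

lemma psi_apply (x : T S V) :
    psi g h x = cat (((grd g).parB 1).tensor (desc h) (deconc x)) := rfl

lemma coder_ι (n : ℕ) (w : TP S V n) :
    coder g h (ι n w) = ∑ p ∈ Finset.HasAntidiagonal.antidiagonal n, ∑ q ∈ Finset.HasAntidiagonal.antidiagonal p.1,
      ι (q.1 + 1 + p.2) (ins g (h q.2) 1 q.1 p.2 n w) := by
  rw [coder, desc_ι]
  simp

lemma psi_ι (n : ℕ) (w : TP S V n) :
    psi g h (ι n w) = ∑ q ∈ Finset.HasAntidiagonal.antidiagonal n, ι (q.1 + 1) (ins g (h q.2) 1 q.1 0 n w) := by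
  rw [psi_apply, deconc_ι, map_sum, map_sum]
  refine Finset.sum_congr rfl fun q _ => ?_
  change _ = ι (q.1 + 1) (TP.cons q.1 (((TPgr g q.1).parB 1).tensor (h q.2) (split V n q.1 q.2 w)))
  generalize split V n q.1 q.2 w = z
  induction z using BalTensor.induction with
  | tmul x y =>
    simp only [BiHom.tensor_tmul, BGrd.parB_apply, par_ι, desc_ι, cat_ι]
  | add x y hx hy => simp only [map_add, hx, hy]

lemma coder_nil (h0 : h 0 = 0) (s : S) : coder g h (ι 0 (TP.nil V s)) = 0 := by
  rw [coder_ι]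
  simp only [Finset.Nat.antidiagonal_zero, Finset.sum_singleton]
  change ι 1 (TP.cons 0 (((TPgr g 0).parB 1).tensor (h 0) (split V 0 0 0 _))) = 0
  generalize split V 0 0 0 (TP.nil V s) = z
  rw [h0]
  induction z using BalTensor.induction with
  | tmul x y => simp
  | add x y hx hy => simp only [map_add, hx, hy, add_zero]

lemma coder_cat (x : T S V) (a : V) :
    coder g h (cat (tmul S x a)) = cat (tmul S (coder g h x) a) + psi g h (cat (tmul S x a)) := by
  induction x using induction_ι with
  | h n w =>
    rw [cat_ι, coder_ι, psi_ι, Finset.Nat.sum_antidiagonal_succ', add_comm,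
      coder_ι]
    refine congrArg (· + _) ?_
    rw [sum_tmul, map_sum]
    refine Finset.sum_congr rfl fun p _ => ?_
    rw [sum_tmul, map_sum]
    refine Finset.sum_congr rfl fun q _ => ?_
    rw [cat_ι, ins_succ]
    rfl
  | add x y hx hy =>
    simp only [add_tmul, map_add, hx, hy]
    abel

lemma psi_one (h0 : h 0 = 0) : psi g h (one S V) = 0 := by
  rw [psi_apply, deconc_one, BiHom.tensor_tmul, one, desc_ι, h0, BiHom.zero_apply, tmul_zero,
    map_zero]

lemma coder_one (h0 : h 0 = 0) : coder g h (one S V) = 0 := coder_nil g h h0 1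

/-- The map `τ ⊗ f`. -/
noncomputable abbrev tauT {Y Y' : Type*} [AddCommGroup Y] [Module S Y] [Module Sᵐᵒᵖ Y]
    [SMulCommClass S Sᵐᵒᵖ Y] [AddCommGroup Y'] [Module S Y'] [Module Sᵐᵒᵖ Y']
    [SMulCommClass S Sᵐᵒᵖ Y'] (f : BiHom S Y Y') :
    BiHom S (BalTensor S (T S V) Y) (BalTensor S (T S V) Y') :=
  ((grd g).parB 1).tensor f

lemma deconc_psi (y : T S V) :
    deconc (psi g h y) = tmul S (psi g h y) (one S V) + tauT g (psi g h) (deconc y) := by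
  have h1 : ∀ z : BalTensor S (T S V) V, deconc (cat z) = tmul S (cat z) (one S V) +
      (BiHom.id S _).tensor cat (BiHom.assoc (deconc.tensor (BiHom.id S V) z)) := by
    intro z
    induction z using BalTensor.induction with
    | tmul x a => rw [deconc_cat, BiHom.tensor_tmul, BiHom.id_apply, assoc_cat]
    | add x y hx hy => simp only [add_tmul, map_add, hx, hy]; abel
  have h2 : ∀ z : BalTensor S (T S V) (T S V),
      BiHom.assoc (deconc.tensor (BiHom.id S V) (tauT g (desc h) z)) =
        tauT g (tauT g (desc h)) (BiHom.assoc (deconc.tensor (BiHom.id S _) z)) := by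
    intro z
    induction z using BalTensor.induction with
    | tmul x y =>
      simp only [BiHom.tensor_tmul, BGrd.parB_apply, deconc_par, BiHom.id_apply]
      generalize deconc x = w
      induction w using BalTensor.induction with
      | tmul x y => rfl
      | add x y hx hy => simp only [add_tmul, map_add, hx, hy]
    | add x y hx hy => simp only [map_add, hx, hy]
  rw [psi_apply, h1, h2, coassoc]
  congr 1
  generalize deconc y = z
  induction z using BalTensor.induction with
  | tmul x y => rfl
  | add x y hx hy => simp only [map_add, hx, hy]

/-- `coder g h` is a coderivation. -/
lemma deconc_coder (h0 : h 0 = 0) (x : T S V) :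
    deconc (coder g h x) =
      tauT g (coder g h) (deconc x) + (coder g h).tensor (BiHom.id S _) (deconc x) := by
  induction x using T.ind with
  | nil s =>
    rw [coder_nil g h h0, map_zero, deconc_nil, BiHom.tensor_tmul, BiHom.tensor_tmul,
      coder_nil g h h0, coder_one g h h0]
    simp
  | cat x a ih =>
    have h1 : ∀ z : BalTensor S (T S V) (T S V),
        tauT g (coder g h) (tensorL (catR a) z) =
          tensorL (catR a) (tauT g (coder g h) z) + tauT g (psi g h) (tensorL (catR a) z) := by
      intro z
      induction z using BalTensor.induction with
      | tmul x y =>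
        simp only [tensorL_tmul, BiHom.tensor_tmul, catR_apply, coder_cat, tmul_add]
      | add x y hx hy => simp only [map_add, hx, hy]; abel
    have h2 : ∀ z : BalTensor S (T S V) (T S V),
        (coder g h).tensor (BiHom.id S _) (tensorL (catR a) z) =
          tensorL (catR a) ((coder g h).tensor (BiHom.id S _) z) := by
      intro z
      induction z using BalTensor.induction with
      | tmul x y => rfl
      | add x y hx hy => simp only [map_add, hx, hy]
    have h3 : tauT g (psi g h) (deconc (cat (tmul S x a))) =
        tauT g (psi g h) (tensorL (catR a) (deconc x)) := by
      rw [deconc_cat, map_add, BiHom.tensor_tmul, psi_one g h h0, tmul_zero, zero_add]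
    rw [coder_cat, map_add, deconc_cat, ih, map_add, deconc_psi g h, h3, deconc_cat, map_add,
      map_add, h1, h2, BiHom.tensor_tmul, BiHom.tensor_tmul, coder_one g h h0, tmul_zero,
      coder_cat, add_tmul, BiHom.id_apply]
    abel
  | add x y hx hy => simp only [map_add, hx, hy]; abel

section Degree

variable {g h}

lemma desc_mem (hd : ∀ n, BHomog (TPgr g n) g 1 (h n)) {i : ℤ} {x : T S V}
    (hx : x ∈ (grd g).gr i) : desc h x ∈ g.gr (i + 1) := by
  obtain ⟨s, hs⟩ := sum_ι_π x
  rw [hs, map_sum]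
  refine sum_mem fun n _ => ?_
  rw [desc_ι]
  exact hd n i _ (hx n)

lemma psi_mem (hd : ∀ n, BHomog (TPgr g n) g 1 (h n)) {i : ℤ} {x : T S V}
    (hx : x ∈ (grd g).gr i) : psi g h x ∈ (grd g).gr (i + 1) := by
  refine Grd.tensorGr_induction (P := fun z => cat (tauT g (desc h) z) ∈ (grd g).gr (i + 1))
    ?_ ?_ ?_ (deconc_mem g hx)
  · rintro p q rfl x hx y hy
    exact cat_mem ((grd g).par_mem 1 hx) (desc_mem hd hy) (by ring)
  · rw [map_zero, map_zero]; exact zero_mem _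
  · intro x y hx hy
    rw [map_add, map_add]; exact add_mem hx hy

lemma coder_mem (h0 : h 0 = 0) (hd : ∀ n, BHomog (TPgr g n) g 1 (h n)) {i : ℤ} {x : T S V}
    (hx : x ∈ (grd g).gr i) : coder g h x ∈ (grd g).gr (i + 1) := by
  refine mem_induction g (P := fun i x => coder g h x ∈ (grd g).gr (i + 1)) ?_ ?_ ?_ ?_ hx
  · intro s; rw [coder_nil g h h0]; exact zero_mem _
  · intro i j x a hx ha hP
    rw [coder_cat]
    exact add_mem (cat_mem hP ha (by ring)) (psi_mem hd (cat_mem hx ha rfl))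
  · intro i; rw [map_zero]; exact zero_mem _
  · intro i x y hx hy; rw [map_add]; exact add_mem hx hy

/-- `coder g h` squares to zero as soon as its composition with `h` does. -/
lemma coder_coder (h0 : h 0 = 0) (hd : ∀ n, BHomog (TPgr g n) g 1 (h n))
    (hm : ∀ x, desc h (coder g h x) = 0) (x : T S V) : coder g h (coder g h x) = 0 := by
  have hτ : ∀ x, (grd g).par 1 (coder g h x) = - coder g h ((grd g).par 1 x) := by
    intro x
    have := Grd.par_comm (g := (grd g).toGrd) (h := (grd g).toGrd) (f := coder g h) (d := 1)
      (fun i x hx => coder_mem h0 hd hx) 1 x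
    simpa using this
  have hττ : ∀ x, (grd g).par 1 ((grd g).par 1 x) = x := by
    intro x
    rw [Grd.par_par, (grd g).par_congr (n' := 0) ⟨1, by ring⟩, Grd.par_zero]
  have h1 : ∀ z : BalTensor S (T S V) V, coder g h (cat z) =
      cat ((coder g h).tensor (BiHom.id S V) z) + psi g h (cat z) := by
    intro z
    induction z using BalTensor.induction with
    | tmul x a => rw [coder_cat]; rfl
    | add x y hx hy => simp only [map_add, hx, hy]; abel
  have h2 : ∀ z : BalTensor S (T S V) (T S V),
      tauT g (desc h) ((coder g h).tensor (BiHom.id S _) z) =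
        - (coder g h).tensor (BiHom.id S V) (tauT g (desc h) z) := by
    intro z
    induction z using BalTensor.induction with
    | tmul x y =>
      simp only [BiHom.tensor_tmul, BGrd.parB_apply, BiHom.id_apply, hτ]
      rw [← neg_one_zsmul, zsmul_tmul, neg_one_zsmul]
    | add x y hx hy => simp only [map_add, hx, hy]; abel
  have h3 : ∀ z : BalTensor S (T S V) (T S V),
      tauT g (desc h) (tauT g (coder g h) z) = 0 := by
    intro z
    induction z using BalTensor.induction with
    | tmul x y => simp only [BiHom.tensor_tmul, hm, tmul_zero]
    | add x y hx hy => simp only [map_add, hx, hy, add_zero]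
  have key : ∀ y, psi g h (coder g h y) - psi g h (psi g h y) + coder g h (psi g h y) = 0 := by
    intro y
    rw [psi_apply g h (coder g h y), deconc_coder g h h0, map_add, map_add, h2, h3, map_zero]
    nth_rewrite 3 [psi_apply]
    rw [h1, map_neg]
    change 0 + - cat ((coder g h).tensor (BiHom.id S V) (tauT g (desc h) (deconc y))) -
      psi g h (psi g h y) + (cat ((coder g h).tensor (BiHom.id S V)
        (tauT g (desc h) (deconc y))) + psi g h (psi g h y)) = 0
    abel
  induction x using T.ind with
  | nil s => rw [coder_nil g h h0, map_zero]
  | cat x a ih =>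
    have h4 := key (cat (tmul S x a))
    have h5 : psi g h (coder g h (cat (tmul S x a))) - psi g h (psi g h (cat (tmul S x a))) =
        psi g h (cat (tmul S (coder g h x) a)) := by
      rw [coder_cat, map_add, add_sub_cancel_right]
    rw [h5] at h4
    rw [coder_cat, map_add, coder_cat, ih, zero_tmul, map_zero, zero_add, h4]
  | add x y hx hy => rw [map_add, map_add, hx, hy, add_zero]

end Degree

end T

end

/-! ### Differential graded categories of graded modules -/

/-- A differential graded category whose objects are the graded right `S`-modules: the morphisms
`M → N` of degree `d`, their composition (`comp f g` is `f` followed by `g`), the differential `D`,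
the embedding `strict` of the homogeneous `S`-linear maps as strict morphisms, and the first
component `fst` of a morphism. -/
structure DGMod (S : Type u) [Ring S] where
  Hom : GRMod.{v} S → GRMod.{v} S → ℤ → Type w
  [grp : ∀ M N d, AddCommGroup (Hom M N d)]
  comp {M N L : GRMod.{v} S} {d e n : ℤ} : Hom M N d → Hom N L e → d + e = n → Hom M L n
  D {M N : GRMod.{v} S} {d e : ℤ} : Hom M N d → d + 1 = e → Hom M N e
  strict {M N : GRMod.{v} S} {d : ℤ} : GRMod.HomD M N d →+ Hom M N d
  fst {M N : GRMod.{v} S} {d : ℤ} : Hom M N d →+ GRMod.HomD M N d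
  add_comp {M N L : GRMod.{v} S} {d e n : ℤ} (f f' : Hom M N d) (g : Hom N L e) (h : d + e = n) :
    comp (f + f') g h = comp f g h + comp f' g h
  comp_add {M N L : GRMod.{v} S} {d e n : ℤ} (f : Hom M N d) (g g' : Hom N L e) (h : d + e = n) :
    comp f (g + g') h = comp f g h + comp f g' h
  D_add {M N : GRMod.{v} S} {d e : ℤ} (f f' : Hom M N d) (h : d + 1 = e) :
    D (f + f') h = D f h + D f' h
  assoc {M N L P : GRMod.{v} S} {d e c n₁ n₂ n : ℤ} (f : Hom M N d) (g : Hom N L e) (k : Hom L P c)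
    (h₁ : d + e = n₁) (h₂ : n₁ + c = n) (h₃ : e + c = n₂) (h₄ : d + n₂ = n) :
    comp (comp f g h₁) k h₂ = comp f (comp g k h₃) h₄
  id_comp {M N : GRMod.{v} S} {d : ℤ} (f : Hom M N d) (h : 0 + d = d) :
    comp (strict (GRMod.HomD.id M)) f h = f
  comp_id {M N : GRMod.{v} S} {d : ℤ} (f : Hom M N d) (h : d + 0 = d) :
    comp f (strict (GRMod.HomD.id N)) h = f
  strict_comp {M N L : GRMod.{v} S} {d e n : ℤ} (f : GRMod.HomD M N d) (g : GRMod.HomD N L e)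
    (h : d + e = n) : strict (f.comp g h) = comp (strict f) (strict g) h
  D_strict {M N : GRMod.{v} S} {d e : ℤ} (f : GRMod.HomD M N d) (h : d + 1 = e) :
    D (strict f) h = 0
  D_D {M N : GRMod.{v} S} {d e c : ℤ} (f : Hom M N d) (h : d + 1 = e) (h' : e + 1 = c) :
    D (D f h) h' = 0
  leibniz {M N L : GRMod.{v} S} {d e n d' e' n' : ℤ} (f : Hom M N d) (g : Hom N L e)
    (h : d + e = n) (hd : d + 1 = d') (he : e + 1 = e') (hn : n + 1 = n') (h₁ : d + e' = n')
    (h₂ : d' + e = n') :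
    D (comp f g h) hn = comp f (D g he) h₁ + sgn e • comp (D f hd) g h₂
  fst_strict {M N : GRMod.{v} S} {d : ℤ} (f : GRMod.HomD M N d) : fst (strict f) = f
  fst_comp {M N L : GRMod.{v} S} {d e n : ℤ} (f : Hom M N d) (g : Hom N L e) (h : d + e = n) :
    fst (comp f g h) = (fst f).comp (fst g) h

attribute [instance] DGMod.grp

/-! ### Bocses and their modules -/

section

variable {S : Type u} [Ring S]

/-- A normal differential graded `S`-bocs: a differential graded counital coassociative
`S`-coalgebra `(C, μ, ε, δ)` with a distinguished element `1` giving `C = S ⊕ ker ε`. -/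
structure Bocs (S : Type u) [Ring S] where
  carrier : Type u
  [addCommGroup : AddCommGroup carrier]
  [modL : Module S carrier]
  [modR : Module Sᵐᵒᵖ carrier]
  [comm : SMulCommClass S Sᵐᵒᵖ carrier]
  grd : BGrd S carrier
  mu : BiHom S carrier (BalTensor S carrier carrier)
  eps : BiHom S carrier S
  delta : BiHom S carrier carrier
  mu_deg : BHomog grd (grd.tensor grd) 0 mu
  eps_deg : BHomog grd (BGrd.unit S) 0 eps
  delta_deg : BHomog grd grd 1 delta
  coassoc : ∀ x, BiHom.assoc (mu.tensor (BiHom.id S _) (mu x)) =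
    (BiHom.id S _).tensor mu (mu x)
  counit_right : ∀ x, ract carrier ((BiHom.id S _).tensor eps (mu x)) = x
  counit_left : ∀ x, lact carrier (eps.tensor (BiHom.id S _) (mu x)) = x
  coderivation : ∀ x, mu (delta x) =
    (grd.parB 1).tensor delta (mu x) + delta.tensor (BiHom.id S _) (mu x)
  delta_delta : ∀ x, delta (delta x) = 0
  one : carrier
  one_mem : one ∈ grd.gr 0
  lsmul_one : ∀ s : S, s • one = MulOpposite.op s • one
  eps_one : eps one = 1
  mu_one : mu one = tmul S one one

attribute [instance] Bocs.addCommGroup Bocs.modL Bocs.modR Bocs.comm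

/-- The map `x ↦ f (m ⊗ x)`. -/
def curry {M : Type*} [AddCommGroup M] [Module Sᵐᵒᵖ M] {X : Type*} [AddCommGroup X] [Module S X]
    [Module Sᵐᵒᵖ X] [SMulCommClass S Sᵐᵒᵖ X] {N : Type*} [AddCommGroup N] [Module Sᵐᵒᵖ N]
    (f : BalTensor S M X →ₗ[Sᵐᵒᵖ] N) (m : M) : X →ₗ[Sᵐᵒᵖ] N where
  toFun x := f (tmul S m x)
  map_add' x y := by rw [tmul_add, map_add]
  map_smul' s x := by rw [← rsmul_tmul, map_smul]; rfl

@[simp] lemma curry_apply {M : Type*} [AddCommGroup M] [Module Sᵐᵒᵖ M] {X : Type*}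
    [AddCommGroup X] [Module S X] [Module Sᵐᵒᵖ X] [SMulCommClass S Sᵐᵒᵖ X] {N : Type*}
    [AddCommGroup N] [Module Sᵐᵒᵖ N]
    (f : BalTensor S M X →ₗ[Sᵐᵒᵖ] N) (m : M) (x : X) : curry f m x = f (tmul S m x) := rfl

namespace Bocs

variable (B : Bocs.{u} S)

/-- The morphisms of graded `B`-modules `M → N` of degree `d`: the maps `M ⊗ C → N` of graded right
`S`-modules, homogeneous of degree `d`. -/
abbrev GHom (M N : GRMod.{v} S) (d : ℤ) : Type (max u v) :=
  Homog (M.grd.tensor B.grd) N.grd d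

variable {B} {M N L P : GRMod.{v} S}

/-- The map underlying the composition: `g (f ⊗ id) (id ⊗ μ)`. -/
def compMap (f : BalTensor S M B.carrier →ₗ[Sᵐᵒᵖ] N) (g : BalTensor S N B.carrier →ₗ[Sᵐᵒᵖ] L) :
    BalTensor S M B.carrier →ₗ[Sᵐᵒᵖ] L :=
  g ∘ₗ tmap f (BiHom.id S _) ∘ₗ tassocInv ∘ₗ tmap LinearMap.id B.mu

lemma compMap_tmul (f : BalTensor S M B.carrier →ₗ[Sᵐᵒᵖ] N)
    (g : BalTensor S N B.carrier →ₗ[Sᵐᵒᵖ] L) (m : M) (c : B.carrier) :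
    compMap f g (tmul S m c) = g (tmap (curry f m) (BiHom.id S _) (B.mu c)) := by
  change g (tmap f (BiHom.id S _) (tassocInv (tmul S m (B.mu c)))) = _
  congr 1
  generalize B.mu c = z
  induction z using BalTensor.induction with
  | tmul x y => rfl
  | add x y hx hy => simp only [tmul_add, map_add, hx, hy]

/-- Composition in the category of graded `B`-modules. -/
def comp {d e n : ℤ} (f : B.GHom M N d) (g : B.GHom N L e) (h : d + e = n) : B.GHom M L n :=
  ⟨compMap f.1 g.1, homog_tensor fun i m hm j c hc => by
    rw [compMap_tmul]
    have h1 := B.mu_deg j c hc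
    rw [add_zero] at h1
    refine Grd.tensorGr_induction (P := fun z =>
      g.1 (tmap (curry f.1 m) (BiHom.id S _) z) ∈ L.grd.gr (i + j + n)) ?_ ?_ ?_ h1
    · rintro p q rfl x hx y hy
      have h2 := f.2 _ _ (Grd.tmul_mem hm hx rfl)
      have h3 := g.2 _ _ (Grd.tmul_mem h2 hy rfl)
      have e : i + p + d + q + e = i + (p + q) + n := by rw [← h]; ring
      rw [← e]
      exact h3
    · rw [map_zero, map_zero]; exact zero_mem _
    · intro x y hx hy
      rw [map_add, map_add]; exact add_mem hx hy⟩

/-- The differential `f ↦ (-1)^{d+1} f (id ⊗ δ)`. -/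
noncomputable def diff {d e : ℤ} (f : B.GHom M N d) (h : d + 1 = e) : B.GHom M N e :=
  ⟨sgn (d + 1) • (f.1 ∘ₗ tmap (M.grd.par 1) B.delta), homog_tensor fun i m hm j c hc => by
    have h1 := f.2 _ _ (Grd.tmul_mem (M.grd.par_mem 1 hm) (B.delta_deg j c hc) rfl)
    have e : i + (j + 1) + d = i + j + e := by rw [← h]; ring
    rw [← e]
    exact zsmul_mem h1 _⟩

lemma diff_tmul {d e : ℤ} (f : B.GHom M N d) (h : d + 1 = e) (m : M) (c : B.carrier) :
    (diff f h).1 (tmul S m c) = sgn (d + 1) • f.1 (tmul S (M.grd.par 1 m) (B.delta c)) := rfl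

lemma eps_delta (c : B.carrier) : B.eps (B.delta c) = 0 := by
  have h1 : ∀ z, ract B.carrier ((BiHom.id S _).tensor B.eps
      (B.delta.tensor (BiHom.id S _) z)) =
      B.delta (ract B.carrier ((BiHom.id S _).tensor B.eps z)) := by
    intro z
    induction z using BalTensor.induction with
    | tmul x y =>
      simp only [BiHom.tensor_tmul, ract_tmul, BiHom.id_apply, B.delta.map_rsmul]
    | add x y hx hy => simp only [map_add, hx, hy]
  have h2 : ∀ c, ract B.carrier ((BiHom.id S _).tensor B.eps
      ((B.grd.parB 1).tensor B.delta (B.mu c))) = 0 := by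
    intro c
    have := B.counit_right (B.delta c)
    rw [B.coderivation, map_add, map_add, h1, B.counit_right] at this
    simpa using this
  have hτ : ∀ x, B.eps (B.grd.par 1 x) = B.eps x := by
    intro x
    have := Grd.par_comm (g := B.grd.toGrd) (h := (BGrd.unit S).toGrd) (f := B.eps) (d := 0)
      B.eps_deg 1 x
    rw [BGrd.unit_par] at this
    simpa using this.symm
  have h3 : ∀ z, B.eps (ract B.carrier ((BiHom.id S _).tensor B.eps
      ((B.grd.parB 1).tensor B.delta z))) =
      B.eps (B.delta (lact B.carrier (B.eps.tensor (BiHom.id S _) z))) := by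
    intro z
    induction z using BalTensor.induction with
    | tmul x y =>
      simp only [BiHom.tensor_tmul, ract_tmul, lact_tmul, BiHom.id_apply, B.delta.map_lsmul,
        B.eps.map_rsmul, B.eps.map_lsmul, BGrd.parB_apply, hτ, smul_eq_mul, op_smul_eq_mul]
    | add x y hx hy => simp only [map_add, hx, hy]
  have h4 := h3 (B.mu c)
  rw [h2, B.counit_left, map_zero] at h4
  exact h4.symm

/-- The strict morphism `M ⊗ C → M ⊗ S → M → N` given by an `S`-linear map `M → N`. -/
def strictMap (f : M →ₗ[Sᵐᵒᵖ] N) : BalTensor S M B.carrier →ₗ[Sᵐᵒᵖ] N :=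
  f ∘ₗ ract M ∘ₗ tmap LinearMap.id B.eps

@[simp] lemma strictMap_tmul (f : M →ₗ[Sᵐᵒᵖ] N) (m : M) (c : B.carrier) :
    strictMap (B := B) f (tmul S m c) = f (MulOpposite.op (B.eps c) • m) := rfl

lemma mem_unit {i : ℤ} {s : S} (hs : s ∈ (BGrd.unit S).gr i) : i = 0 ∨ s = 0 := by
  change s ∈ (if i = 0 then ⊤ else ⊥ : Submodule Sᵐᵒᵖ S) at hs
  by_cases h : i = 0
  · exact Or.inl h
  · rw [if_neg h] at hs
    exact Or.inr ((Submodule.mem_bot _).1 hs)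

/-- The strict morphism given by a homogeneous `S`-linear map. -/
def strict {d : ℤ} : GRMod.HomD M N d →+ B.GHom M N d where
  toFun f := ⟨strictMap f.1, homog_tensor fun i m hm j c hc => by
    have h1 := B.eps_deg j c hc
    rw [add_zero] at h1
    rw [strictMap_tmul]
    rcases mem_unit h1 with rfl | h2
    · rw [add_zero]
      exact f.2 i _ (Submodule.smul_mem _ _ hm)
    · rw [h2]; simp⟩
  map_zero' := Subtype.ext (tmul_ext fun m c => rfl)
  map_add' f g := Subtype.ext (tmul_ext fun m c => rfl)

lemma strict_tmul {d : ℤ} (f : GRMod.HomD M N d) (m : M) (c : B.carrier) :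
    (strict (B := B) f).1 (tmul S m c) = f.1 (MulOpposite.op (B.eps c) • m) := rfl

/-- The first component `m ↦ f (m ⊗ 1)` of a morphism. -/
def fst {d : ℤ} : B.GHom M N d →+ GRMod.HomD M N d where
  toFun f := ⟨{ toFun := fun m => f.1 (tmul S m B.one)
                map_add' := fun m m' => by rw [add_tmul, map_add]
                map_smul' := fun s m => by
                  rw [← MulOpposite.op_unop s, smul_tmul, B.lsmul_one, ← rsmul_tmul, map_smul,
                    RingHom.id_apply] },
    fun i m hm => f.2 i _ (Grd.tmul_mem hm B.one_mem (add_zero i))⟩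
  map_zero' := rfl
  map_add' _ _ := rfl

@[simp] lemma fst_apply {d : ℤ} (f : B.GHom M N d) (m : M) :
    (fst f).1 m = f.1 (tmul S m B.one) := rfl

lemma ghom_ext {d : ℤ} {f g : B.GHom M N d} (h : ∀ m c, f.1 (tmul S m c) = g.1 (tmul S m c)) :
    f = g := Subtype.ext (tmul_ext h)

lemma comp_tmul {d e n : ℤ} (f : B.GHom M N d) (g : B.GHom N L e) (h : d + e = n) (m : M)
    (c : B.carrier) :
    (comp f g h).1 (tmul S m c) = g.1 (tmap (curry f.1 m) (BiHom.id S _) (B.mu c)) :=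
  compMap_tmul f.1 g.1 m c

variable (B) in
/-- The differential graded category of graded right `B`-modules. -/
noncomputable def GMod : DGMod.{max u v, v, u} S where
  Hom := B.GHom
  comp := comp
  D := diff
  strict := strict
  fst := fst
  add_comp {M N L d e n} (f f' : B.GHom M N d) (g : B.GHom N L e) h := ghom_ext fun m c => by
    change _ = ((comp f g h).1 (tmul S m c) : L) + (comp f' g h).1 (tmul S m c)
    rw [comp_tmul, comp_tmul, comp_tmul, ← map_add]
    congr 1
    generalize B.mu c = z
    induction z using BalTensor.induction with
    | tmul x y => exact add_tmul ..
    | add x y hx hy => simp only [map_add, hx, hy]; abel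
  comp_add f g g' h := ghom_ext fun m c => rfl
  D_add f f' h := ghom_ext fun m c => smul_add (sgn _) (f.1 _) (f'.1 _)
  assoc {M N L P d e c' n₁ n₂ n} f g k h₁ h₂ h₃ h₄ := ghom_ext fun m c => by
    rw [comp_tmul, comp_tmul]
    let Θ : BalTensor S B.carrier (BalTensor S B.carrier B.carrier) →+ P :=
      (k.1 ∘ₗ tmap g.1 (BiHom.id S _) ∘ₗ tassocInv ∘ₗ
        tmap (curry f.1 m) (BiHom.id S _)).toAddMonoidHom
    have hΘ : ∀ x y z, Θ (tmul S x (tmul S y z)) =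
      k.1 (tmul S (g.1 (tmul S (f.1 (tmul S m x)) y)) z) := fun _ _ _ => rfl
    have c1 : ∀ y, k.1 (tmap (curry (comp f g h₁).1 m) (BiHom.id S _) y) =
        Θ (BiHom.assoc (B.mu.tensor (BiHom.id S _) y)) := by
      intro y
      induction y using BalTensor.induction with
      | tmul x y =>
        rw [tmap_tmul, curry_apply, comp_tmul, BiHom.tensor_tmul]
        generalize B.mu x = z
        induction z using BalTensor.induction with
        | tmul x y => rfl
        | add x y hx hy => simp only [map_add, add_tmul, hx, hy]
      | add x y hx hy => simp only [map_add, hx, hy]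
    have c2 : ∀ y, (comp g k h₃).1 (tmap (curry f.1 m) (BiHom.id S _) y) =
        Θ ((BiHom.id S _).tensor B.mu y) := by
      intro y
      induction y using BalTensor.induction with
      | tmul x y =>
        rw [tmap_tmul, curry_apply, comp_tmul, BiHom.tensor_tmul, BiHom.id_apply]
        generalize B.mu y = z
        induction z using BalTensor.induction with
        | tmul x y => rfl
        | add x y hx hy => simp only [map_add, tmul_add, hx, hy]
      | add x y hx hy => simp only [map_add, hx, hy]
    rw [c1, c2, B.coassoc]
  id_comp {M N d} f h := ghom_ext fun m c => by
    rw [comp_tmul]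
    have h1 : ∀ z, f.1 (tmap (curry (strict (B := B) (GRMod.HomD.id M)).1 m) (BiHom.id S _) z) =
        f.1 (tmul S m (lact _ (B.eps.tensor (BiHom.id S _) z))) := by
      intro z
      induction z using BalTensor.induction with
      | tmul x y =>
        rw [tmap_tmul, curry_apply, strict_tmul, GRMod.HomD.id_apply, smul_tmul]; rfl
      | add x y hx hy => simp only [map_add, tmul_add, hx, hy]
    rw [h1, B.counit_left]
  comp_id {M N d} f h := ghom_ext fun m c => by
    rw [comp_tmul]
    have h1 : ∀ z, (strict (B := B) (GRMod.HomD.id N)).1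
        (tmap (curry f.1 m) (BiHom.id S _) z) =
        f.1 (tmul S m (ract _ ((BiHom.id S _).tensor B.eps z))) := by
      intro z
      induction z using BalTensor.induction with
      | tmul x y =>
        rw [tmap_tmul, curry_apply, strict_tmul, GRMod.HomD.id_apply, BiHom.tensor_tmul,
          ract_tmul, ← rsmul_tmul, map_smul]; rfl
      | add x y hx hy => simp only [map_add, tmul_add, hx, hy]
    rw [h1, B.counit_right]
  strict_comp {M N L d e n} f g h := ghom_ext fun m c => by
    rw [comp_tmul, strict_tmul]
    have h1 : ∀ z, (strict (B := B) g).1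
        (tmap (curry (strict (B := B) f).1 m) (BiHom.id S _) z) =
        g.1 (f.1 (MulOpposite.op (B.eps (ract _ ((BiHom.id S _).tensor B.eps z))) • m)) := by
      intro z
      induction z using BalTensor.induction with
      | tmul x y =>
        rw [tmap_tmul, curry_apply, strict_tmul, strict_tmul, BiHom.tensor_tmul, ract_tmul,
          B.eps.map_rsmul, op_smul_eq_mul, MulOpposite.op_mul, mul_smul]
        simp only [BiHom.id_apply, map_smul]
      | add x y hx hy => simp only [map_add, MulOpposite.op_add, add_smul, hx, hy]
    rw [h1, B.counit_right]
    rfl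
  D_strict f h := ghom_ext fun m c => by
    rw [diff_tmul, strict_tmul, eps_delta]
    simp
  D_D f h h' := ghom_ext fun m c => by
    rw [diff_tmul, diff_tmul, B.delta_delta]
    simp
  leibniz {M N L d e n d' e' n'} f g h hd he hn h₁ h₂ := ghom_ext fun m c => by
    have e1 : ((comp f (diff g he) h₁ + sgn e • comp (diff f hd) g h₂).1) (tmul S m c) =
      (comp f (diff g he) h₁).1 (tmul S m c) + sgn e • (comp (diff f hd) g h₂).1 (tmul S m c) := rfl
    rw [e1, diff_tmul, comp_tmul, comp_tmul, comp_tmul, B.coderivation, map_add, map_add,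
      smul_add]
    have hτ : ∀ x, N.grd.par 1 (f.1 (tmul S m x)) =
        sgn d • f.1 (tmul S (M.grd.par 1 m) (B.grd.par 1 x)) := by
      intro x
      have := Grd.par_comm (f := f.1) f.2 1 (tmul S m x)
      rw [Grd.par_tensor, one_mul] at this
      exact this
    congr 1
    · generalize B.mu c = z
      induction z using BalTensor.induction with
      | tmul x y =>
        rw [BiHom.tensor_tmul, tmap_tmul, tmap_tmul, curry_apply, curry_apply, diff_tmul, hτ,
          zsmul_tmul, map_zsmul, smul_smul, ← sgn_add]
        congr 1
        apply sgn_congr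
        rw [← h]
        exact ⟨0, by ring⟩
      | add x y hx hy => simp only [map_add, smul_add, hx, hy]
    · generalize B.mu c = z
      induction z using BalTensor.induction with
      | tmul x y =>
        rw [BiHom.tensor_tmul, tmap_tmul, tmap_tmul, curry_apply, curry_apply, diff_tmul,
          zsmul_tmul, map_zsmul, smul_smul, ← sgn_add]
        congr 1
        apply sgn_congr
        rw [← h]
        exact ⟨0, by ring⟩
      | add x y hx hy => simp only [map_add, smul_add, hx, hy]
  fst_strict f := by
    ext m
    rw [fst_apply, strict_tmul, B.eps_one]
    simp
  fst_comp f g h := by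
    ext m
    rw [fst_apply, comp_tmul, B.mu_one]
    rfl

end Bocs

end

/-! ### A-infinity algebras and the bar construction -/

section

/-- An `A_∞`-algebra over `S`: a graded `S`-`S`-bimodule `A`, on which `k` acts centrally, with
morphisms of bimodules `m_n : A^{⊗n} → A` of degree `2 - n`, for `n ≥ 1`, satisfying the Stasheff
identities `∑_{r+s+t=n, s≥1} (-1)^{r+st} m_{r+1+t} (id^{⊗r} ⊗ m_s ⊗ id^{⊗t}) = 0`. For convenience
of indexing there is also `m_0 = 0`. -/
structure AInfAlg (k : Type w) [Field k] (S : Type u) [Ring S] [Algebra k S] where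
  carrier : Type u
  [addCommGroup : AddCommGroup carrier]
  [modL : Module S carrier]
  [modR : Module Sᵐᵒᵖ carrier]
  [comm : SMulCommClass S Sᵐᵒᵖ carrier]
  central : ∀ (c : k) (x : carrier),
    algebraMap k S c • x = MulOpposite.op (algebraMap k S c) • x
  grd : BGrd S carrier
  m : ∀ n, BiHom S (TP S carrier n) carrier
  m_zero : m 0 = 0
  m_deg : ∀ n : ℕ, BHomog (TPgr grd n) grd (2 - n) (m n)
  stasheff : ∀ (n : ℕ) (x : TP S carrier n),
    ∑ p ∈ Finset.HasAntidiagonal.antidiagonal n, ∑ q ∈ Finset.HasAntidiagonal.antidiagonal p.1,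
      sgn (q.1 + q.2 * p.2) •
        m (q.1 + 1 + p.2) (ins grd (m q.2) (2 - q.2) q.1 p.2 n x) = 0

attribute [instance] AInfAlg.addCommGroup AInfAlg.modL AInfAlg.modR AInfAlg.comm

variable {S : Type u} [Ring S]

section Susp

variable {V : Type u} [AddCommGroup V] [Module S V] [Module Sᵐᵒᵖ V] [SMulCommClass S Sᵐᵒᵖ V]
  (g : BGrd S V)

/-- The map `σ^{⊗n} : V^{⊗n} → V[1]^{⊗n}`, where `σ : V → V[1]` is the identity map, of degree `-1`.
By the Koszul sign rule, `σ^{⊗(n+1)} (w ⊗ a) = (-1)^{|w|} σ^{⊗n} w ⊗ σ a`. -/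
noncomputable def susp : ∀ n, BiHom S (TP S V n) (TP S V n)
  | 0 => BiHom.id S _
  | n + 1 => (TP.cons n).comp
      ((((susp n).comp ((TPgr g n).parB 1)).tensor (BiHom.id S V)).comp (TP.uncons n))

lemma susp_cons (n : ℕ) (w : TP S V n) (a : V) :
    susp g (n + 1) (TP.cons n (tmul S w a)) =
      TP.cons n (tmul S (susp g n ((TPgr g n).par 1 w)) a) := rfl

lemma susp_mem (n : ℕ) {i : ℤ} {w : TP S V n} (hw : w ∈ (TPgr g n).gr i) :
    susp g n w ∈ (TPgr g n).gr i := by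
  induction n generalizing i with
  | zero => exact hw
  | succ n ih =>
    refine TP.mem_succ_induction (P := fun z => susp g (n + 1) z ∈ _) ?_ ?_ ?_ hw
    · rintro p q rfl w hw a ha
      rw [susp_cons]
      exact TP.cons_mem (ih ((TPgr g n).par_mem 1 hw)) ha rfl
    · rw [map_zero]; exact zero_mem _
    · intro x y hx hy
      rw [map_add]; exact add_mem hx hy

lemma susp_par (n : ℕ) (e : ℤ) (w : TP S V n) :
    (TPgr g n).par e (susp g n w) = susp g n ((TPgr g n).par e w) := by
  have := Grd.par_comm (g := (TPgr g n).toGrd) (h := (TPgr g n).toGrd) (f := susp g n) (d := 0)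
    (fun i x hx => by rw [add_zero]; exact susp_mem g n hx) e w
  simpa using this

/-- The map `σ^{⊗n}` is its own inverse, since the underlying map of `σ` is the identity. -/
lemma susp_susp (n : ℕ) (w : TP S V n) : susp g n (susp g n w) = w := by
  induction n with
  | zero => rfl
  | succ n ih =>
    induction w using TP.induction_succ with
    | tmul w a =>
      rw [susp_cons, susp_cons, susp_par, ih, Grd.par_par,
        (TPgr g n).par_congr (n' := 0) ⟨1, by ring⟩, Grd.par_zero]
    | add x y hx hy => rw [map_add, map_add, hx, hy]

lemma mem_shift_iff (n : ℕ) (i : ℤ) (w : TP S V n) :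
    w ∈ (TPgr (g.shift 1) n).gr i ↔ w ∈ (TPgr g n).gr (i + n) := by
  induction n generalizing i with
  | zero => simp [TPgr]
  | succ n ih =>
    constructor
    · intro hw
      refine TP.mem_succ_induction (P := fun z => z ∈ (TPgr g (n + 1)).gr _) ?_ ?_ ?_ hw
      · rintro p q rfl w hw a ha
        exact TP.cons_mem ((ih _ _).1 hw) ha (by push_cast; ring)
      · exact zero_mem _
      · intro x y hx hy; exact add_mem hx hy
    · intro hw
      refine TP.mem_succ_induction (P := fun z => z ∈ (TPgr (g.shift 1) (n + 1)).gr _) ?_ ?_ ?_ hw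
      · rintro p q e w hw a ha
        refine TP.cons_mem (i := p - n) (j := q - 1) ((ih _ _).2 (by simpa using hw)) ?_ ?_
        · change a ∈ g.gr (q - 1 + 1)
          simpa using ha
        · push_cast at e; linarith
      · exact zero_mem _
      · intro x y hx hy; exact add_mem hx hy

lemma par_shift_TP (n : ℕ) (e : ℤ) (w : TP S V n) :
    (TPgr (g.shift 1) n).par e w = sgn (e * n) • (TPgr g n).par e w := by
  induction w using (TPgr g n).induction with
  | mem i w hw =>
    have h : w ∈ (TPgr (g.shift 1) n).gr (i - n) := (mem_shift_iff g n _ w).2 (by simpa using hw)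
    rw [(TPgr g n).par_of_mem e hw, (TPgr (g.shift 1) n).par_of_mem e h, smul_smul, ← sgn_add]
    apply congrArg (· • w)
    apply sgn_congr
    exact ⟨- (e * n), by ring⟩
  | add x y hx hy => simp only [map_add, smul_add, hx, hy]

/-- The total map `T → T` with components `susp`. -/
noncomputable def suspT : BiHom S (T S V) (T S V) := T.desc fun n => (T.ι n).comp (susp g n)

@[simp] lemma suspT_ι (n : ℕ) (w : TP S V n) : suspT g (T.ι n w) = T.ι n (susp g n w) :=
  T.desc_ι _ n w

lemma suspT_cat (x : T S V) (a : V) :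
    suspT g (T.cat (tmul S x a)) = T.cat (tmul S (suspT g ((T.grd g).par 1 x)) a) := by
  induction x using T.induction_ι with
  | h n w => rw [T.cat_ι, suspT_ι, susp_cons, T.par_ι, suspT_ι, T.cat_ι]
  | add x y hx hy => simp only [add_tmul, map_add, hx, hy]

/-- The auxiliary map `y ↦ σ(τ^s x) ⊗ σ(y)` for `y` of weight `s`. -/
noncomputable def suspAux (x : T S V) : T S V →+ BalTensor S (T S V) (T S V) :=
  DirectSum.toAddMonoid (fun s => AddMonoidHom.mk'
    (fun y : TP S V s => tmul S (suspT g ((T.grd g).par s x)) (T.ι s (susp g s y)))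
    (fun y y' => by rw [map_add, map_add, tmul_add]))

lemma suspAux_ι (x : T S V) (s : ℕ) (y : TP S V s) : suspAux g x (T.ι s y) =
    tmul S (suspT g ((T.grd g).par s x)) (T.ι s (susp g s y)) :=
  DirectSum.toAddMonoid_of _ s y

/-- The auxiliary map `x ⊗ y ↦ σ(τ^s x) ⊗ σ(y)` for `y` of weight `s`. -/
noncomputable def suspTT : BalTensor S (T S V) (T S V) →+ BalTensor S (T S V) (T S V) :=
  lift₂ S (fun x y => suspAux g x y)
    (fun x x' y => by
      induction y using T.induction_ι with
      | h n w => simp only [suspAux_ι, map_add, add_tmul]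
      | add x y hx hy => simp only [map_add, hx, hy]; abel)
    (fun _ _ _ => map_add _ _ _)
    (fun x s y => by
      induction y using T.induction_ι with
      | h n w =>
        rw [suspAux_ι, ← (T.ι n).map_lsmul, suspAux_ι, map_smul, (suspT g).map_rsmul, smul_tmul,
          (susp g n).map_lsmul, (T.ι n).map_lsmul]
      | add x y hx hy => simp only [smul_add, map_add, hx, hy])

lemma suspTT_ι (x : T S V) (s : ℕ) (y : TP S V s) : suspTT g (tmul S x (T.ι s y)) =
    tmul S (suspT g ((T.grd g).par s x)) (T.ι s (susp g s y)) := suspAux_ι g x s y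

lemma deconc_suspT (x : T S V) : T.deconc (suspT g x) = suspTT g (T.deconc x) := by
  induction x using T.ind with
  | nil s =>
    rw [suspT_ι, T.deconc_nil, T.one, suspTT_ι, Nat.cast_zero, Grd.par_zero, suspT_ι]
    exact T.deconc_nil s
  | cat x a ih =>
    have h1 : ∀ z, suspTT g (T.tensorL (T.catR a) z) = T.tensorL (T.catR a)
        (suspTT g (((T.grd g).parB 1).tensor ((T.grd g).parB 1) z)) := by
      intro z
      induction z using BalTensor.induction with
      | tmul x y =>
        induction y using T.induction_ι with
        | h n w =>
          rw [T.tensorL_tmul, T.catR_apply, T.cat_ι, suspTT_ι, BiHom.tensor_tmul,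
            BGrd.parB_apply, BGrd.parB_apply, T.par_ι, suspTT_ι, T.tensorL_tmul, T.catR_apply,
            T.cat_ι, Grd.par_par, susp_cons]
          push_cast
          rfl
        | add x y hx hy => simp only [tmul_add, map_add, hx, hy]
      | add x y hx hy => simp only [map_add, hx, hy]
    have h2 : suspTT g (T.deconc ((T.grd g).par 1 x)) = T.deconc (suspT g ((T.grd g).par 1 x)) := by
      have h3 : suspT g ((T.grd g).par 1 x) = (T.grd g).par 1 (suspT g x) := by
        clear ih
        induction x using T.induction_ι with
        | h n w => rw [T.par_ι, suspT_ι, suspT_ι, T.par_ι, susp_par]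
        | add x y hx hy => simp only [map_add, hx, hy]
      rw [h3, T.deconc_par, T.deconc_par, ih]
      generalize T.deconc x = z
      induction z using BalTensor.induction with
      | tmul x y =>
        induction y using T.induction_ι with
        | h n w =>
          have h4 : ∀ x, suspT g ((T.grd g).par 1 x) = (T.grd g).par 1 (suspT g x) := by
            intro x
            induction x using T.induction_ι with
            | h n w => rw [T.par_ι, suspT_ι, suspT_ι, T.par_ι, susp_par]
            | add x y hx hy => simp only [map_add, hx, hy]
          rw [suspTT_ι, BiHom.tensor_tmul, BiHom.tensor_tmul, BGrd.parB_apply, BGrd.parB_apply,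
            BGrd.parB_apply, BGrd.parB_apply, T.par_ι, suspTT_ι, T.par_ι, susp_par, ← h4,
            Grd.par_par, Grd.par_par, add_comm]
        | add x y hx hy => simp only [tmul_add, map_add, hx, hy]
      | add x y hx hy => simp only [map_add, hx, hy]
    rw [suspT_cat, T.deconc_cat, T.deconc_cat, map_add, h1, ← T.deconc_par, h2]
    congr 1
    rw [T.one, suspTT_ι, Nat.cast_zero, Grd.par_zero, suspT_cat]
    rfl
  | add x y hx hy => simp only [map_add, hx, hy]

/-- Compatibility of `σ^{⊗n}` with the decomposition `V^{⊗(q+s)} = V^{⊗q} ⊗ V^{⊗s}`. -/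
lemma split_susp (n q s : ℕ) (w : TP S V n) : split V n q s (susp g n w) =
    ((susp g q).comp ((TPgr g q).parB s)).tensor (susp g s) (split V n q s w) := by
  change (T.π q).tensor (T.π s) (T.deconc (T.ι n (susp g n w))) =
    ((susp g q).comp ((TPgr g q).parB s)).tensor (susp g s)
      ((T.π q).tensor (T.π s) (T.deconc (T.ι n w)))
  rw [← suspT_ι, deconc_suspT]
  generalize T.deconc (T.ι n w) = z
  induction z using BalTensor.induction with
  | tmul x y =>
    induction y using T.induction_ι with
    | h j v =>
      rw [suspTT_ι]
      simp only [BiHom.tensor_tmul]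
      by_cases hs : j = s
      · subst hs
        rw [T.π_ι, T.π_ι]
        congr 1
        induction x using T.induction_ι with
        | h i u =>
          rw [T.par_ι, suspT_ι]
          by_cases hq : i = q
          · subst hq
            rw [T.π_ι, T.π_ι]; rfl
          · rw [T.π_ι_ne hq, T.π_ι_ne hq, map_zero]
        | add x y hx hy => simp only [map_add, hx, hy]
      · rw [T.π_ι_ne hs, T.π_ι_ne hs, map_zero, tmul_zero, tmul_zero]
    | add x y hx hy => simp only [tmul_add, map_add, hx, hy]
  | add x y hx hy => simp only [map_add, hx, hy]

lemma split_mem (n q s : ℕ) {i : ℤ} {w : TP S V n} (hw : w ∈ (TPgr g n).gr i) :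
    split V n q s w ∈ ((TPgr g q).tensor (TPgr g s)).gr i := by
  change (T.π q).tensor (T.π s) (T.deconc (T.ι n w)) ∈ _
  refine Grd.tensorGr_induction (P := fun z => (T.π q).tensor (T.π s) z ∈
    ((TPgr g q).tensor (TPgr g s)).gr i) ?_ ?_ ?_ (T.deconc_mem g (T.ι_mem hw))
  · rintro a b rfl x hx y hy
    exact Grd.tmul_mem (hx q) (hy s) rfl
  · rw [map_zero]; exact zero_mem _
  · intro x y hx hy
    rw [map_add]; exact add_mem hx hy

variable {g} in
lemma ins_mem {s : ℕ} {φ : BiHom S (TP S V s) V} {e : ℤ} (hφ : BHomog (TPgr g s) g e φ)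
    (r t n : ℕ) : BHomog (TPgr g n) (TPgr g (r + 1 + t)) e (ins g φ e r t n) := by
  induction t generalizing n with
  | zero =>
    intro i w hw
    change TP.cons r (((TPgr g r).parB e).tensor φ (split V n r s w)) ∈ (TPgr g (r + 1)).gr (i + e)
    refine Grd.tensorGr_induction (P := fun z => TP.cons r (((TPgr g r).parB e).tensor φ z) ∈
      (TPgr g (r + 1)).gr (i + e)) ?_ ?_ ?_ (split_mem g n r s hw)
    · rintro a b rfl x hx y hy
      exact TP.cons_mem ((TPgr g r).par_mem e hx) (hφ b y hy) (by ring)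
    · rw [map_zero, map_zero]; exact zero_mem _
    · intro x y hx hy
      rw [map_add, map_add]; exact add_mem hx hy
  | succ t ih =>
    intro i w hw
    cases n with
    | zero => exact zero_mem _
    | succ n =>
      refine TP.mem_succ_induction (P := fun z => ins g φ e r (t + 1) (n + 1) z ∈
        (TPgr g (r + 1 + t + 1)).gr (i + e)) ?_ ?_ ?_ hw
      · rintro a b rfl x hx y hy
        rw [ins_succ]
        exact TP.cons_mem (ih n a x hx) hy (by ring)
      · rw [map_zero]; exact zero_mem _
      · intro x y hx hy
        rw [map_add]; exact add_mem hx hy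

variable {g} in
lemma ins_congr {s : ℕ} (φ : BiHom S (TP S V s) V) {e e' : ℤ} (h : Even (e - e')) (r t n : ℕ) :
    ins g φ e r t n = ins g φ e' r t n := by
  induction t generalizing n with
  | zero =>
    have : (TPgr g r).parB e = (TPgr g r).parB e' := by
      ext x
      rw [BGrd.parB_apply, BGrd.parB_apply, (TPgr g r).par_congr h]
    unfold ins
    rw [this]
  | succ t ih =>
    cases n with
    | zero => rfl
    | succ n => unfold ins; rw [ih]

variable {g} in
/-- Compatibility of `id ⊗ m_s ⊗ id` with the suspensions. -/
lemma susp_ins {s : ℕ} {φ : BiHom S (TP S V s) V} (hφ : BHomog (TPgr g s) g (2 - s) φ)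
    (r t n : ℕ) (w : TP S V n) :
    susp g (r + 1 + t) (ins (g.shift 1) (φ.comp (susp g s)) 1 r t n w) =
      sgn (r + s * t) • ins g φ (2 - s) r t n (susp g n w) := by
  induction t generalizing n with
  | zero =>
    rw [ins_congr (g := g) φ (e' := s) ⟨1 - s, by ring⟩]
    change susp g (r + 1) (TP.cons r (((TPgr (g.shift 1) r).parB 1).tensor (φ.comp (susp g s))
      (split V n r s w))) = sgn (r + s * (0 : ℕ)) •
      TP.cons r (((TPgr g r).parB s).tensor φ (split V n r s (susp g n w)))
    rw [split_susp]
    generalize split V n r s w = z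
    induction z using BalTensor.induction with
    | tmul x y =>
      simp only [BiHom.tensor_tmul, BGrd.parB_apply, BiHom.comp_apply]
      rw [par_shift_TP, susp_cons, susp_par, Grd.par_par,
        (TPgr g r).par_congr (n := s + s) (n' := 0) ⟨s, by ring⟩, Grd.par_zero, map_zsmul,
        Grd.par_par, (TPgr g r).par_congr (n := 1 + 1) (n' := 0) ⟨1, by ring⟩, Grd.par_zero,
        map_zsmul, zsmul_tmul, map_zsmul]
      congr 2
      push_cast; ring
    | add x y hx hy => simp only [map_add, smul_add, hx, hy]
  | succ t ih =>
    cases n with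
    | zero => exact (map_zero _).trans (smul_zero _).symm
    | succ n =>
      induction w using TP.induction_succ with
      | tmul w a =>
        rw [ins_succ, susp_cons, ins_succ]
        change TP.cons (r + 1 + t) (tmul S (susp g (r + 1 + t) ((TPgr g (r + 1 + t)).par 1
          (ins (g.shift 1) (φ.comp (susp g s)) 1 r t n w))) a) = _
        rw [← susp_par, ih, map_zsmul,
          Grd.par_comm (f := ins g φ (2 - s) r t n) (ins_mem hφ r t n) 1, ← susp_par,
          smul_smul, zsmul_tmul, map_zsmul, ← sgn_add]
        congr 1
        apply sgn_congr
        exact ⟨1 - s, by push_cast; ring⟩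
      | add x y hx hy => simp only [map_add, smul_add, hx, hy]

end Susp

namespace AInfAlg

variable {k : Type w} [Field k] [Algebra k S] (A : AInfAlg k S)

/-- The operation `m̂_n = σ m_n (σ^{⊗n})⁻¹ : A[1]^{⊗n} → A[1]`. -/
noncomputable def mhat (n : ℕ) : BiHom S (TP S A.carrier n) A.carrier :=
  (A.m n).comp (susp A.grd n)

lemma mhat_zero : A.mhat 0 = 0 := by
  rw [mhat, A.m_zero]; rfl

lemma mhat_deg (n : ℕ) : BHomog (TPgr (A.grd.shift 1) n) (A.grd.shift 1) 1 (A.mhat n) := by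
  intro i w hw
  have h := A.m_deg n _ _ (susp_mem A.grd n ((mem_shift_iff A.grd n i w).1 hw))
  have e : i + n + (2 - n) = i + 1 + 1 := by ring
  rw [e] at h
  exact h

lemma mhat_coder (x : T S A.carrier) :
    T.desc A.mhat (coder (A.grd.shift 1) A.mhat x) = 0 := by
  induction x using T.induction_ι with
  | h n w =>
    rw [T.coder_ι, map_sum, ← A.stasheff n (susp A.grd n w)]
    refine Finset.sum_congr rfl fun p _ => ?_
    rw [map_sum]
    refine Finset.sum_congr rfl fun q _ => ?_
    rw [T.desc_ι]
    change A.m _ (susp A.grd _ (ins (A.grd.shift 1) ((A.m q.2).comp (susp A.grd q.2)) 1 q.1 p.2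
      n w)) = _
    rw [susp_ins (A.m_deg q.2), map_zsmul]
  | add x y hx hy => rw [map_add, map_add, hx, hy, add_zero]

/-- The bocs `B_A` of an `A_∞`-algebra: the tensor coalgebra `T_S(A[1])` with the deconcatenation
coproduct, the projection to `S` as counit, and the differential with components
`∑ id^{⊗r} ⊗ m̂_s ⊗ id^{⊗t}`. -/
noncomputable abbrev bar : Bocs.{u} S where
  carrier := T S A.carrier
  grd := T.grd (A.grd.shift 1)
  mu := T.deconc
  eps := T.counit A.carrier
  delta := coder (A.grd.shift 1) A.mhat
  mu_deg i x hx := by rw [add_zero]; exact T.deconc_mem _ hx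
  eps_deg i x hx := by rw [add_zero]; exact hx 0
  delta_deg i x hx := T.coder_mem A.mhat_zero A.mhat_deg hx
  coassoc := T.coassoc
  counit_right x := by
    induction x using T.ind with
    | nil s =>
      rw [T.deconc_nil, BiHom.tensor_tmul, T.counit_one, ract_tmul]
      simp
    | cat x a ih =>
      have h1 : ∀ z : BalTensor S (T S A.carrier) (T S A.carrier),
          (BiHom.id S _).tensor (T.counit A.carrier) (T.tensorL (T.catR a) z) = 0 := by
        intro z
        induction z using BalTensor.induction with
        | tmul x y => simp
        | add x y hx hy => simp only [map_add, hx, hy, add_zero]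
      rw [T.deconc_cat, map_add, h1, add_zero, BiHom.tensor_tmul, T.counit_one, ract_tmul]
      simp
    | add x y hx hy => simp only [map_add, hx, hy]
  counit_left x := by
    induction x using T.ind with
    | nil s =>
      rw [T.deconc_nil, BiHom.tensor_tmul, T.counit_nil, lact_tmul, BiHom.id_apply, T.lsmul_one]
    | cat x a ih =>
      have h1 : ∀ z : BalTensor S (T S A.carrier) (T S A.carrier),
          lact _ ((T.counit A.carrier).tensor (BiHom.id S _) (T.tensorL (T.catR a) z)) =
          T.catR a (lact _ ((T.counit A.carrier).tensor (BiHom.id S _) z)) := by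
        intro z
        induction z using BalTensor.induction with
        | tmul x y =>
          rw [T.tensorL_tmul, BiHom.tensor_tmul, BiHom.tensor_tmul, lact_tmul, lact_tmul,
            map_smul]; rfl
        | add x y hx hy => simp only [map_add, hx, hy]
      rw [T.deconc_cat, map_add, map_add, h1, ih, BiHom.tensor_tmul, T.counit_cat, zero_tmul,
        map_zero, zero_add]; rfl
    | add x y hx hy => simp only [map_add, hx, hy]
  coderivation := T.deconc_coder _ _ A.mhat_zero
  delta_delta := T.coder_coder A.mhat_zero A.mhat_deg A.mhat_coder
  one := T.one S A.carrier
  one_mem := T.one_mem _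
  lsmul_one s := by rw [T.lsmul_one, T.rsmul_one]
  eps_one := T.counit_one
  mu_one := T.deconc_one

end AInfAlg

end

/-! ### Graded modules over an A-infinity algebra -/

section

variable {S : Type u} [Ring S]

section MDesc

variable {V : Type u} [AddCommGroup V] [Module S V] [Module Sᵐᵒᵖ V] [SMulCommClass S Sᵐᵒᵖ V]
  {M : Type*} [AddCommGroup M] [Module Sᵐᵒᵖ M] {N : Type*} [AddCommGroup N] [Module Sᵐᵒᵖ N]

/-- Auxiliary map for `mdesc`. -/
def mdescAux (F : ∀ p, BalTensor S M (TP S V p) →ₗ[Sᵐᵒᵖ] N) (m : M) : T S V →ₗ[Sᵐᵒᵖ] N :=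
  DirectSum.toModule Sᵐᵒᵖ ℕ N (fun p => curry (F p) m)

lemma mdescAux_ι (F : ∀ p, BalTensor S M (TP S V p) →ₗ[Sᵐᵒᵖ] N) (m : M) (p : ℕ) (w : TP S V p) :
    mdescAux F m (T.ι p w) = F p (tmul S m w) := DirectSum.toModule_lof Sᵐᵒᵖ p w

/-- The map `M ⊗ T → N` given by a family of maps `M ⊗ V^{⊗p} → N`. -/
def mdesc (F : ∀ p, BalTensor S M (TP S V p) →ₗ[Sᵐᵒᵖ] N) :
    BalTensor S M (T S V) →ₗ[Sᵐᵒᵖ] N where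
  toFun := lift₂ S (fun m t => mdescAux F m t)
    (fun m m' t => by
      induction t using T.induction_ι with
      | h n w => simp only [mdescAux_ι, add_tmul, map_add]
      | add x y hx hy => simp only [map_add, hx, hy]; abel)
    (fun _ _ _ => map_add _ _ _)
    (fun m s t => by
      induction t using T.induction_ι with
      | h n w => rw [mdescAux_ι, ← (T.ι n).map_lsmul, mdescAux_ι, smul_tmul]
      | add x y hx hy => simp only [smul_add, map_add, hx, hy])
  map_add' := map_add _
  map_smul' s z := by
    induction z using BalTensor.induction with
    | tmul m t => rw [rsmul_tmul, lift₂_tmul, lift₂_tmul, map_smul]; rfl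
    | add x y hx hy => simp only [smul_add, map_add, hx, hy]

lemma mdesc_ι (F : ∀ p, BalTensor S M (TP S V p) →ₗ[Sᵐᵒᵖ] N) (m : M) (p : ℕ) (w : TP S V p) :
    mdesc F (tmul S m (T.ι p w)) = F p (tmul S m w) := mdescAux_ι F m p w

end MDesc

namespace AInfAlg

variable {k : Type w} [Field k] [Algebra k S] (A : AInfAlg k S)

/-- The morphisms `M → N` of degree `d` in the category of graded `A`-modules: families of maps
`f_p : M ⊗ A^{⊗p} → N`, `p ≥ 0`, of graded right `S`-modules, where `f_p` has degree `d - p`. -/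
def GHom (M N : GRMod.{v} S) (d : ℤ) :
    AddSubgroup (∀ p : ℕ, BalTensor S M (TP S A.carrier p) →ₗ[Sᵐᵒᵖ] N) where
  carrier := {f | ∀ p : ℕ, f p ∈ Homog (M.grd.tensor (TPgr A.grd p)) N.grd (d - p)}
  zero_mem' _ := zero_mem _
  add_mem' hf hg p := add_mem (hf p) (hg p)
  neg_mem' hf p := neg_mem (hf p)

variable {A} {M N L P : GRMod.{v} S}

lemma ghom_ext {d : ℤ} {f g : A.GHom M N d}
    (h : ∀ p m w, f.1 p (tmul S m w) = g.1 p (tmul S m w)) : f = g :=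
  Subtype.ext (funext fun p => tmul_ext (h p))

/-- The composition: `(g ∘ f)_p = ∑_{q+s=p} (-1)^{(d+q)s} g_s (f_q ⊗ id^{⊗s})`, where `f` has
degree `d`. -/
def comp {d e n : ℤ} (f : A.GHom M N d) (g : A.GHom N L e) (h : d + e = n) : A.GHom M L n :=
  ⟨fun p => ∑ q ∈ Finset.HasAntidiagonal.antidiagonal p, sgn ((d + q.1) * q.2) •
      (g.1 q.2 ∘ₗ tmap (f.1 q.1) (BiHom.id S _) ∘ₗ tassocInv ∘ₗ
        tmap LinearMap.id (split A.carrier p q.1 q.2)),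
    fun p => sum_mem fun q hq => zsmul_mem (by
      refine homog_tensor fun i m hm j w hw => ?_
      rw [Finset.HasAntidiagonal.mem_antidiagonal] at hq
      change g.1 q.2 (tmap (f.1 q.1) (BiHom.id S _) (tassocInv (tmul S m
        (split A.carrier p q.1 q.2 w)))) ∈ _
      refine Grd.tensorGr_induction (P := fun z => g.1 q.2 (tmap (f.1 q.1) (BiHom.id S _)
        (tassocInv (tmul S m z))) ∈ L.grd.gr (i + j + (n - p))) ?_ ?_ ?_
        (split_mem A.grd p q.1 q.2 hw)
      · rintro a b rfl x hx y hy
        have h2 := f.2 q.1 _ _ (Grd.tmul_mem hm hx rfl)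
        have h3 := g.2 q.2 _ _ (Grd.tmul_mem h2 hy rfl)
        have e : i + a + (d - q.1) + b + (e - q.2) = i + (a + b) + (n - p) := by
          rw [← h, ← hq]; push_cast; ring
        rw [← e]
        exact h3
      · simp
      · intro x y hx hy
        rw [tmul_add, map_add, map_add, map_add]; exact add_mem hx hy) _⟩

lemma comp_tmul {d e n : ℤ} (f : A.GHom M N d) (g : A.GHom N L e) (h : d + e = n) (p : ℕ) (m : M)
    (w : TP S A.carrier p) :
    (comp f g h).1 p (tmul S m w) = ∑ q ∈ Finset.HasAntidiagonal.antidiagonal p,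
      sgn ((d + q.1) * q.2) • g.1 q.2 (tmap (curry (f.1 q.1) m) (BiHom.id S _)
        (split A.carrier p q.1 q.2 w)) := by
  change (∑ q ∈ Finset.HasAntidiagonal.antidiagonal p, sgn ((d + q.1) * q.2) •
      (g.1 q.2 ∘ₗ tmap (f.1 q.1) (BiHom.id S _) ∘ₗ tassocInv ∘ₗ
        tmap LinearMap.id (split A.carrier p q.1 q.2))) (tmul S m w) = _
  rw [LinearMap.sum_apply]
  refine Finset.sum_congr rfl fun q _ => ?_
  change sgn _ • g.1 q.2 (tmap (f.1 q.1) (BiHom.id S _) (tassocInv (tmul S m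
    (split A.carrier p q.1 q.2 w)))) = _
  congr 2
  generalize split A.carrier p q.1 q.2 w = z
  induction z using BalTensor.induction with
  | tmul x y => rfl
  | add x y hx hy => simp only [tmul_add, map_add, hx, hy]

/-- The differential:
`δ(f)_p = ∑_{r+s+t=p} (-1)^{d+r+st} f_{r+1+t} (id_M ⊗ id^{⊗r} ⊗ m_s ⊗ id^{⊗t})`, where `f` has
degree `d`. -/
noncomputable def diff {d e : ℤ} (f : A.GHom M N d) (h : d + 1 = e) : A.GHom M N e :=
  ⟨fun p => ∑ x ∈ Finset.HasAntidiagonal.antidiagonal p,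
      ∑ y ∈ Finset.HasAntidiagonal.antidiagonal x.1, sgn (d + y.1 + y.2 * x.2) •
        (f.1 (y.1 + 1 + x.2) ∘ₗ
          tmap (M.grd.par (2 - y.2)) (ins A.grd (A.m y.2) (2 - y.2) y.1 x.2 p)),
    fun p => sum_mem fun x hx => sum_mem fun y hy => zsmul_mem (by
      refine homog_tensor fun i m hm j w hw => ?_
      rw [Finset.HasAntidiagonal.mem_antidiagonal] at hx hy
      have h1 := f.2 (y.1 + 1 + x.2) _ _ (Grd.tmul_mem (M.grd.par_mem (2 - y.2) hm)
        (ins_mem (A.m_deg y.2) y.1 x.2 p j w hw) rfl)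
      have e : i + (j + (2 - y.2)) + (d - (y.1 + 1 + x.2 : ℕ)) = i + j + (e - p) := by
        rw [← h, ← hx, ← hy]; push_cast; ring
      rw [← e]
      exact h1) _⟩

lemma diff_tmul {d e : ℤ} (f : A.GHom M N d) (h : d + 1 = e) (p : ℕ) (m : M)
    (w : TP S A.carrier p) :
    (diff f h).1 p (tmul S m w) = ∑ x ∈ Finset.HasAntidiagonal.antidiagonal p,
      ∑ y ∈ Finset.HasAntidiagonal.antidiagonal x.1, sgn (d + y.1 + y.2 * x.2) •
        f.1 (y.1 + 1 + x.2) (tmul S (M.grd.par (2 - y.2) m)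
          (ins A.grd (A.m y.2) (2 - y.2) y.1 x.2 p w)) := by
  change (∑ x ∈ Finset.HasAntidiagonal.antidiagonal p,
      ∑ y ∈ Finset.HasAntidiagonal.antidiagonal x.1, sgn (d + y.1 + y.2 * x.2) •
        (f.1 (y.1 + 1 + x.2) ∘ₗ
          tmap (M.grd.par (2 - y.2)) (ins A.grd (A.m y.2) (2 - y.2) y.1 x.2 p))) (tmul S m w) = _
  rw [LinearMap.sum_apply]
  refine Finset.sum_congr rfl fun x _ => ?_
  rw [LinearMap.sum_apply]
  rfl

/-- The components of a strict morphism: `f_0 (m ⊗ s) = f (m s)` and `f_p = 0` for `p ≥ 1`. -/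
def strictMap (A : AInfAlg k S) (f : M →ₗ[Sᵐᵒᵖ] N) :
    ∀ p, BalTensor S M (TP S A.carrier p) →ₗ[Sᵐᵒᵖ] N
  | 0 => f ∘ₗ ract M ∘ₗ tmap LinearMap.id (TP.unnil A.carrier)
  | _ + 1 => 0

/-- The strict morphism given by a homogeneous `S`-linear map. -/
def strict {d : ℤ} : GRMod.HomD M N d →+ A.GHom M N d where
  toFun f := ⟨strictMap A f.1, fun p => by
    cases p with
    | zero =>
      refine homog_tensor fun i m hm j c hc => ?_
      change f.1 (MulOpposite.op (TP.unnil A.carrier c) • m) ∈ _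
      rcases Bocs.mem_unit (s := TP.unnil A.carrier c) hc with rfl | h2
      · rw [add_zero, Nat.cast_zero, sub_zero]
        exact f.2 i _ (Submodule.smul_mem _ _ hm)
      · rw [h2]; simp
    | succ p => exact zero_mem _⟩
  map_zero' := ghom_ext fun p m w => by
    cases p with
    | zero => rfl
    | succ p => rfl
  map_add' f g := ghom_ext fun p m w => by
    cases p with
    | zero => rfl
    | succ p => exact (add_zero _).symm

/-- The first component `m ↦ f_0 (m ⊗ 1)` of a morphism. -/
def fst {d : ℤ} : A.GHom M N d →+ GRMod.HomD M N d where
  toFun f := ⟨{ toFun := fun m => f.1 0 (tmul S m (TP.nil A.carrier 1))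
                map_add' := fun m m' => by rw [add_tmul, map_add]
                map_smul' := fun s m => by
                  rw [← MulOpposite.op_unop s, smul_tmul, ← (TP.nil A.carrier).map_lsmul,
                    RingHom.id_apply, ← map_smul, rsmul_tmul, ← (TP.nil A.carrier).map_rsmul]
                  simp },
    fun i m hm => by
      have := f.2 0 i _ (Grd.tmul_mem hm (TP.nil_mem A.grd 1) (add_zero i))
      rwa [Nat.cast_zero, sub_zero] at this⟩
  map_zero' := rfl
  map_add' _ _ := rfl

/-- The map `σ_M ⊗ σ^{⊗p} : M ⊗ A^{⊗p} → M[1] ⊗ A[1]^{⊗p}`, with the sign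
`m ⊗ w ↦ (-1)^{p|m|} σ m ⊗ σ^{⊗p} w` since `σ^{⊗p}` has degree `-p`. -/
noncomputable def suspM (A : AInfAlg k S) (M : GRMod.{v} S) (p : ℕ) :
    BalTensor S M (TP S A.carrier p) →ₗ[Sᵐᵒᵖ] BalTensor S M (TP S A.carrier p) :=
  tmap (M.grd.par p) (susp A.grd p)

/-- The map `σ_M ⊗ σ^{⊗p}` is its own inverse. -/
lemma suspM_suspM (p : ℕ) (z) : suspM A M p (suspM A M p z) = z := by
  induction z using BalTensor.induction with
  | tmul m w =>
    change tmul S (M.grd.par p (M.grd.par p m)) (susp A.grd p (susp A.grd p w)) = _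
    rw [susp_susp, Grd.par_par, M.grd.par_congr (n' := 0) ⟨p, by ring⟩, Grd.par_zero]
  | add x y hx hy => rw [map_add, map_add, hx, hy]

/-- The morphism `f̂ : M[1] ⊗ T_S(A[1]) → N[1]` of graded `B_A`-modules associated with a morphism
`f : M → N`. Its components satisfy `f̂_p (σ_M ⊗ σ^{⊗p}) = σ_N f_p`. -/
noncomputable def hat {d : ℤ} : A.GHom M N d →+ A.bar.GHom (M.shift 1) (N.shift 1) d where
  toFun f := ⟨mdesc (fun p => f.1 p ∘ₗ suspM A M p), homog_tensor fun i m hm j x hx => by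
    obtain ⟨s, hs⟩ := T.sum_ι_π x
    have hx' : ∀ n, T.π n x ∈ (TPgr (A.grd.shift 1) n).gr j := hx
    change mdesc (fun p => f.1 p ∘ₗ suspM A M p) (tmul S m x) ∈ N.grd.gr (i + j + d + 1)
    rw [hs, tmul_sum, map_sum]
    refine sum_mem fun n _ => ?_
    rw [mdesc_ι]
    have h1 := f.2 n _ _ (Grd.tmul_mem (M.grd.par_mem n hm)
      (susp_mem A.grd n ((mem_shift_iff A.grd n j _).1 (hx' n))) rfl)
    have e : i + 1 + (j + n) + (d - n) = i + j + d + 1 := by ring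
    rw [e] at h1
    exact h1⟩
  map_zero' := Bocs.ghom_ext fun m c => by
    change mdesc _ (tmul S m c) = 0
    induction c using T.induction_ι with
    | h n w => rw [mdesc_ι]; rfl
    | add x y hx hy => rw [tmul_add, map_add, hx, hy, add_zero]
  map_add' f g := Bocs.ghom_ext fun m c => by
    change mdesc _ (tmul S m c) = mdesc (fun p => f.1 p ∘ₗ suspM A M p) (tmul S m c) +
      mdesc (fun p => g.1 p ∘ₗ suspM A M p) (tmul S m c)
    induction c using T.induction_ι with
    | h n w => rw [mdesc_ι, mdesc_ι, mdesc_ι]; rfl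
    | add x y hx hy => rw [tmul_add, map_add, map_add, map_add, hx, hy]; abel

lemma hat_ι {d : ℤ} (f : A.GHom M N d) (p : ℕ) (m : M) (w : TP S A.carrier p) :
    (hat f).1 (tmul S m (T.ι p w)) = f.1 p (tmul S (M.grd.par p m) (susp A.grd p w)) :=
  mdesc_ι _ m p w

/-- The defining property of `f̂`. -/
lemma hat_susp {d : ℤ} (f : A.GHom M N d) (p : ℕ) (z : BalTensor S M (TP S A.carrier p)) :
    (hat f).1 (tmap LinearMap.id (T.ι p) (suspM A M p z)) = f.1 p z := by
  induction z using BalTensor.induction with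
  | tmul m w =>
    change (hat f).1 (tmul S (M.grd.par p m) (T.ι p (susp A.grd p w))) = _
    rw [hat_ι]
    exact congrArg (f.1 p) (suspM_suspM p (tmul S m w))
  | add x y hx hy =>
    rw [map_add, map_add, map_add (f.1 p), ← hx, ← hy]
    exact map_add (hat f).1 _ _

lemma hat_injective {d : ℤ} {f g : A.GHom M N d} (h : hat f = hat g) : f = g :=
  ghom_ext fun p m w => by rw [← hat_susp f, h, hat_susp]

lemma hat_ext {d : ℤ} {f g : A.bar.GHom (M.shift 1) (N.shift 1) d}
    (h : ∀ m p w, f.1 (tmul S m (T.ι p w)) = g.1 (tmul S m (T.ι p w))) : f = g :=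
  Bocs.ghom_ext fun m c => by
    induction c using T.induction_ι with
    | h n w => exact h m n w
    | add x y hx hy =>
      have e : ∀ f : A.bar.GHom (M.shift 1) (N.shift 1) d,
        f.1 (tmul S m (x + y)) = f.1 (tmul S m x) + f.1 (tmul S m y) := fun f => by
          rw [← map_add]; exact congrArg f.1 (tmul_add S m x y)
      rw [e, e, hx, hy]

lemma hat_comp {d e n : ℤ} (f : A.GHom M N d) (g : A.GHom N L e) (h : d + e = n) :
    hat (comp f g h) = Bocs.comp (hat f) (hat g) h := hat_ext fun m p w => by
  rw [hat_ι, comp_tmul, Bocs.comp_tmul]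
  change _ = (hat g).1 (tmap _ (BiHom.id S _) (T.deconc (T.ι p w)))
  rw [T.deconc_ι, map_sum, map_sum]
  refine Finset.sum_congr rfl fun q hq => ?_
  rw [Finset.HasAntidiagonal.mem_antidiagonal] at hq
  rw [split_susp]
  generalize split A.carrier p q.1 q.2 w = z
  induction z using BalTensor.induction with
  | tmul x y =>
    have hτ := Grd.par_comm (f := f.1 q.1) (f.2 q.1) q.2
      (tmul S (M.grd.par q.1 m) (susp A.grd q.1 x))
    change sgn ((d + q.1) * q.2) • g.1 q.2 (tmul S (f.1 q.1 (tmul S (M.grd.par p m)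
      (susp A.grd q.1 ((TPgr A.grd q.1).par q.2 x)))) (susp A.grd q.2 y)) =
      (hat g).1 (tmul S ((hat f).1 (tmul S m (T.ι q.1 x))) (T.ι q.2 y))
    rw [hat_ι, hat_ι, hτ, Grd.par_tensor, Grd.par_par, zsmul_tmul, map_zsmul, susp_par,
      M.grd.par_congr (n := q.2 + q.1) (n' := p) ⟨0, by rw [← hq]; push_cast; ring⟩]
    refine congrArg (· • _) ?_
    exact sgn_congr ⟨q.1 * q.2, by ring⟩
  | add x y hx hy => simp only [map_add, smul_add, hx, hy]

lemma hat_diff {d e : ℤ} (f : A.GHom M N d) (h : d + 1 = e) :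
    hat (diff f h) = Bocs.diff (hat f) h := hat_ext fun m p w => by
  rw [hat_ι, diff_tmul, Bocs.diff_tmul]
  change _ = sgn (d + 1) • (hat f).1 (tmul S ((M.grd.shift 1).par 1 m)
    (coder (A.grd.shift 1) A.mhat (T.ι p w)))
  rw [T.coder_ι, Grd.par_shift, zsmul_tmul, tmul_sum, map_zsmul, map_sum, smul_smul,
    Finset.smul_sum]
  refine Finset.sum_congr rfl fun x hx => ?_
  rw [tmul_sum, map_sum, Finset.smul_sum]
  refine Finset.sum_congr rfl fun y hy => ?_
  rw [Finset.HasAntidiagonal.mem_antidiagonal] at hx hy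
  rw [hat_ι, Grd.par_par, Grd.par_par, mhat, susp_ins (A.m_deg y.2), tmul_zsmul, map_zsmul,
    smul_smul, ← sgn_add, ← sgn_add,
    M.grd.par_congr (n := 2 - y.2 + p) (n' := (y.1 + 1 + x.2 : ℕ) + 1)
      ⟨0, by rw [← hx, ← hy]; push_cast; ring⟩]
  refine congrArg (· • _) ?_
  exact sgn_congr ⟨-1, by ring⟩

lemma hat_strict {d : ℤ} (f : GRMod.HomD M N d) (f' : GRMod.HomD (M.shift 1) (N.shift 1) d)
    (hf : ∀ x, f'.1 x = f.1 x) :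
    hat (A := A) (strict f) = Bocs.strict f' := hat_ext fun m p w => by
  rw [hat_ι, Bocs.strict_tmul]
  change _ = f'.1 (MulOpposite.op (T.counit A.carrier (T.ι p w)) • m)
  rw [hf]
  cases p with
  | zero =>
    change f.1 (MulOpposite.op (TP.unnil A.carrier w) • M.grd.par (0 : ℕ) m) =
      f.1 (MulOpposite.op (TP.unnil A.carrier (T.π 0 (T.ι 0 w))) • m)
    rw [T.π_ι, Nat.cast_zero, Grd.par_zero]
  | succ p =>
    change (0 : N) = f.1 (MulOpposite.op (TP.unnil A.carrier (T.π 0 (T.ι (p + 1) w))) • m)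
    rw [T.π_ι_ne (Nat.succ_ne_zero p)]
    simp

lemma fst_hat {d : ℤ} (f : A.GHom M N d) (m : M) : (Bocs.fst (hat f)).1 m = (fst f).1 m := by
  change (hat f).1 (tmul S m (T.ι 0 (TP.nil A.carrier 1))) = f.1 0 (tmul S m (TP.nil A.carrier 1))
  rw [hat_ι, Nat.cast_zero, Grd.par_zero]
  rfl

/-- The map `M[n] → N[n]` with the same underlying map as `f : M → N`. -/
def _root_.AInfty.GRMod.HomD.shiftMap {d : ℤ} (f : GRMod.HomD M N d) (n : ℤ) :
    GRMod.HomD (M.shift n) (N.shift n) d :=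
  ⟨f.1, fun i x hx => by
    have := f.2 _ x hx
    have e : i + n + d = i + d + n := by ring
    rwa [e] at this⟩

lemma hat_strict' {d : ℤ} (f : GRMod.HomD M N d) :
    hat (A := A) (strict f) = Bocs.strict (f.shiftMap 1) := hat_strict f _ fun _ => rfl

variable (A) in
/-- The differential graded category of graded right `A`-modules. -/
noncomputable def GMod : DGMod.{max u v, v, u} S where
  Hom M N d := A.GHom M N d
  comp := comp
  D := diff
  strict := strict
  fst := fst
  add_comp f f' g h := hat_injective (by
    rw [map_add, hat_comp, hat_comp, hat_comp, map_add]; exact A.bar.GMod.add_comp (hat f) (hat f') (hat g) h)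
  comp_add f g g' h := hat_injective (by
    rw [map_add, hat_comp, hat_comp, hat_comp, map_add]; exact A.bar.GMod.comp_add (hat f) (hat g) (hat g') h)
  D_add f f' h := hat_injective (by
    rw [map_add, hat_diff, hat_diff, hat_diff, map_add]; exact A.bar.GMod.D_add (hat f) (hat f') h)
  assoc f g k h₁ h₂ h₃ h₄ := hat_injective (by
    rw [hat_comp, hat_comp, hat_comp, hat_comp]; exact A.bar.GMod.assoc (hat f) (hat g) (hat k) h₁ h₂ h₃ h₄)
  id_comp {M N d} f h := hat_injective (by
    rw [hat_comp, hat_strict _ (GRMod.HomD.id (M.shift 1)) fun _ => rfl]; exact A.bar.GMod.id_comp (hat f) h)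
  comp_id {M N d} f h := hat_injective (by
    rw [hat_comp, hat_strict _ (GRMod.HomD.id (N.shift 1)) fun _ => rfl]; exact A.bar.GMod.comp_id (hat f) h)
  strict_comp f g h := hat_injective (by
    rw [hat_comp, hat_strict', hat_strict', hat_strict']
    exact A.bar.GMod.strict_comp (f.shiftMap 1) (g.shiftMap 1) h)
  D_strict f h := hat_injective (by
    rw [hat_diff, hat_strict', map_zero]; exact A.bar.GMod.D_strict (f.shiftMap 1) h)
  D_D f h h' := hat_injective (by
    rw [hat_diff, hat_diff, map_zero]; exact A.bar.GMod.D_D (hat f) h h')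
  leibniz f g h hd he hn h₁ h₂ := hat_injective (by
    rw [map_add, map_zsmul, hat_diff, hat_comp, hat_comp, hat_comp, hat_diff, hat_diff]
    exact A.bar.GMod.leibniz (hat f) (hat g) h hd he hn h₁ h₂)
  fst_strict {M N d} f := by
    ext m
    rw [← fst_hat, hat_strict']
    exact congrArg (fun φ : GRMod.HomD (M.shift 1) (N.shift 1) d => φ.1 m)
      (A.bar.GMod.fst_strict (f.shiftMap 1))
  fst_comp {M N L d e n} f g h := by
    ext m
    rw [← fst_hat, hat_comp, GRMod.HomD.comp_apply, ← fst_hat, ← fst_hat]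
    exact congrArg (fun φ : GRMod.HomD (M.shift 1) (L.shift 1) n => φ.1 m)
      (A.bar.GMod.fst_comp (hat f) (hat g) h)

end AInfAlg

end

namespace GRMod.HomD

variable {S : Type u} [Ring S] (M : GRMod.{v} S)

/-- The identification `M[p] → M[n][m]`, for `n + m = p`. -/
def shiftAdd (n m p : ℤ) (h : n + m = p) : HomD (M.shift p) ((M.shift n).shift m) 0 :=
  ⟨LinearMap.id, fun i x hx => by
    change x ∈ M.grd.gr (i + 0 + m + n)
    change x ∈ M.grd.gr (i + p) at hx
    rwa [show i + 0 + m + n = i + p by omega]⟩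

/-- The identification `M[n][m] → M[p]`, for `n + m = p`. -/
def shiftAddInv (n m p : ℤ) (h : n + m = p) : HomD ((M.shift n).shift m) (M.shift p) 0 :=
  ⟨LinearMap.id, fun i x hx => by
    change x ∈ M.grd.gr (i + 0 + p)
    change x ∈ M.grd.gr (i + m + n) at hx
    rwa [show i + 0 + p = i + m + n by omega]⟩

/-- The identification `M[n][m] → M[m][n]`. -/
def shiftSwap (n m : ℤ) : HomD ((M.shift n).shift m) ((M.shift m).shift n) 0 :=
  (shiftAddInv M n m (n + m) rfl).comp (shiftAdd M m n (n + m) (add_comm _ _)) (add_zero 0)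

/-- The identification `M[0] → M`. -/
def shiftZero : HomD (M.shift 0) M 0 := sigInv M 0

/-- The identification `M → M[0]`. -/
def shiftZeroInv : HomD M (M.shift 0) 0 := sig M 0

@[simp] lemma shiftAdd_apply (n m p : ℤ) (h : n + m = p) (x : M) :
    (shiftAdd M n m p h).1 x = x := rfl
@[simp] lemma shiftAddInv_apply (n m p : ℤ) (h : n + m = p) (x : M) :
    (shiftAddInv M n m p h).1 x = x := rfl
@[simp] lemma shiftSwap_apply (n m : ℤ) (x : M) : (shiftSwap M n m).1 x = x := rfl
@[simp] lemma shiftZero_apply (x : M) : (shiftZero M).1 x = x := rfl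
@[simp] lemma shiftZeroInv_apply (x : M) : (shiftZeroInv M).1 x = x := rfl

end GRMod.HomD

namespace DGMod

open GRMod

variable {S : Type u} [Ring S] (𝒜 : DGMod.{w, v, u} S)

section

variable {M N L M' N' L' M'' N'' : GRMod.{v} S}

/-- The composition `α f β` of a morphism `f` with strict morphisms `α` and `β`. -/
def conj {a b d e : ℤ} (α : HomD M' M a) (β : HomD N N' b) (f : 𝒜.Hom M N d) (h : a + d + b = e) :
    𝒜.Hom M' N' e :=
  𝒜.comp (𝒜.comp (𝒜.strict α) f rfl) (𝒜.strict β) h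

lemma zero_comp {d e n : ℤ} (g : 𝒜.Hom N L e) (h : d + e = n) :
    𝒜.comp (0 : 𝒜.Hom M N d) g h = 0 := by
  simpa using 𝒜.add_comp (0 : 𝒜.Hom M N d) 0 g h

lemma comp_zero {d e n : ℤ} (g : 𝒜.Hom M N d) (h : d + e = n) :
    𝒜.comp g (0 : 𝒜.Hom N L e) h = 0 := by
  simpa using 𝒜.comp_add g (0 : 𝒜.Hom N L e) 0 h

lemma D_zero {d e : ℤ} (h : d + 1 = e) : 𝒜.D (0 : 𝒜.Hom M N d) h = 0 := by
  simpa using 𝒜.D_add (0 : 𝒜.Hom M N d) 0 h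

lemma neg_comp {d e n : ℤ} (f : 𝒜.Hom M N d) (g : 𝒜.Hom N L e) (h : d + e = n) :
    𝒜.comp (-f) g h = -𝒜.comp f g h := by
  rw [eq_neg_iff_add_eq_zero, ← 𝒜.add_comp, neg_add_cancel, 𝒜.zero_comp]

lemma comp_neg {d e n : ℤ} (f : 𝒜.Hom M N d) (g : 𝒜.Hom N L e) (h : d + e = n) :
    𝒜.comp f (-g) h = -𝒜.comp f g h := by
  rw [eq_neg_iff_add_eq_zero, ← 𝒜.comp_add, neg_add_cancel, 𝒜.comp_zero]

lemma D_neg {d e : ℤ} (f : 𝒜.Hom M N d) (h : d + 1 = e) : 𝒜.D (-f) h = -𝒜.D f h := by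
  rw [eq_neg_iff_add_eq_zero, ← 𝒜.D_add, neg_add_cancel, 𝒜.D_zero]

lemma zsmul_comp (c : ℤ) {d e n : ℤ} (f : 𝒜.Hom M N d) (g : 𝒜.Hom N L e) (h : d + e = n) :
    𝒜.comp (c • f) g h = c • 𝒜.comp f g h :=
  map_zsmul (AddMonoidHom.mk' (fun f => 𝒜.comp f g h) fun _ _ => 𝒜.add_comp _ _ _ _) c f

lemma comp_zsmul (c : ℤ) {d e n : ℤ} (f : 𝒜.Hom M N d) (g : 𝒜.Hom N L e) (h : d + e = n) :
    𝒜.comp f (c • g) h = c • 𝒜.comp f g h :=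
  map_zsmul (AddMonoidHom.mk' (fun g => 𝒜.comp f g h) fun _ _ => 𝒜.comp_add _ _ _ _) c g

lemma D_zsmul (c : ℤ) {d e : ℤ} (f : 𝒜.Hom M N d) (h : d + 1 = e) :
    𝒜.D (c • f) h = c • 𝒜.D f h :=
  map_zsmul (AddMonoidHom.mk' (fun f => 𝒜.D f h) fun _ _ => 𝒜.D_add _ _ _) c f

lemma conj_add {a b d e : ℤ} (α : HomD M' M a) (β : HomD N N' b) (f g : 𝒜.Hom M N d)
    (h : a + d + b = e) : 𝒜.conj α β (f + g) h = 𝒜.conj α β f h + 𝒜.conj α β g h := by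
  simp only [conj, 𝒜.comp_add, 𝒜.add_comp]

lemma conj_zsmul (c : ℤ) {a b d e : ℤ} (α : HomD M' M a) (β : HomD N N' b) (f : 𝒜.Hom M N d)
    (h : a + d + b = e) : 𝒜.conj α β (c • f) h = c • 𝒜.conj α β f h :=
  map_zsmul (AddMonoidHom.mk' (fun f => 𝒜.conj α β f h) fun _ _ => 𝒜.conj_add _ _ _ _ _) c f

lemma conj_zero {a b d e : ℤ} (α : HomD M' M a) (β : HomD N N' b)
    (h : a + d + b = e) : 𝒜.conj α β (0 : 𝒜.Hom M N d) h = 0 := by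
  simp only [conj, 𝒜.comp_zero, 𝒜.zero_comp]

lemma conj_sub {a b d e : ℤ} (α : HomD M' M a) (β : HomD N N' b) (f g : 𝒜.Hom M N d)
    (h : a + d + b = e) : 𝒜.conj α β (f - g) h = 𝒜.conj α β f h - 𝒜.conj α β g h := by
  rw [eq_sub_iff_add_eq, ← 𝒜.conj_add, sub_add_cancel]

lemma conj_congr {a a' b b' d e : ℤ} (α : HomD M' M a) (α' : HomD M' M a') (β : HomD N N' b)
    (β' : HomD N N' b') (f : 𝒜.Hom M N d) (h : a + d + b = e) (h' : a' + d + b' = e)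
    (ha : a = a') (hα : ∀ x, α.1 x = α'.1 x) (hβ : ∀ x, β.1 x = β'.1 x) :
    𝒜.conj α β f h = 𝒜.conj α' β' f h' := by
  subst ha
  obtain rfl : b = b' := by omega
  rw [HomD.ext hα, HomD.ext hβ]

lemma conj_comp {a b b' c d e m n p q : ℤ} (α : HomD M' M a) (β : HomD N N' b) (β' : HomD N' N b')
    (γ : HomD L L' c) (f : 𝒜.Hom M N d) (g : 𝒜.Hom N L e) (h₁ : a + d + b = m)
    (h₂ : b' + e + c = n) (h₃ : m + n = p) (hb : b + b' = 0) (hβ : ∀ x, β'.1 (β.1 x) = x)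
    (hq : d + e = q) :
    𝒜.comp (𝒜.conj α β f h₁) (𝒜.conj β' γ g h₂) h₃ =
      𝒜.conj α γ (𝒜.comp f g hq) (by omega) := by
  unfold conj
  have key : 𝒜.comp (𝒜.strict β) (𝒜.comp (𝒜.comp (𝒜.strict β') g rfl) (𝒜.strict γ) h₂)
      (show b + n = e + c by omega) = 𝒜.comp g (𝒜.strict γ) rfl := by
    rw [← 𝒜.assoc (𝒜.strict β) (𝒜.comp (𝒜.strict β') g rfl) (𝒜.strict γ)
      (show b + (b' + e) = e by omega) rfl h₂ _,
      ← 𝒜.assoc (𝒜.strict β) (𝒜.strict β') g hb (by omega : 0 + e = e) rfl _,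
      ← 𝒜.strict_comp β β' hb, show β.comp β' hb = HomD.id N from HomD.ext hβ, 𝒜.id_comp]
  rw [𝒜.assoc (𝒜.comp (𝒜.strict α) f rfl) (𝒜.strict β) _ h₁ h₃
    (show b + n = e + c by omega) (by omega), key,
    ← 𝒜.assoc (𝒜.comp (𝒜.strict α) f rfl) g (𝒜.strict γ) (show a + d + e = a + q by omega)
      (by omega) rfl _, 𝒜.assoc (𝒜.strict α) f g rfl _ hq rfl]

lemma conj_conj {a b d e a' b' e' : ℤ} (α : HomD M' M a) (β : HomD N N' b) (α' : HomD M'' M' a')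
    (β' : HomD N' N'' b') (f : 𝒜.Hom M N d) (h : a + d + b = e) (h' : a' + e + b' = e') :
    𝒜.conj α' β' (𝒜.conj α β f h) h' =
      𝒜.conj (α'.comp α rfl) (β.comp β' rfl) f (by omega) := by
  unfold conj
  rw [𝒜.strict_comp, 𝒜.strict_comp,
    ← 𝒜.assoc (𝒜.strict α') (𝒜.comp (𝒜.strict α) f rfl) (𝒜.strict β)
      (show a' + (a + d) = a' + a + d by omega) (by omega) h rfl,
    ← 𝒜.assoc (𝒜.strict α') (𝒜.strict α) f rfl rfl rfl (by omega),
    𝒜.assoc _ (𝒜.strict β) (𝒜.strict β') (by omega) (by omega) rfl (by omega)]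

lemma strict_comp_eq {a d e : ℤ} (α : HomD M' M a) (f : 𝒜.Hom M N d) (h : a + d = e) :
    𝒜.comp (𝒜.strict α) f h = 𝒜.conj α (HomD.id N) f (by omega) := by
  subst h
  rw [conj, 𝒜.comp_id]

lemma comp_strict_eq {b d e : ℤ} (β : HomD N N' b) (f : 𝒜.Hom M N d) (h : d + b = e) :
    𝒜.comp f (𝒜.strict β) h = 𝒜.conj (HomD.id M) β f (by omega) := by
  unfold conj
  have : ∀ q (hq : 0 + d = q) (h' : q + b = e), 𝒜.comp f (𝒜.strict β) h =
      𝒜.comp (𝒜.comp (𝒜.strict (HomD.id M)) f hq) (𝒜.strict β) h' := by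
    intro q hq h'
    obtain rfl : q = d := by omega
    rw [𝒜.id_comp]
  exact this _ _ _

lemma conj_strict {a b d e : ℤ} (α : HomD M' M a) (β : HomD N N' b) (f : HomD M N d)
    (h : a + d + b = e) :
    𝒜.conj α β (𝒜.strict f) h = 𝒜.strict ((α.comp f rfl).comp β h) := by
  rw [𝒜.strict_comp, 𝒜.strict_comp]; rfl

lemma D_conj {a b d e d' e' : ℤ} (α : HomD M' M a) (β : HomD N N' b) (f : 𝒜.Hom M N d)
    (h : a + d + b = e) (hd : d + 1 = d') (he : e + 1 = e') :
    𝒜.D (𝒜.conj α β f h) he = sgn b • 𝒜.conj α β (𝒜.D f hd) (by omega) := by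
  unfold conj
  rw [𝒜.leibniz _ _ h (show a + d + 1 = a + d' by omega) rfl he (by omega) (by omega),
    𝒜.leibniz _ _ rfl rfl hd (show a + d + 1 = a + d' by omega) rfl (by omega),
    𝒜.D_strict, 𝒜.D_strict, 𝒜.comp_zero, 𝒜.zero_comp, smul_zero, add_zero, zero_add]

end

/-- The morphism `f[n] = σ f σ⁻¹ : M[n] → N[n]`. -/
def shiftHom {M N : GRMod.{v} S} {d : ℤ} (f : 𝒜.Hom M N d) (n : ℤ) :
    𝒜.Hom (M.shift n) (N.shift n) d :=
  𝒜.conj (HomD.sigInv M n) (HomD.sig N n) f (by omega)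

section

variable {M N L : GRMod.{v} S}

lemma shiftHom_comp {d e q : ℤ} (f : 𝒜.Hom M N d) (g : 𝒜.Hom N L e) (n : ℤ) (h : d + e = q) :
    𝒜.comp (𝒜.shiftHom f n) (𝒜.shiftHom g n) h = 𝒜.shiftHom (𝒜.comp f g h) n :=
  𝒜.conj_comp _ _ _ _ _ _ _ _ _ (by omega) (fun _ => rfl) _

lemma shiftHom_add {d : ℤ} (f g : 𝒜.Hom M N d) (n : ℤ) :
    𝒜.shiftHom (f + g) n = 𝒜.shiftHom f n + 𝒜.shiftHom g n := 𝒜.conj_add _ _ _ _ _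

lemma shiftHom_sub {d : ℤ} (f g : 𝒜.Hom M N d) (n : ℤ) :
    𝒜.shiftHom (f - g) n = 𝒜.shiftHom f n - 𝒜.shiftHom g n := 𝒜.conj_sub _ _ _ _ _

lemma shiftHom_zsmul (c : ℤ) {d : ℤ} (f : 𝒜.Hom M N d) (n : ℤ) :
    𝒜.shiftHom (c • f) n = c • 𝒜.shiftHom f n := 𝒜.conj_zsmul _ _ _ _ _

lemma shiftHom_zero {d : ℤ} (n : ℤ) : 𝒜.shiftHom (0 : 𝒜.Hom M N d) n = 0 := 𝒜.conj_zero _ _ _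

lemma D_shiftHom {d e : ℤ} (f : 𝒜.Hom M N d) (n : ℤ) (h : d + 1 = e) :
    𝒜.D (𝒜.shiftHom f n) h = sgn n • 𝒜.shiftHom (𝒜.D f h) n := by
  unfold shiftHom
  rw [𝒜.D_conj _ _ _ _ h, sgn_congr (show Even (-n - n) from ⟨-n, by ring⟩)]

lemma shiftHom_id (n : ℤ) :
    𝒜.shiftHom (𝒜.strict (HomD.id M)) n = 𝒜.strict (HomD.id (M.shift n)) := by
  rw [shiftHom, 𝒜.conj_strict]
  congr 1

end

/-! ### Twisted modules -/

/-- A twisted object `(M, u)`, where `u` is an endomorphism of `M` of degree `1` which satisfies the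
Maurer-Cartan equation `δ(u) + u * u = 0`. For the category of graded `B`-modules these are the
twisted `B`-modules, and for that of graded `A`-modules they are the `A_∞`-modules over `A`. -/
structure Tw where
  obj : GRMod.{v} S
  u : 𝒜.Hom obj obj 1
  mc : 𝒜.D u (show (1 : ℤ) + 1 = 2 by norm_num) + 𝒜.comp u u (show (1 : ℤ) + 1 = 2 by norm_num) = 0

variable {𝒜}

namespace Tw

/-- The morphisms `(M, u) → (N, v)` are the `f` of degree `0` with `δ(f) + v * f - f * u = 0`. -/
def homs (X Y : 𝒜.Tw) : AddSubgroup (𝒜.Hom X.obj Y.obj 0) where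
  carrier := {f | 𝒜.D f (zero_add 1) + 𝒜.comp f Y.u (zero_add 1) - 𝒜.comp X.u f (add_zero 1) = 0}
  zero_mem' := by
    simp only [Set.mem_ofPred_eq, 𝒜.D_zero, 𝒜.zero_comp, 𝒜.comp_zero, add_zero, sub_zero]
  add_mem' {f g} hf hg := by
    simp only [Set.mem_ofPred_eq] at *
    rw [𝒜.D_add, 𝒜.add_comp, 𝒜.comp_add]
    rw [← add_zero (0 : 𝒜.Hom X.obj Y.obj 1)]
    nth_rw 1 [← hf]
    rw [← hg]
    abel
  neg_mem' {f} hf := by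
    simp only [Set.mem_ofPred_eq] at *
    rw [𝒜.D_neg, 𝒜.neg_comp, 𝒜.comp_neg]
    have h2 := congrArg Neg.neg hf
    rw [neg_zero] at h2
    refine Eq.trans ?_ h2
    abel

lemma mem_homs {X Y : 𝒜.Tw} (f : 𝒜.Hom X.obj Y.obj 0) : f ∈ homs X Y ↔
    𝒜.D f (zero_add 1) + 𝒜.comp f Y.u (zero_add 1) - 𝒜.comp X.u f (add_zero 1) = 0 := Iff.rfl

/-- Morphisms of twisted objects. -/
@[ext] structure Mor (X Y : 𝒜.Tw) where
  hom : 𝒜.Hom X.obj Y.obj 0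
  mem : hom ∈ homs X Y

lemma comp_mem {X Y Z : 𝒜.Tw} {f : 𝒜.Hom X.obj Y.obj 0} {g : 𝒜.Hom Y.obj Z.obj 0}
    (hf : f ∈ homs X Y) (hg : g ∈ homs Y Z) : 𝒜.comp f g (add_zero 0) ∈ homs X Z := by
  rw [mem_homs] at *
  rw [𝒜.leibniz f g (add_zero 0) (zero_add 1) (zero_add 1) (zero_add 1) (zero_add 1) (add_zero 1),
    sgn_zero, one_smul, 𝒜.assoc f g Z.u (add_zero 0) (zero_add 1) (zero_add 1) (zero_add 1),
    ← 𝒜.assoc X.u f g (add_zero 1) (add_zero 1) (add_zero 0) (add_zero 1)]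
  have e1 : 𝒜.D f (zero_add 1) = 𝒜.comp X.u f (add_zero 1) - 𝒜.comp f Y.u (zero_add 1) := by
    rw [← sub_eq_zero, ← hf]; abel
  have e2 : 𝒜.D g (zero_add 1) = 𝒜.comp Y.u g (add_zero 1) - 𝒜.comp g Z.u (zero_add 1) := by
    rw [← sub_eq_zero, ← hg]; abel
  rw [e1, e2, sub_eq_add_neg, sub_eq_add_neg, sub_eq_add_neg, 𝒜.add_comp, 𝒜.comp_add, 𝒜.neg_comp, 𝒜.comp_neg,
    𝒜.assoc f Y.u g (zero_add 1) (add_zero 1) (add_zero 1) (zero_add 1)]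
  abel

lemma id_mem (X : 𝒜.Tw) : 𝒜.strict (HomD.id X.obj) ∈ homs X X := by
  rw [mem_homs, 𝒜.D_strict, 𝒜.id_comp, 𝒜.comp_id, zero_add, sub_self]

instance : Category 𝒜.Tw where
  Hom := Mor
  id X := ⟨𝒜.strict (HomD.id X.obj), id_mem X⟩
  comp f g := ⟨𝒜.comp f.hom g.hom (add_zero 0), comp_mem f.mem g.mem⟩
  id_comp _ := Mor.ext (𝒜.id_comp _ _)
  comp_id _ := Mor.ext (𝒜.comp_id _ _)
  assoc _ _ _ := Mor.ext (𝒜.assoc _ _ _ _ _ _ _)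

@[ext] lemma hom_ext {X Y : 𝒜.Tw} {f g : X ⟶ Y} (h : f.hom = g.hom) : f = g := Mor.ext h

@[simp] lemma id_hom (X : 𝒜.Tw) : Mor.hom (𝟙 X) = 𝒜.strict (HomD.id X.obj) := rfl
@[simp] lemma comp_hom {X Y Z : 𝒜.Tw} (f : X ⟶ Y) (g : Y ⟶ Z) :
    (f ≫ g).hom = 𝒜.comp f.hom g.hom (add_zero 0) := rfl

/-- Morphisms of twisted objects form a subgroup. -/
def homEquiv (X Y : 𝒜.Tw) : (X ⟶ Y) ≃ homs X Y where
  toFun f := ⟨f.hom, f.mem⟩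
  invFun f := ⟨f.1, f.2⟩
  left_inv _ := rfl
  right_inv _ := rfl

instance (X Y : 𝒜.Tw) : AddCommGroup (X ⟶ Y) := (homEquiv X Y).addCommGroup

@[simp] lemma add_hom {X Y : 𝒜.Tw} (f g : X ⟶ Y) : (f + g).hom = f.hom + g.hom := rfl
@[simp] lemma sub_hom {X Y : 𝒜.Tw} (f g : X ⟶ Y) : (f - g).hom = f.hom - g.hom := rfl
@[simp] lemma zero_hom (X Y : 𝒜.Tw) : Mor.hom (0 : X ⟶ Y) = 0 := rfl

instance : Preadditive 𝒜.Tw where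
  add_comp _ _ _ _ _ _ := hom_ext (𝒜.add_comp _ _ _ _)
  comp_add _ _ _ _ _ _ := hom_ext (𝒜.comp_add _ _ _ _)

/-- The morphism of twisted objects given by a strict map. -/
def ofStrict {X Y : 𝒜.Tw} (f : HomD X.obj Y.obj 0)
    (h : 𝒜.comp (𝒜.strict f) Y.u (zero_add 1) = 𝒜.comp X.u (𝒜.strict f) (add_zero 1)) : X ⟶ Y :=
  ⟨𝒜.strict f, by rw [mem_homs, 𝒜.D_strict, zero_add, h, sub_self]⟩

@[simp] lemma ofStrict_hom {X Y : 𝒜.Tw} (f : HomD X.obj Y.obj 0) (h) :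
    (ofStrict f h : X ⟶ Y).hom = 𝒜.strict f := rfl

/-- The isomorphism of twisted objects given by mutually inverse strict maps. -/
@[simps] def isoOfStrict {X Y : 𝒜.Tw} (f : HomD X.obj Y.obj 0) (g : HomD Y.obj X.obj 0)
    (hf : 𝒜.comp (𝒜.strict f) Y.u (zero_add 1) = 𝒜.comp X.u (𝒜.strict f) (add_zero 1))
    (hg : 𝒜.comp (𝒜.strict g) X.u (zero_add 1) = 𝒜.comp Y.u (𝒜.strict g) (add_zero 1))
    (h₁ : ∀ x, g.1 (f.1 x) = x) (h₂ : ∀ x, f.1 (g.1 x) = x) : X ≅ Y where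
  hom := ofStrict f hf
  inv := ofStrict g hg
  hom_inv_id := hom_ext <| by
    simp only [comp_hom, ofStrict_hom, id_hom, ← 𝒜.strict_comp]
    congr 1
    exact HomD.ext h₁
  inv_hom_id := hom_ext <| by
    simp only [comp_hom, ofStrict_hom, id_hom, ← 𝒜.strict_comp]
    congr 1
    exact HomD.ext h₂

/-! #### The shift -/

/-- The shift `Tⁿ(M, u) = (M[n], (-1)ⁿ u[n])`. -/
@[reducible] def shift (X : 𝒜.Tw) (n : ℤ) : 𝒜.Tw where
  obj := X.obj.shift n
  u := sgn n • 𝒜.shiftHom X.u n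
  mc := by
    rw [𝒜.D_zsmul, 𝒜.zsmul_comp, 𝒜.comp_zsmul, 𝒜.D_shiftHom, 𝒜.shiftHom_comp, ← smul_add,
      ← smul_add, ← 𝒜.shiftHom_add, X.mc, 𝒜.shiftHom_zero, smul_zero, smul_zero]

/-- The shift functor `Tⁿ`, given on morphisms by `f ↦ f[n]`. -/
@[simps] def shiftF (n : ℤ) : 𝒜.Tw ⥤ 𝒜.Tw where
  obj X := X.shift n
  map {X Y} f := ⟨𝒜.shiftHom f.hom n, by
    have := f.mem
    rw [mem_homs] at this ⊢
    rw [𝒜.zsmul_comp, 𝒜.comp_zsmul, 𝒜.D_shiftHom, 𝒜.shiftHom_comp,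
      𝒜.shiftHom_comp, ← smul_add, ← smul_sub, ← 𝒜.shiftHom_add, ← 𝒜.shiftHom_sub, this,
      𝒜.shiftHom_zero, smul_zero]⟩
  map_id X := hom_ext (𝒜.shiftHom_id n)
  map_comp f g := hom_ext (𝒜.shiftHom_comp _ _ _ _).symm

/-- The identification `T⁰ X ≅ X`. -/
@[simps! hom_hom inv_hom] def shiftZeroIso (X : 𝒜.Tw) : X.shift 0 ≅ X :=
  isoOfStrict (X := X.shift 0) (HomD.shiftZero X.obj) (HomD.shiftZeroInv X.obj)
    (by
      dsimp only [shift]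
      rw [sgn_zero, one_smul, 𝒜.strict_comp_eq, 𝒜.comp_strict_eq, shiftHom, 𝒜.conj_conj]
      exact 𝒜.conj_congr _ _ _ _ _ _ _ (by norm_num) (fun _ => rfl) (fun _ => rfl))
    (by
      dsimp only [shift]
      rw [sgn_zero, one_smul, 𝒜.strict_comp_eq, 𝒜.comp_strict_eq, shiftHom, 𝒜.conj_conj]
      exact 𝒜.conj_congr _ _ _ _ _ _ _ (by norm_num) (fun _ => rfl) (fun _ => rfl))
    (fun _ => rfl) (fun _ => rfl)

/-- The identification `T^{n+m} X ≅ T^m (T^n X)`. -/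
@[simps! hom_hom inv_hom] def shiftAddIso (X : 𝒜.Tw) (n m : ℤ) :
    X.shift (n + m) ≅ (X.shift n).shift m :=
  isoOfStrict (X := X.shift (n + m)) (Y := (X.shift n).shift m)
    (HomD.shiftAdd X.obj n m _ rfl) (HomD.shiftAddInv X.obj n m _ rfl)
    (by
      dsimp only [shift]
      rw [𝒜.shiftHom_zsmul, smul_smul, mul_comm, ← sgn_add,
        𝒜.zsmul_comp, 𝒜.comp_zsmul, 𝒜.strict_comp_eq, 𝒜.comp_strict_eq, shiftHom, shiftHom,
        shiftHom, 𝒜.conj_conj, 𝒜.conj_conj, 𝒜.conj_conj]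
      congr 1
      exact 𝒜.conj_congr _ _ _ _ _ _ _ (by omega) (fun _ => rfl) (fun _ => rfl))
    (by
      dsimp only [shift]
      rw [𝒜.shiftHom_zsmul, smul_smul, mul_comm, ← sgn_add,
        𝒜.zsmul_comp, 𝒜.comp_zsmul, 𝒜.strict_comp_eq, 𝒜.comp_strict_eq, shiftHom, shiftHom,
        shiftHom, 𝒜.conj_conj, 𝒜.conj_conj, 𝒜.conj_conj]
      congr 1
      exact 𝒜.conj_congr _ _ _ _ _ _ _ (by omega) (fun _ => rfl) (fun _ => rfl))
    (fun _ => rfl) (fun _ => rfl)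

lemma eqToHom_hom (X : 𝒜.Tw) {a b : ℤ} (h : a = b) (h' : X.shift a = X.shift b) :
    (eqToHom h').hom = 𝒜.strict ((HomD.shiftAdd X.obj b 0 a (by omega)).comp
      (HomD.shiftZero (X.obj.shift b)) (add_zero 0)) := by
  subst h
  rfl

end Tw

end DGMod

namespace DGMod
open GRMod
variable {S : Type u} [Ring S] {𝒜 : DGMod.{w, v, u} S}

namespace Tw

/-- The shift functors `Tⁿ` with their structure isomorphisms. -/
def shiftCore : ShiftMkCore 𝒜.Tw ℤ where
  F := shiftF
  zero := NatIso.ofComponents shiftZeroIso fun {X Y} f => hom_ext <| by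
    change 𝒜.comp (𝒜.shiftHom f.hom 0) (𝒜.strict (HomD.shiftZero Y.obj)) (add_zero 0) =
      𝒜.comp (𝒜.strict (HomD.shiftZero X.obj)) f.hom (add_zero 0)
    rw [𝒜.strict_comp_eq, 𝒜.comp_strict_eq, shiftHom, 𝒜.conj_conj]
    exact 𝒜.conj_congr _ _ _ _ _ _ _ (by norm_num) (fun _ => rfl) (fun _ => rfl)
  add n m := NatIso.ofComponents (fun X => shiftAddIso X n m) fun {X Y} f => hom_ext <| by
    change 𝒜.comp (𝒜.shiftHom f.hom (n + m)) (𝒜.strict (HomD.shiftAdd Y.obj n m _ rfl))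
      (add_zero 0) = 𝒜.comp (𝒜.strict (HomD.shiftAdd X.obj n m _ rfl))
      (𝒜.shiftHom (𝒜.shiftHom f.hom n) m) (add_zero 0)
    rw [𝒜.strict_comp_eq, 𝒜.comp_strict_eq, shiftHom, shiftHom, shiftHom, 𝒜.conj_conj,
      𝒜.conj_conj, 𝒜.conj_conj]
    exact 𝒜.conj_congr _ _ _ _ _ _ _ (by omega) (fun _ => rfl) (fun _ => rfl)
  assoc_hom_app a b c X := hom_ext <| by
    change 𝒜.comp (𝒜.strict (HomD.shiftAdd X.obj (a + b) c _ rfl))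
      (𝒜.shiftHom (𝒜.strict (HomD.shiftAdd X.obj a b _ rfl)) c) (add_zero 0) =
      𝒜.comp (Mor.hom (eqToHom (congrArg X.shift (add_assoc a b c)) : X.shift (a + b + c) ⟶ X.shift (a + (b + c)))) (𝒜.comp (𝒜.strict (HomD.shiftAdd X.obj a (b + c) _ rfl))
        (𝒜.strict (HomD.shiftAdd (X.obj.shift a) b c _ rfl)) (add_zero 0)) (add_zero 0)
    rw [eqToHom_hom X (add_assoc a b c), shiftHom, 𝒜.conj_strict, ← 𝒜.strict_comp,
      ← 𝒜.strict_comp, ← 𝒜.strict_comp]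
    congr 1
  zero_add_hom_app n X := hom_ext <| by
    change 𝒜.strict (HomD.shiftAdd X.obj 0 n _ rfl) =
      𝒜.comp (Mor.hom (eqToHom (congrArg X.shift (zero_add n)) : X.shift (0 + n) ⟶ X.shift n)) (𝒜.shiftHom (𝒜.strict (HomD.shiftZeroInv X.obj)) n) (add_zero 0)
    rw [eqToHom_hom X (zero_add n), shiftHom, 𝒜.conj_strict, ← 𝒜.strict_comp]
    congr 1
  add_zero_hom_app n X := hom_ext <| by
    change 𝒜.strict (HomD.shiftAdd X.obj n 0 _ rfl) =
      𝒜.comp (Mor.hom (eqToHom (congrArg X.shift (add_zero n)) : X.shift (n + 0) ⟶ X.shift n)) (𝒜.strict (HomD.shiftZeroInv (X.obj.shift n))) (add_zero 0)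
    rw [eqToHom_hom X (add_zero n), ← 𝒜.strict_comp]
    congr 1

instance : HasShift 𝒜.Tw ℤ := hasShiftMk _ _ shiftCore

instance (n : ℤ) : (shiftFunctor 𝒜.Tw n).Additive where
  map_add {_ _} _ _ := hom_ext (𝒜.shiftHom_add _ _ n)

lemma shiftFunctor_eq (n : ℤ) : shiftFunctor 𝒜.Tw n = shiftF n := rfl

lemma shiftFunctorAdd_hom_app (n m : ℤ) (X : 𝒜.Tw) :
    ((shiftFunctorAdd 𝒜.Tw n m).hom.app X).hom = 𝒜.strict (HomD.shiftAdd X.obj n m _ rfl) := rfl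

lemma shiftFunctorAdd_inv_app (n m : ℤ) (X : 𝒜.Tw) :
    ((shiftFunctorAdd 𝒜.Tw n m).inv.app X).hom =
      𝒜.strict (HomD.shiftAddInv X.obj n m _ rfl) := rfl

lemma shiftFunctorZero_hom_app (X : 𝒜.Tw) :
    ((shiftFunctorZero 𝒜.Tw ℤ).hom.app X).hom = 𝒜.strict (HomD.shiftZero X.obj) := rfl

lemma shiftFunctorZero_inv_app (X : 𝒜.Tw) :
    ((shiftFunctorZero 𝒜.Tw ℤ).inv.app X).hom = 𝒜.strict (HomD.shiftZeroInv X.obj) := rfl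

/-! #### Homotopy -/

/-- Homotopy of morphisms `f, g : (M, u) → (N, v)`: there is `h : M → N` of degree `-1` with
`f - g = δ(h) + v * h + h * u`. -/
def homotopic (𝒜 : DGMod.{w, v, u} S) : HomRel 𝒜.Tw := fun X Y f g =>
  ∃ h : 𝒜.Hom X.obj Y.obj (-1), f.hom - g.hom =
    𝒜.D h (neg_add_cancel 1) + 𝒜.comp h Y.u (neg_add_cancel 1) + 𝒜.comp X.u h (add_neg_cancel 1)

lemma homotopic_equivalence {X Y : 𝒜.Tw} : Equivalence (@homotopic S _ 𝒜 X Y) where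
  refl f := ⟨0, by rw [𝒜.D_zero, 𝒜.zero_comp, 𝒜.comp_zero, sub_self, add_zero, add_zero]⟩
  symm := by
    rintro f g ⟨h, e⟩
    refine ⟨-h, ?_⟩
    rw [𝒜.D_neg, 𝒜.neg_comp, 𝒜.comp_neg, ← neg_sub, e]
    abel
  trans := by
    rintro f g k ⟨h, e⟩ ⟨h', e'⟩
    refine ⟨h + h', ?_⟩
    rw [𝒜.D_add, 𝒜.add_comp, 𝒜.comp_add, ← sub_add_sub_cancel f.hom g.hom k.hom, e, e']
    abel

lemma D_hom {X Y : 𝒜.Tw} (f : X ⟶ Y) : 𝒜.D f.hom (zero_add 1) =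
    𝒜.comp X.u f.hom (add_zero 1) - 𝒜.comp f.hom Y.u (zero_add 1) := by
  have := f.mem
  rw [mem_homs] at this
  rw [← sub_eq_zero, ← this]; abel

instance : Congruence (homotopic 𝒜) where
  equivalence := homotopic_equivalence
  comp_left {X Y Z} f g g' := by
    rintro ⟨h, e⟩
    refine ⟨𝒜.comp f.hom h (zero_add (-1)), ?_⟩
    have e1 : (f ≫ g).hom - (f ≫ g').hom = 𝒜.comp f.hom (g.hom - g'.hom) (add_zero 0) := by
      rw [sub_eq_add_neg g.hom, 𝒜.comp_add, 𝒜.comp_neg, ← sub_eq_add_neg]; rfl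
    rw [e1, e, 𝒜.leibniz f.hom h _ (zero_add 1) (neg_add_cancel 1) (neg_add_cancel 1) (add_zero 0)
      (add_neg_cancel 1), D_hom, 𝒜.comp_add, 𝒜.comp_add, sub_eq_add_neg, 𝒜.add_comp, 𝒜.neg_comp,
      𝒜.assoc f.hom h Z.u (zero_add (-1)) (neg_add_cancel 1) (neg_add_cancel 1) (add_zero 0),
      ← 𝒜.assoc X.u f.hom h (add_zero 1) (add_neg_cancel 1) (zero_add (-1)) (add_neg_cancel 1),
      𝒜.assoc f.hom Y.u h (zero_add 1) (add_neg_cancel 1) (add_neg_cancel 1) (add_zero 0)]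
    have : sgn (-1) = -1 := rfl
    rw [this, neg_smul, one_smul]
    abel
  comp_right {X Y Z} f f' g := by
    rintro ⟨h, e⟩
    refine ⟨𝒜.comp h g.hom (add_zero (-1)), ?_⟩
    have e1 : (f ≫ g).hom - (f' ≫ g).hom = 𝒜.comp (f.hom - f'.hom) g.hom (add_zero 0) := by
      rw [sub_eq_add_neg f.hom, 𝒜.add_comp, 𝒜.neg_comp, ← sub_eq_add_neg]; rfl
    rw [e1, e, 𝒜.leibniz h g.hom _ (neg_add_cancel 1) (zero_add 1) (neg_add_cancel 1)
      (neg_add_cancel 1) (add_zero 0), D_hom, 𝒜.add_comp, 𝒜.add_comp, sub_eq_add_neg, 𝒜.comp_add,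
      𝒜.comp_neg,
      𝒜.assoc h g.hom Z.u (add_zero (-1)) (neg_add_cancel 1) (zero_add 1) (neg_add_cancel 1),
      𝒜.assoc X.u h g.hom (add_neg_cancel 1) (add_zero 0) (add_zero (-1)) (add_neg_cancel 1),
      𝒜.assoc h Y.u g.hom (neg_add_cancel 1) (add_zero 0) (add_zero 1) (neg_add_cancel 1),
      sgn_zero, one_smul]
    abel

instance : (homotopic 𝒜).IsCompatibleWithShift ℤ where
  condition n X Y f g := by
    rintro ⟨h, e⟩
    refine ⟨sgn n • 𝒜.shiftHom h n, ?_⟩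
    have : 𝒜.shiftHom f.hom n - 𝒜.shiftHom g.hom n =
        𝒜.D (sgn n • 𝒜.shiftHom h n) (neg_add_cancel 1) +
        𝒜.comp (sgn n • 𝒜.shiftHom h n) (sgn n • 𝒜.shiftHom Y.u n) (neg_add_cancel 1) +
        𝒜.comp (sgn n • 𝒜.shiftHom X.u n) (sgn n • 𝒜.shiftHom h n) (add_neg_cancel 1) := by
      rw [← 𝒜.shiftHom_sub, e]
      simp only [𝒜.zsmul_comp, 𝒜.comp_zsmul, 𝒜.D_zsmul, 𝒜.D_shiftHom, smul_smul, sgn_mul_self,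
        one_smul, 𝒜.shiftHom_comp, 𝒜.shiftHom_add]
    exact this

end Tw

variable (𝒜)

/-- The homotopy category of twisted objects. -/
abbrev Ho := Quotient (Tw.homotopic 𝒜)

/-- The projection to the homotopy category. -/
abbrev toHo : 𝒜.Tw ⥤ 𝒜.Ho := Quotient.functor (Tw.homotopic 𝒜)

variable {𝒜}

namespace Ho

lemma homotopic_add : ∀ ⦃X Y : 𝒜.Tw⦄ (f₁ f₂ g₁ g₂ : X ⟶ Y), Tw.homotopic 𝒜 f₁ f₂ →
    Tw.homotopic 𝒜 g₁ g₂ → Tw.homotopic 𝒜 (f₁ + g₁) (f₂ + g₂) := by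
  rintro X Y f₁ f₂ g₁ g₂ ⟨h, e⟩ ⟨h', e'⟩
  refine ⟨h + h', ?_⟩
  rw [𝒜.D_add, 𝒜.add_comp, 𝒜.comp_add, Tw.add_hom, Tw.add_hom, add_sub_add_comm, e, e']
  abel

instance : Preadditive 𝒜.Ho := Quotient.preadditive _ homotopic_add

instance : (toHo 𝒜).Additive := Quotient.functor_additive _ homotopic_add

instance (n : ℤ) : (shiftFunctor 𝒜.Ho n).Additive := by
  have : ((toHo 𝒜) ⋙ shiftFunctor 𝒜.Ho n).Additive :=
    Functor.additive_of_iso ((toHo 𝒜).commShiftIso n)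
  exact Functor.additive_of_full_essSurj_comp (toHo 𝒜) _

/-- The zero object. -/
def zero (𝒜 : DGMod.{w, v, u} S) : 𝒜.Tw where
  obj := GRMod.zero S
  u := 0
  mc := by rw [𝒜.D_zero, 𝒜.zero_comp, add_zero]

open Limits in
lemma isZero_zero : IsZero ((toHo 𝒜).obj (zero 𝒜)) := by
  have : IsZero (zero 𝒜) := by
    rw [IsZero.iff_id_eq_zero]
    refine Tw.hom_ext ?_
    change 𝒜.strict (HomD.id (GRMod.zero S)) = 0
    rw [show HomD.id (GRMod.zero.{v} S) = 0 from HomD.ext fun _ => rfl, map_zero]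
  exact (toHo 𝒜).map_isZero this

instance : Limits.HasZeroObject 𝒜.Ho := ⟨⟨_, isZero_zero⟩⟩

end Ho

end DGMod

namespace DGMod
open GRMod
variable {S : Type u} [Ring S]

lemma conj_comp_zero (𝒜 : DGMod.{w, v, u} S) {M N L M' N' L' Q : GRMod.{v} S}
    {a b b' c d e m n p : ℤ} (α : HomD M' M a) (β : HomD N Q b)
    (β' : HomD Q L b') (γ : HomD L' N' c) (f : 𝒜.Hom M N d) (g : 𝒜.Hom L L' e)
    (h₁ : a + d + b = m) (h₂ : b' + e + c = n) (h₃ : m + n = p)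
    (hβ : ∀ x, β'.1 (β.1 x) = 0) :
    𝒜.comp (𝒜.conj α β f h₁) (𝒜.conj β' γ g h₂) h₃ = 0 := by
  unfold conj
  rw [𝒜.assoc (𝒜.comp (𝒜.strict α) f rfl) (𝒜.strict β) _ h₁ h₃ (rfl : b + n = b + n) (by omega),
    ← 𝒜.assoc (𝒜.strict β) (𝒜.comp (𝒜.strict β') g rfl) (𝒜.strict γ)
      (show b + (b' + e) = b + b' + e by omega) (by omega) h₂ _,
    ← 𝒜.assoc (𝒜.strict β) (𝒜.strict β') g rfl rfl rfl _,
    ← 𝒜.strict_comp β β' rfl, show β.comp β' rfl = 0 from HomD.ext hβ, map_zero, 𝒜.zero_comp,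
    𝒜.zero_comp, 𝒜.comp_zero]

lemma conj_left_zero (𝒜 : DGMod.{w, v, u} S) {M N M' N' : GRMod.{v} S} {a b d e : ℤ}
    (α : HomD M' M a) (β : HomD N N' b) (f : 𝒜.Hom M N d) (h : a + d + b = e)
    (hα : ∀ x, α.1 x = 0) : 𝒜.conj α β f h = 0 := by
  rw [conj, show α = 0 from HomD.ext hα, map_zero, 𝒜.zero_comp, 𝒜.zero_comp]

lemma conj_right_zero (𝒜 : DGMod.{w, v, u} S) {M N M' N' : GRMod.{v} S} {a b d e : ℤ}
    (α : HomD M' M a) (β : HomD N N' b) (f : 𝒜.Hom M N d) (h : a + d + b = e)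
    (hβ : ∀ x, β.1 x = 0) : 𝒜.conj α β f h = 0 := by
  rw [conj, show β = 0 from HomD.ext hβ, map_zero, 𝒜.comp_zero]

variable {𝒜 : DGMod.{w, v, u} S}

namespace Tw

/-- The object `J(M, u) = (M ⊕ M[1], u_J)`, where `u_J` is the matrix with rows `(u, σ⁻¹)` and
`(0, -u[1])`. -/
@[reducible] def J (X : 𝒜.Tw) : 𝒜.Tw where
  obj := X.obj.prod (X.obj.shift 1)
  u := 𝒜.conj (HomD.fst _ _) (HomD.inl _ _) X.u (by norm_num : (0 : ℤ) + 1 + 0 = 1) +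
    𝒜.conj (HomD.snd _ _) (HomD.inl _ _) (𝒜.strict (HomD.sigInv X.obj 1))
      (by norm_num : (0 : ℤ) + 1 + 0 = 1) +
    𝒜.conj (HomD.snd _ _) (HomD.inr _ _) (X.shift 1).u (by norm_num : (0 : ℤ) + 1 + 0 = 1)
  mc := by
    have h2 : (1 : ℤ) + 1 = 2 := by norm_num
    have key : 𝒜.comp (𝒜.strict (HomD.sigInv X.obj 1)) X.u h2 +
        𝒜.comp (X.shift 1).u (𝒜.strict (HomD.sigInv X.obj 1)) h2 = 0 := by
      dsimp only [shift]
      rw [𝒜.zsmul_comp, 𝒜.strict_comp_eq, 𝒜.comp_strict_eq, shiftHom, 𝒜.conj_conj,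
        show sgn 1 = -1 from rfl, neg_smul, one_smul, add_neg_eq_zero]
      exact 𝒜.conj_congr _ _ _ _ _ _ _ (by norm_num) (fun _ => rfl) (fun _ => rfl)
    rw [𝒜.D_add, 𝒜.D_add, 𝒜.D_conj _ _ _ _ h2, 𝒜.D_conj _ _ _ _ h2, 𝒜.D_conj _ _ _ _ h2,
      𝒜.D_strict, 𝒜.conj_zero, smul_zero, add_zero, sgn_zero, one_smul, one_smul]
    simp only [𝒜.add_comp, 𝒜.comp_add]
    rw [𝒜.conj_comp _ _ (HomD.fst X.obj (X.obj.shift 1)) _ X.u X.u _ _ _ rfl (fun _ => rfl) h2,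
      𝒜.conj_comp _ _ (HomD.fst X.obj (X.obj.shift 1)) _ _ X.u _ _ _ rfl (fun _ => rfl) h2,
      𝒜.conj_comp _ _ (HomD.snd X.obj (X.obj.shift 1)) _ (X.shift 1).u (X.shift 1).u
        _ _ _ rfl (fun _ => rfl) h2,
      𝒜.conj_comp _ _ (HomD.snd X.obj (X.obj.shift 1)) _ (X.shift 1).u
        (𝒜.strict (HomD.sigInv X.obj 1)) _ _ _ rfl (fun _ => rfl) h2]
    rw [𝒜.conj_comp_zero _ _ (HomD.fst _ _) _ _ _ _ _ _ (fun _ => rfl),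
      𝒜.conj_comp_zero _ _ (HomD.snd _ _) _ _ _ _ _ _ (fun _ => rfl),
      𝒜.conj_comp_zero _ _ (HomD.snd _ _) _ _ _ _ _ _ (fun _ => rfl),
      𝒜.conj_comp_zero _ _ (HomD.snd _ _) _ _ _ _ _ _ (fun _ => rfl),
      𝒜.conj_comp_zero _ _ (HomD.snd _ _) _ _ _ _ _ _ (fun _ => rfl)]
    have k1 := 𝒜.conj_zero (HomD.snd X.obj (X.obj.shift 1)) (HomD.inl X.obj (X.obj.shift 1))
      (d := 2) (e := 2) (by norm_num)
    rw [← key, 𝒜.conj_add] at k1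
    have k2 := 𝒜.conj_zero (HomD.fst X.obj (X.obj.shift 1)) (HomD.inl X.obj (X.obj.shift 1))
      (d := 2) (e := 2) (by norm_num)
    rw [← X.mc, 𝒜.conj_add] at k2
    have k3 := 𝒜.conj_zero (HomD.snd X.obj (X.obj.shift 1)) (HomD.inr X.obj (X.obj.shift 1))
      (d := 2) (e := 2) (by norm_num)
    rw [← (X.shift 1).mc, 𝒜.conj_add] at k3
    have k := congrArg₂ (· + ·) (congrArg₂ (· + ·) k1 k2) k3
    simp only [add_zero] at k
    refine Eq.trans ?_ k
    abel

/-- The strict morphism `α = (id, 0)ᵗ : X → J X`. -/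
def α (X : 𝒜.Tw) : X ⟶ J X := ofStrict (Y := J X) (HomD.inl _ _) <| by
  rw [𝒜.comp_add, 𝒜.comp_add]
  simp only [𝒜.strict_comp_eq, 𝒜.comp_strict_eq, 𝒜.conj_conj]
  rw [𝒜.conj_left_zero _ _ (𝒜.strict (HomD.sigInv X.obj 1)) _ fun _ => rfl,
    𝒜.conj_left_zero _ _ (X.shift 1).u _ fun _ => rfl, add_zero, add_zero]
  exact 𝒜.conj_congr _ _ _ _ _ _ _ rfl (fun _ => rfl) (fun _ => rfl)

/-- The strict morphism `β = (0, id) : J X → T X`. -/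
def β (X : 𝒜.Tw) : J X ⟶ X⟦(1 : ℤ)⟧ := ofStrict (X := J X) (Y := X.shift 1) (HomD.snd _ _) <| by
  rw [𝒜.add_comp, 𝒜.add_comp]
  simp only [𝒜.strict_comp_eq, 𝒜.comp_strict_eq, 𝒜.conj_conj]
  rw [𝒜.conj_right_zero _ _ (𝒜.strict (HomD.sigInv X.obj 1)) _ fun _ => rfl,
    𝒜.conj_right_zero _ _ X.u _ fun _ => rfl]
  refine Eq.trans (𝒜.conj_congr _ _ _ _ _ _ _ rfl (fun _ => rfl) (fun _ => rfl))
    ((fun x => by abel : ∀ x : 𝒜.Hom (X.obj.prod (X.obj.shift 1)) (X.obj.shift 1) 1,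
      x = 0 + 0 + x) _)

/-- A conflation: a pair `X → E → Y` of morphisms with composition zero whose first components
form a short exact sequence `0 → X → E → Y → 0`. -/
structure IsConflation {X E Y : 𝒜.Tw} (f : X ⟶ E) (g : E ⟶ Y) : Prop where
  comp_eq_zero : f ≫ g = 0
  injective : Function.Injective (𝒜.fst f.hom).1
  exact : Function.Exact (𝒜.fst f.hom).1 (𝒜.fst g.hom).1
  surjective : Function.Surjective (𝒜.fst g.hom).1

/-- A canonical triangle, given by morphisms of twisted objects `f`, `g` and `h`. -/
structure IsCanonical {X E Y : 𝒜.Tw} (f : X ⟶ E) (g : E ⟶ Y) (h : Y ⟶ X⟦(1 : ℤ)⟧) : Prop where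
  conflation : IsConflation f g
  exists_lift : ∃ e : E ⟶ J X, f ≫ e = α X ∧ e ≫ β X = g ≫ h

end Tw

open Pretriangulated

/-- The triangles of the homotopy category: those isomorphic to the image of a canonical
triangle. -/
def triangles (𝒜 : DGMod.{w, v, u} S) : Set (Triangle 𝒜.Ho) :=
  {t | ∃ (X E Y : 𝒜.Tw) (f : X ⟶ E) (g : E ⟶ Y) (h : Y ⟶ X⟦(1 : ℤ)⟧), Tw.IsCanonical f g h ∧
    Nonempty (t ≅ (toHo 𝒜).mapTriangle.obj (Triangle.mk f g h))}

end DGMod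

namespace DGMod
open GRMod

variable {S : Type u} [Ring S]

/-- A differential graded functor `𝒜 → ℬ` with `M ↦ M[1]` on objects, which maps the strict
morphism given by `f : M → N` to the strict morphism given by the same map `M[1] → N[1]`. -/
structure DGFun (𝒜 : DGMod.{w, v, u} S) (ℬ : DGMod.{w, v, u} S) where
  map {M N : GRMod.{v} S} {d : ℤ} : 𝒜.Hom M N d →+ ℬ.Hom (M.shift 1) (N.shift 1) d
  map_comp {M N L : GRMod.{v} S} {d e n : ℤ} (f : 𝒜.Hom M N d) (g : 𝒜.Hom N L e) (h : d + e = n) :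
    map (𝒜.comp f g h) = ℬ.comp (map f) (map g) h
  map_D {M N : GRMod.{v} S} {d e : ℤ} (f : 𝒜.Hom M N d) (h : d + 1 = e) :
    map (𝒜.D f h) = ℬ.D (map f) h
  map_strict {M N : GRMod.{v} S} {d : ℤ} (f : HomD M N d) :
    map (𝒜.strict f) = ℬ.strict (f.shiftMap 1)

namespace DGFun

variable {𝒜 ℬ : DGMod.{w, v, u} S} (F : DGFun 𝒜 ℬ)

lemma map_shiftHom {M N : GRMod.{v} S} {d : ℤ} (f : 𝒜.Hom M N d) (n : ℤ) :
    F.map (𝒜.shiftHom f n) =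
      ℬ.conj ((HomD.sigInv M n).shiftMap 1) ((HomD.sig N n).shiftMap 1) (F.map f) (by omega) := by
  unfold DGMod.shiftHom DGMod.conj
  rw [F.map_comp, F.map_comp, F.map_strict, F.map_strict]

/-- The induced map on twisted objects: `(M, u) ↦ (M[1], F u)`. -/
@[reducible] def obj (X : 𝒜.Tw) : ℬ.Tw where
  obj := X.obj.shift 1
  u := F.map X.u
  mc := by rw [← F.map_D, ← F.map_comp, ← map_add, X.mc, map_zero]

/-- The induced functor on twisted objects: `(M, u) ↦ (M[1], F u)` and `f ↦ F f`. -/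
@[simps] def tw : 𝒜.Tw ⥤ ℬ.Tw where
  obj X := F.obj X
  map {X Y} f := ⟨F.map f.hom, by
    have h := f.mem
    rw [Tw.mem_homs] at h ⊢
    rw [← F.map_D, ← F.map_comp, ← F.map_comp, ← map_add, ← map_sub, h, map_zero]⟩
  map_id X := Tw.hom_ext (F.map_strict _)
  map_comp f g := Tw.hom_ext (F.map_comp _ _ _)

instance : F.tw.Additive where
  map_add {_ _ _ _} := Tw.hom_ext (_root_.map_add F.map _ _)

lemma tw_homotopic {X Y : 𝒜.Tw} {f g : X ⟶ Y} (h : Tw.homotopic 𝒜 f g) :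
    Tw.homotopic ℬ (F.tw.map f) (F.tw.map g) := by
  obtain ⟨h, e⟩ := h
  refine ⟨F.map h, ?_⟩
  have : F.map f.hom - F.map g.hom = ℬ.D (F.map h) (neg_add_cancel 1) +
      ℬ.comp (F.map h) (F.map Y.u) (neg_add_cancel 1) +
      ℬ.comp (F.map X.u) (F.map h) (add_neg_cancel 1) := by
    rw [← map_sub, e, map_add, map_add, F.map_D, F.map_comp, F.map_comp]
  exact this

/-- The identification of `F (Tⁿ X)` with `Tⁿ (F X)`, given by the identity map. -/
def shiftIso (X : 𝒜.Tw) (n : ℤ) : F.obj (X.shift n) ≅ (F.obj X).shift n :=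
  Tw.isoOfStrict (X := F.obj (X.shift n)) (Y := (F.obj X).shift n)
    (HomD.shiftSwap X.obj n 1) (HomD.shiftSwap X.obj 1 n)
    (by
      dsimp only [obj, Tw.shift]
      rw [map_zsmul, F.map_shiftHom, ℬ.zsmul_comp, ℬ.comp_zsmul, ℬ.strict_comp_eq,
        ℬ.comp_strict_eq, DGMod.shiftHom, ℬ.conj_conj, ℬ.conj_conj]
      congr 1)
    (by
      dsimp only [obj, Tw.shift]
      rw [map_zsmul, F.map_shiftHom, ℬ.zsmul_comp, ℬ.comp_zsmul, ℬ.strict_comp_eq,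
        ℬ.comp_strict_eq, DGMod.shiftHom, ℬ.conj_conj, ℬ.conj_conj]
      congr 1)
    (fun _ => rfl) (fun _ => rfl)

instance : F.tw.CommShift ℤ where
  commShiftIso n := NatIso.ofComponents
    (F := shiftFunctor 𝒜.Tw n ⋙ F.tw) (G := F.tw ⋙ shiftFunctor ℬ.Tw n)
    (fun X => F.shiftIso X n) fun {X Y} f => Tw.hom_ext <| by
    change ℬ.comp (F.map (𝒜.shiftHom f.hom n))
      (ℬ.strict (HomD.shiftSwap Y.obj n 1)) (add_zero 0) =
      ℬ.comp (ℬ.strict (HomD.shiftSwap X.obj n 1))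
      (ℬ.shiftHom (F.map f.hom) n) (add_zero 0)
    rw [F.map_shiftHom, ℬ.strict_comp_eq, ℬ.comp_strict_eq, DGMod.shiftHom,
      ℬ.conj_conj, ℬ.conj_conj]
    exact ℬ.conj_congr _ _ _ _ _ _ _ (by omega) (fun _ => rfl) (fun _ => rfl)
  commShiftIso_zero := by
    ext X
    rw [Functor.CommShift.isoZero_hom_app]
    change ℬ.strict (HomD.shiftSwap X.obj 0 1) =
      ℬ.comp (F.map (𝒜.strict (HomD.shiftZero X.obj)))
        (ℬ.strict (HomD.shiftZeroInv (X.obj.shift 1))) (add_zero 0)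
    rw [F.map_strict, ← ℬ.strict_comp]
    congr 1
  commShiftIso_add a b := by
    ext X
    rw [Functor.CommShift.isoAdd_hom_app]
    change ℬ.strict (HomD.shiftSwap X.obj (a + b) 1) =
      ℬ.comp (F.map (𝒜.strict (HomD.shiftAdd X.obj a b _ rfl)))
      (ℬ.comp (ℬ.strict (HomD.shiftSwap (X.obj.shift a) b 1))
        (ℬ.comp (ℬ.shiftHom (ℬ.strict (HomD.shiftSwap X.obj a 1)) b)
        (ℬ.strict (HomD.shiftAddInv (X.obj.shift 1) a b _ rfl)) (add_zero 0))
        (add_zero 0)) (add_zero 0)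
    rw [F.map_strict, DGMod.shiftHom, ℬ.conj_strict, ← ℬ.strict_comp, ← ℬ.strict_comp,
      ← ℬ.strict_comp]
    congr 1

/-- The induced functor between the homotopy categories. -/
noncomputable def ho : 𝒜.Ho ⥤ ℬ.Ho :=
  CategoryTheory.Quotient.lift (Tw.homotopic 𝒜) (F.tw ⋙ toHo ℬ)
    fun _ _ _ _ h => CategoryTheory.Quotient.sound _ (F.tw_homotopic h)

noncomputable instance : F.ho.CommShift ℤ :=
  CategoryTheory.Quotient.liftCommShift (F.tw ⋙ toHo ℬ) (Tw.homotopic 𝒜) ℤ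
    fun _ _ _ _ h => CategoryTheory.Quotient.sound _ (F.tw_homotopic h)

end DGFun

end DGMod

namespace AInfAlg
open DGMod

variable {k : Type w} [Field k] {S : Type u} [Ring S] [Algebra k S]

/-- The differential graded functor `M ↦ M[1]`, `f ↦ f̂` from graded `A`-modules to graded
`B_A`-modules. -/
noncomputable def hatFun (A : AInfAlg k S) :
    DGFun (A.GMod : DGMod.{max u v, v, u} S) A.bar.GMod where
  map := hat
  map_comp := hat_comp
  map_D := hat_diff
  map_strict := hat_strict'

/-- The functor `G : Mod_∞-A → TGMod⁰-B_A`, given by `(M, m) ↦ (M[1], m̂)` and `f ↦ f̂`. -/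
noncomputable abbrev G (A : AInfAlg k S) :
    (A.GMod : DGMod.{max u v, v, u} S).Tw ⥤ (A.bar.GMod : DGMod.{max u v, v, u} S).Tw :=
  A.hatFun.tw

/-- The functor induced by `G` between the homotopy categories. -/
noncomputable abbrev GHo (A : AInfAlg k S) :
    (A.GMod : DGMod.{max u v, v, u} S).Ho ⥤ (A.bar.GMod : DGMod.{max u v, v, u} S).Ho :=
  A.hatFun.ho

end AInfAlg

end AInfty

namespace AInfty

lemma sgn_neg_one : sgn (-1) = -1 := rfl

namespace DGMod

open GRMod

section Total

variable {S : Type u} [Ring S] (𝒜 : DGMod.{w, v, u} S)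

/-- The category of graded modules whose morphisms are the finite sums of homogeneous morphisms of
`𝒜`. -/
structure Tot (_ : DGMod.{w, v, u} S) : Type (max u (v + 1)) where
  ob ::
  obj : GRMod.{v} S

namespace Tot

/-- The composition of inhomogeneous morphisms, as a biadditive map. -/
def compHom (M N L : GRMod.{v} S) :
    (⨁ d, 𝒜.Hom M N d) →+ (⨁ d, 𝒜.Hom N L d) →+ ⨁ d, 𝒜.Hom M L d :=
  DirectSum.toAddMonoid fun d => AddMonoidHom.flip <| DirectSum.toAddMonoid fun e =>
    AddMonoidHom.flip <| AddMonoidHom.mk' (fun f => AddMonoidHom.mk'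
      (fun g => DirectSum.of (fun n => 𝒜.Hom M L n) (d + e) (𝒜.comp f g rfl))
      fun g g' => by rw [𝒜.comp_add, map_add])
      fun f f' => by ext g; simp [𝒜.add_comp]

lemma compHom_of {M N L : GRMod.{v} S} {d e n : ℤ} (f : 𝒜.Hom M N d) (g : 𝒜.Hom N L e)
    (h : d + e = n) :
    compHom 𝒜 M N L (DirectSum.of _ d f) (DirectSum.of _ e g) =
      DirectSum.of (fun n => 𝒜.Hom M L n) n (𝒜.comp f g h) := by
  subst h
  simp [compHom]

instance : Category 𝒜.Tot where
  Hom M N := ⨁ d, 𝒜.Hom M.obj N.obj d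
  id M := DirectSum.of (fun d => 𝒜.Hom M.obj M.obj d) 0 (𝒜.strict (HomD.id M.obj))
  comp f g := compHom 𝒜 _ _ _ f g
  id_comp {M N} f := by
    induction f using DirectSum.induction_on with
    | zero => exact map_zero _
    | of d f => rw [compHom_of 𝒜 _ _ (zero_add d), 𝒜.id_comp]
    | add f g hf hg => rw [map_add, hf, hg]
  comp_id {M N} f := by
    induction f using DirectSum.induction_on with
    | zero => rw [map_zero]; rfl
    | of d f => rw [compHom_of 𝒜 _ _ (add_zero d), 𝒜.comp_id]
    | add f g hf hg => rw [map_add, AddMonoidHom.add_apply, hf, hg]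
  assoc {M N L P} f g k := by
    induction f using DirectSum.induction_on with
    | zero => simp
    | add f f' hf hf' => simp only [map_add, AddMonoidHom.add_apply, hf, hf']
    | of d f =>
    induction g using DirectSum.induction_on with
    | zero => simp
    | add f f' hf hf' => simp only [map_add, AddMonoidHom.add_apply, hf, hf']
    | of e g =>
    induction k using DirectSum.induction_on with
    | zero => simp
    | add f f' hf hf' => simp only [map_add, hf, hf']
    | of c k =>
      rw [compHom_of 𝒜 f g rfl, compHom_of 𝒜 g k rfl, compHom_of 𝒜 _ k rfl,
        compHom_of 𝒜 f _ (add_assoc d e c).symm, 𝒜.assoc f g k rfl rfl rfl]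

instance (M N : 𝒜.Tot) : AddCommGroup (M ⟶ N) :=
  inferInstanceAs (AddCommGroup (⨁ d, 𝒜.Hom M.obj N.obj d))

instance : Preadditive 𝒜.Tot where
  add_comp M N L f f' g := by
    exact DFunLike.congr_fun (map_add (compHom 𝒜 M.obj N.obj L.obj) f f') g
  comp_add M N L f g g' := map_add (compHom 𝒜 M.obj N.obj L.obj f) g g'

end Tot

variable {M N L P : GRMod.{v} S}

/-- A homogeneous morphism as a morphism of the total category. -/
def tot {M N : GRMod.{v} S} {d : ℤ} (f : 𝒜.Hom M N d) : (Tot.ob M : 𝒜.Tot) ⟶ Tot.ob N :=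
  DirectSum.of (fun d => 𝒜.Hom M N d) d f

lemma tot_injective {d : ℤ} {f g : 𝒜.Hom M N d} (h : 𝒜.tot f = 𝒜.tot g) : f = g :=
  DirectSum.of_injective d h

@[simp] lemma tot_comp {d e n : ℤ} (f : 𝒜.Hom M N d) (g : 𝒜.Hom N L e) (h : d + e = n) :
    𝒜.tot (𝒜.comp f g h) = 𝒜.tot f ≫ 𝒜.tot g := (Tot.compHom_of 𝒜 f g h).symm

@[simp] lemma tot_add {d : ℤ} (f g : 𝒜.Hom M N d) : 𝒜.tot (f + g) = 𝒜.tot f + 𝒜.tot g :=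
  map_add (DirectSum.of (fun d => 𝒜.Hom M N d) d) f g

@[simp] lemma tot_sub {d : ℤ} (f g : 𝒜.Hom M N d) : 𝒜.tot (f - g) = 𝒜.tot f - 𝒜.tot g :=
  map_sub (DirectSum.of (fun d => 𝒜.Hom M N d) d) f g

@[simp] lemma tot_neg {d : ℤ} (f : 𝒜.Hom M N d) : 𝒜.tot (-f) = -𝒜.tot f :=
  map_neg (DirectSum.of (fun d => 𝒜.Hom M N d) d) f

@[simp] lemma tot_zero {d : ℤ} : 𝒜.tot (0 : 𝒜.Hom M N d) = 0 :=
  map_zero (DirectSum.of (fun d => 𝒜.Hom M N d) d)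

@[simp] lemma tot_zsmul {d : ℤ} (c : ℤ) (f : 𝒜.Hom M N d) : 𝒜.tot (c • f) = c • 𝒜.tot f :=
  map_zsmul (DirectSum.of (fun d => 𝒜.Hom M N d) d) c f

/-- The differential of a homogeneous morphism, in the total category. -/
def dtot {d : ℤ} (f : 𝒜.Hom M N d) : (Tot.ob M : 𝒜.Tot) ⟶ Tot.ob N := 𝒜.tot (𝒜.D f rfl)

@[simp] lemma tot_D {d e : ℤ} (f : 𝒜.Hom M N d) (h : d + 1 = e) : 𝒜.tot (𝒜.D f h) = 𝒜.dtot f := by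
  subst h; rfl

@[simp] lemma dtot_add {d : ℤ} (f g : 𝒜.Hom M N d) : 𝒜.dtot (f + g) = 𝒜.dtot f + 𝒜.dtot g := by
  simp only [dtot, 𝒜.D_add, tot_add]

@[simp] lemma dtot_neg {d : ℤ} (f : 𝒜.Hom M N d) : 𝒜.dtot (-f) = -𝒜.dtot f := by
  simp only [dtot, 𝒜.D_neg, tot_neg]

@[simp] lemma dtot_sub {d : ℤ} (f g : 𝒜.Hom M N d) : 𝒜.dtot (f - g) = 𝒜.dtot f - 𝒜.dtot g := by
  rw [sub_eq_add_neg, dtot_add, dtot_neg, sub_eq_add_neg]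

@[simp] lemma dtot_zero {d : ℤ} : 𝒜.dtot (0 : 𝒜.Hom M N d) = 0 := by
  rw [dtot, 𝒜.D_zero, tot_zero]

@[simp] lemma dtot_D {d e : ℤ} (f : 𝒜.Hom M N d) (h : d + 1 = e) : 𝒜.dtot (𝒜.D f h) = 0 := by
  rw [dtot, 𝒜.D_D, tot_zero]

@[simp] lemma dtot_comp {d e n : ℤ} (f : 𝒜.Hom M N d) (g : 𝒜.Hom N L e) (h : d + e = n) :
    𝒜.dtot (𝒜.comp f g h) = 𝒜.tot f ≫ 𝒜.dtot g + sgn e • (𝒜.dtot f ≫ 𝒜.tot g) := by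
  rw [dtot, 𝒜.leibniz f g h rfl rfl rfl (by omega) (by omega)]
  simp

/-- A strict morphism in the total category. -/
def st {d : ℤ} (α : HomD M N d) : (Tot.ob M : 𝒜.Tot) ⟶ Tot.ob N := 𝒜.tot (𝒜.strict α)

@[simp] lemma tot_strict {d : ℤ} (α : HomD M N d) : 𝒜.tot (𝒜.strict α) = 𝒜.st α := rfl

@[simp] lemma dtot_strict {d : ℤ} (α : HomD M N d) : 𝒜.dtot (𝒜.strict α) = 0 := by
  rw [dtot, 𝒜.D_strict, tot_zero]

lemma st_comp {d e n : ℤ} (α : HomD M N d) (β : HomD N L e) (h : d + e = n) :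
    𝒜.st α ≫ 𝒜.st β = 𝒜.st (α.comp β h) := by
  rw [st, st, ← tot_comp (h := h), ← 𝒜.strict_comp]; rfl

@[simp] lemma st_id : 𝒜.st (HomD.id M) = 𝟙 (Tot.ob M : 𝒜.Tot) := rfl

lemma st_congr {d e : ℤ} (α : HomD M N d) (β : HomD M N e) (h : d = e) (H : ∀ x, α.1 x = β.1 x) :
    𝒜.st α = 𝒜.st β := by
  subst h; rw [HomD.ext H]

lemma st_comp_eq_id {d e : ℤ} (α : HomD M N d) (β : HomD N M e) (h : d + e = 0)
    (H : ∀ x, β.1 (α.1 x) = x) : 𝒜.st α ≫ 𝒜.st β = 𝟙 (Tot.ob M : 𝒜.Tot) := by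
  rw [st_comp 𝒜 α β h, ← st_id]; exact st_congr _ _ _ rfl H

lemma st_comp_eq_zero {d e : ℤ} (α : HomD M N d) (β : HomD N L e)
    (H : ∀ x, β.1 (α.1 x) = 0) : 𝒜.st α ≫ 𝒜.st β = 0 := by
  rw [st_comp 𝒜 α β rfl, show α.comp β rfl = 0 from HomD.ext H, st, map_zero, tot_zero]

@[simp] lemma st_sig_sigInv (M : GRMod.{v} S) (n : ℤ) :
    𝒜.st (HomD.sig M n) ≫ 𝒜.st (HomD.sigInv M n) = 𝟙 (Tot.ob M : 𝒜.Tot) :=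
  𝒜.st_comp_eq_id _ _ (neg_add_cancel n) fun _ => rfl

@[simp] lemma st_sig_sigInv_assoc (M : GRMod.{v} S) (n : ℤ) {Z : 𝒜.Tot}
    (f : (Tot.ob M : 𝒜.Tot) ⟶ Z) :
    𝒜.st (HomD.sig M n) ≫ 𝒜.st (HomD.sigInv M n) ≫ f = f := by
  rw [← Category.assoc, st_sig_sigInv, Category.id_comp]

@[simp] lemma st_sigInv_sig (M : GRMod.{v} S) (n : ℤ) :
    𝒜.st (HomD.sigInv M n) ≫ 𝒜.st (HomD.sig M n) = 𝟙 (Tot.ob (M.shift n) : 𝒜.Tot) :=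
  𝒜.st_comp_eq_id _ _ (add_neg_cancel n) fun _ => rfl

@[simp] lemma st_sigInv_sig_assoc (M : GRMod.{v} S) (n : ℤ) {Z : 𝒜.Tot}
    (f : (Tot.ob (M.shift n) : 𝒜.Tot) ⟶ Z) :
    𝒜.st (HomD.sigInv M n) ≫ 𝒜.st (HomD.sig M n) ≫ f = f := by
  rw [← Category.assoc, st_sigInv_sig, Category.id_comp]

@[simp] lemma st_inl_fst (M N : GRMod.{v} S) :
    𝒜.st (HomD.inl M N) ≫ 𝒜.st (HomD.fst M N) = 𝟙 (Tot.ob M : 𝒜.Tot) :=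
  𝒜.st_comp_eq_id _ _ rfl fun _ => rfl

@[simp] lemma st_inl_fst_assoc (M N : GRMod.{v} S) {Z : 𝒜.Tot}
    (f : (Tot.ob M : 𝒜.Tot) ⟶ Z) : 𝒜.st (HomD.inl M N) ≫ 𝒜.st (HomD.fst M N) ≫ f = f := by
  rw [← Category.assoc, st_inl_fst, Category.id_comp]

@[simp] lemma st_inr_snd (M N : GRMod.{v} S) :
    𝒜.st (HomD.inr M N) ≫ 𝒜.st (HomD.snd M N) = 𝟙 (Tot.ob N : 𝒜.Tot) :=
  𝒜.st_comp_eq_id _ _ rfl fun _ => rfl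

@[simp] lemma st_inr_snd_assoc (M N : GRMod.{v} S) {Z : 𝒜.Tot}
    (f : (Tot.ob N : 𝒜.Tot) ⟶ Z) : 𝒜.st (HomD.inr M N) ≫ 𝒜.st (HomD.snd M N) ≫ f = f := by
  rw [← Category.assoc, st_inr_snd, Category.id_comp]

@[simp] lemma st_inl_snd (M N : GRMod.{v} S) :
    𝒜.st (HomD.inl M N) ≫ 𝒜.st (HomD.snd M N) = 0 :=
  𝒜.st_comp_eq_zero _ _ fun _ => rfl

@[simp] lemma st_inl_snd_assoc (M N : GRMod.{v} S) {Z : 𝒜.Tot}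
    (f : (Tot.ob N : 𝒜.Tot) ⟶ Z) : 𝒜.st (HomD.inl M N) ≫ 𝒜.st (HomD.snd M N) ≫ f = 0 := by
  rw [← Category.assoc, st_inl_snd, Limits.zero_comp]

@[simp] lemma st_inr_fst (M N : GRMod.{v} S) :
    𝒜.st (HomD.inr M N) ≫ 𝒜.st (HomD.fst M N) = 0 :=
  𝒜.st_comp_eq_zero _ _ fun _ => rfl

@[simp] lemma st_inr_fst_assoc (M N : GRMod.{v} S) {Z : 𝒜.Tot}
    (f : (Tot.ob M : 𝒜.Tot) ⟶ Z) : 𝒜.st (HomD.inr M N) ≫ 𝒜.st (HomD.fst M N) ≫ f = 0 := by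
  rw [← Category.assoc, st_inr_fst, Limits.zero_comp]

lemma st_prod (M N : GRMod.{v} S) :
    𝒜.st (HomD.fst M N) ≫ 𝒜.st (HomD.inl M N) + 𝒜.st (HomD.snd M N) ≫ 𝒜.st (HomD.inr M N) =
      𝟙 (Tot.ob (M.prod N) : 𝒜.Tot) := by
  rw [st_comp 𝒜 _ _ (add_zero 0), st_comp 𝒜 _ _ (add_zero 0), ← st_id, st, st, st, ← tot_add,
    ← map_add]
  congr 2
  exact HomD.ext fun x => Prod.ext (add_zero _) (zero_add _)

@[simp] lemma tot_conj {M' N' : GRMod.{v} S} {a b d e : ℤ} (α : HomD M' M a) (β : HomD N N' b)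
    (f : 𝒜.Hom M N d) (h : a + d + b = e) :
    𝒜.tot (𝒜.conj α β f h) = 𝒜.st α ≫ 𝒜.tot f ≫ 𝒜.st β := by
  simp [conj, Category.assoc]

@[simp] lemma dtot_conj {M' N' : GRMod.{v} S} {a b d e : ℤ} (α : HomD M' M a) (β : HomD N N' b)
    (f : 𝒜.Hom M N d) (h : a + d + b = e) :
    𝒜.dtot (𝒜.conj α β f h) = sgn b • (𝒜.st α ≫ 𝒜.dtot f ≫ 𝒜.st β) := by
  simp [conj, Category.assoc]

@[simp] lemma tot_shiftHom {d : ℤ} (f : 𝒜.Hom M N d) (n : ℤ) :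
    𝒜.tot (𝒜.shiftHom f n) = 𝒜.st (HomD.sigInv M n) ≫ 𝒜.tot f ≫ 𝒜.st (HomD.sig N n) := by
  simp [shiftHom]

@[simp] lemma dtot_shiftHom {d : ℤ} (f : 𝒜.Hom M N d) (n : ℤ) :
    𝒜.dtot (𝒜.shiftHom f n) =
      sgn n • (𝒜.st (HomD.sigInv M n) ≫ 𝒜.dtot f ≫ 𝒜.st (HomD.sig N n)) := by
  rw [shiftHom, dtot_conj, sgn_congr (show Even (-n - n) from ⟨-n, by ring⟩)]

end Total

namespace Tw

variable {S : Type u} [Ring S] {𝒜 : DGMod.{w, v, u} S} {X Y Z W : 𝒜.Tw}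

lemma dtot_u (X : 𝒜.Tw) : 𝒜.dtot X.u = -(𝒜.tot X.u ≫ 𝒜.tot X.u) := by
  have := congrArg 𝒜.tot X.mc
  rw [tot_add, tot_D, tot_comp, tot_zero] at this
  exact eq_neg_of_add_eq_zero_left this

lemma dtot_hom (f : X ⟶ Y) :
    𝒜.dtot f.hom = 𝒜.tot X.u ≫ 𝒜.tot f.hom - 𝒜.tot f.hom ≫ 𝒜.tot Y.u := by
  have := congrArg 𝒜.tot (D_hom f)
  simpa using this

lemma mem_homs_iff (f : 𝒜.Hom X.obj Y.obj 0) : f ∈ homs X Y ↔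
    𝒜.dtot f = 𝒜.tot X.u ≫ 𝒜.tot f - 𝒜.tot f ≫ 𝒜.tot Y.u := by
  rw [mem_homs]
  constructor
  · intro h
    have := congrArg 𝒜.tot h
    simp only [tot_sub, tot_add, tot_D, tot_comp, tot_zero] at this
    rw [← sub_eq_zero, ← this]; abel
  · intro h
    apply 𝒜.tot_injective
    simp only [tot_sub, tot_add, tot_D, tot_comp, tot_zero, h]
    abel

lemma tot_ext {f g : X ⟶ Y} (h : 𝒜.tot f.hom = 𝒜.tot g.hom) : f = g :=
  hom_ext (𝒜.tot_injective h)

@[simp] lemma tot_comp_hom (f : X ⟶ Y) (g : Y ⟶ Z) :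
    𝒜.tot (f ≫ g).hom = 𝒜.tot f.hom ≫ 𝒜.tot g.hom := 𝒜.tot_comp _ _ _

@[simp] lemma neg_hom (f : X ⟶ Y) : (-f).hom = -f.hom := rfl

@[simp] lemma tot_shift_hom (f : X ⟶ Y) (n : ℤ) :
    𝒜.tot (f⟦n⟧').hom =
      𝒜.st (HomD.sigInv X.obj n) ≫ 𝒜.tot f.hom ≫ 𝒜.st (HomD.sig Y.obj n) :=
  𝒜.tot_shiftHom _ _

lemma tot_shift_u (X : 𝒜.Tw) (n : ℤ) : 𝒜.tot (X.shift n).u =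
    sgn n • (𝒜.st (HomD.sigInv X.obj n) ≫ 𝒜.tot X.u ≫ 𝒜.st (HomD.sig X.obj n)) := by
  simp

end Tw

end DGMod

end AInfty

namespace AInfty

namespace DGMod

open GRMod

namespace Tw

variable {S : Type u} [Ring S] {𝒜 : DGMod.{w, v, u} S} {X Y Z W : 𝒜.Tw}

/-- The first component of a morphism of twisted objects. -/
def cmp (f : X ⟶ Y) : X.obj →ₗ[Sᵐᵒᵖ] Y.obj := (𝒜.fst f.hom).1

@[simp] lemma cmp_comp (f : X ⟶ Y) (g : Y ⟶ Z) (x : X.obj) : cmp (f ≫ g) x = cmp g (cmp f x) := by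
  unfold cmp; rw [comp_hom, 𝒜.fst_comp]; rfl

@[simp] lemma cmp_id (x : X.obj) : cmp (𝟙 X) x = x := by
  unfold cmp; rw [id_hom, 𝒜.fst_strict]; rfl

@[simp] lemma cmp_add (f g : X ⟶ Y) (x : X.obj) : cmp (f + g) x = cmp f x + cmp g x := by
  unfold cmp; rw [add_hom, map_add]; rfl

@[simp] lemma cmp_neg (f : X ⟶ Y) (x : X.obj) : cmp (-f) x = -cmp f x := by
  unfold cmp; rw [neg_hom, map_neg]; rfl

@[simp] lemma cmp_zero (x : X.obj) : cmp (0 : X ⟶ Y) x = 0 := by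
  unfold cmp; rw [zero_hom, map_zero]; rfl

@[simp] lemma cmp_sub (f g : X ⟶ Y) (x : X.obj) : cmp (f - g) x = cmp f x - cmp g x := by
  rw [sub_eq_add_neg, cmp_add, cmp_neg, sub_eq_add_neg]

@[simp] lemma cmp_α (x : X.obj) : cmp (α X) x = (x, 0) := by
  unfold cmp; rw [α, ofStrict_hom, 𝒜.fst_strict]; rfl

lemma cmp_β (x : (J X).obj) : cmp (β X) x = x.2 :=
  congrArg (fun φ : HomD _ _ 0 => φ.1 x) (𝒜.fst_strict (HomD.snd X.obj (X.obj.shift 1)))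

lemma isConflation_iff (f : X ⟶ Y) (g : Y ⟶ Z) : IsConflation f g ↔
    f ≫ g = 0 ∧ Function.Injective (cmp f) ∧ Function.Exact (cmp f) (cmp g) ∧
      Function.Surjective (cmp g) :=
  ⟨fun h => ⟨h.1, h.2, h.3, h.4⟩, fun h => ⟨h.1, h.2.1, h.2.2.1, h.2.2.2⟩⟩

section Ext

variable (X Y : 𝒜.Tw) (t : 𝒜.Hom Y.obj X.obj 1)
  (ht : 𝒜.dtot t + 𝒜.tot t ≫ 𝒜.tot X.u + 𝒜.tot Y.u ≫ 𝒜.tot t = 0)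

/-- The extension of `Y` by `X` with underlying module `X ⊕ Y` defined by `t : Y → X` of degree
`1`. -/
@[reducible] def ext : 𝒜.Tw where
  obj := X.obj.prod Y.obj
  u := 𝒜.conj (HomD.fst _ _) (HomD.inl _ _) X.u (by norm_num : (0 : ℤ) + 1 + 0 = 1) +
    𝒜.conj (HomD.snd _ _) (HomD.inl _ _) t (by norm_num : (0 : ℤ) + 1 + 0 = 1) +
    𝒜.conj (HomD.snd _ _) (HomD.inr _ _) Y.u (by norm_num : (0 : ℤ) + 1 + 0 = 1)
  mc := by
    apply 𝒜.tot_injective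
    have ht' : 𝒜.dtot t = -(𝒜.tot t ≫ 𝒜.tot X.u) - 𝒜.tot Y.u ≫ 𝒜.tot t := by
      rw [← sub_eq_zero, ← ht]; abel
    simp [dtot_u, ht', Preadditive.add_comp, Preadditive.comp_add, Preadditive.comp_sub,
      Preadditive.sub_comp]
    abel

lemma tot_ext_u : 𝒜.tot (ext X Y t ht).u =
    𝒜.st (HomD.fst X.obj Y.obj) ≫ 𝒜.tot X.u ≫ 𝒜.st (HomD.inl X.obj Y.obj) +
    𝒜.st (HomD.snd X.obj Y.obj) ≫ 𝒜.tot t ≫ 𝒜.st (HomD.inl X.obj Y.obj) +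
    𝒜.st (HomD.snd X.obj Y.obj) ≫ 𝒜.tot Y.u ≫ 𝒜.st (HomD.inr X.obj Y.obj) := by
  simp

/-- The inclusion of `X` in an extension of `Y` by `X`. -/
def inl : X ⟶ ext X Y t ht where
  hom := 𝒜.strict (HomD.inl X.obj Y.obj)
  mem := by
    rw [mem_homs_iff, tot_ext_u]
    simp [Preadditive.comp_add]

/-- The projection onto `Y` of an extension of `Y` by `X`. -/
def snd : ext X Y t ht ⟶ Y where
  hom := 𝒜.strict (HomD.snd X.obj Y.obj)
  mem := by
    rw [mem_homs_iff, tot_ext_u]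
    simp [Preadditive.add_comp]

variable {X Y t}

/-- The morphism to an extension of `Y` by `X` with components `a` and `b`. -/
def lift (a : 𝒜.Hom W.obj X.obj 0) (b : W ⟶ Y) (h : 𝒜.dtot a =
    𝒜.tot W.u ≫ 𝒜.tot a - 𝒜.tot a ≫ 𝒜.tot X.u - 𝒜.tot b.hom ≫ 𝒜.tot t) : W ⟶ ext X Y t ht where
  hom := 𝒜.comp a (𝒜.strict (HomD.inl X.obj Y.obj)) (add_zero 0) +
    𝒜.comp b.hom (𝒜.strict (HomD.inr X.obj Y.obj)) (add_zero 0)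
  mem := by
    rw [mem_homs_iff, tot_ext_u]
    simp [Preadditive.add_comp, Preadditive.comp_add, h, dtot_hom, Preadditive.sub_comp]
    abel

@[simp] lemma tot_inl : 𝒜.tot (inl X Y t ht).hom = 𝒜.st (HomD.inl X.obj Y.obj) := rfl
@[simp] lemma tot_snd : 𝒜.tot (snd X Y t ht).hom = 𝒜.st (HomD.snd X.obj Y.obj) := rfl

@[simp] lemma tot_lift (a : 𝒜.Hom W.obj X.obj 0) (b : W ⟶ Y) (h) :
    𝒜.tot (lift ht a b h).hom = 𝒜.tot a ≫ 𝒜.st (HomD.inl X.obj Y.obj) +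
      𝒜.tot b.hom ≫ 𝒜.st (HomD.inr X.obj Y.obj) := by
  simp [lift]

lemma inl_snd : inl X Y t ht ≫ snd X Y t ht = 0 := tot_ext (by simp)

lemma lift_snd (a : 𝒜.Hom W.obj X.obj 0) (b : W ⟶ Y) (h) : lift ht a b h ≫ snd X Y t ht = b :=
  tot_ext (by simp [Preadditive.add_comp])

@[simp] lemma cmp_inl (x : X.obj) : cmp (inl X Y t ht) x = (x, 0) := by
  unfold cmp; rw [inl, 𝒜.fst_strict]; rfl

@[simp] lemma cmp_snd (x : (ext X Y t ht).obj) : cmp (snd X Y t ht) x = x.2 := by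
  unfold cmp; rw [snd, 𝒜.fst_strict]; rfl

@[simp] lemma cmp_lift (a : 𝒜.Hom W.obj X.obj 0) (b : W ⟶ Y) (h) (x : W.obj) :
    cmp (lift ht a b h) x = ((𝒜.fst a).1 x, cmp b x) := by
  unfold cmp
  rw [lift, map_add, 𝒜.fst_comp, 𝒜.fst_comp, 𝒜.fst_strict, 𝒜.fst_strict]
  exact Prod.ext (add_zero _) (zero_add _)

/-- The first component of a morphism to an extension. -/
def pr (e : W ⟶ ext X Y t ht) : 𝒜.Hom W.obj X.obj 0 :=
  𝒜.comp e.hom (𝒜.strict (HomD.fst X.obj Y.obj)) (add_zero 0)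

@[simp] lemma tot_pr (e : W ⟶ ext X Y t ht) :
    𝒜.tot (pr ht e) = 𝒜.tot e.hom ≫ 𝒜.st (HomD.fst X.obj Y.obj) := by simp [pr]

lemma dtot_pr (e : W ⟶ ext X Y t ht) : 𝒜.dtot (pr ht e) =
    𝒜.tot W.u ≫ 𝒜.tot (pr ht e) - 𝒜.tot (pr ht e) ≫ 𝒜.tot X.u -
      𝒜.tot (e ≫ snd X Y t ht).hom ≫ 𝒜.tot t := by
  rw [pr, dtot_comp, dtot_hom, tot_ext_u]
  simp [Preadditive.add_comp, Preadditive.comp_add, Preadditive.sub_comp]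
  abel

lemma isConflation_ext : IsConflation (inl X Y t ht) (snd X Y t ht) := by
  rw [isConflation_iff]
  refine ⟨inl_snd ht, fun x y h => ?_, fun y => ⟨fun h => ⟨y.1, ?_⟩, ?_⟩, fun y => ⟨(0, y), cmp_snd ht (0, y)⟩⟩
  · rw [cmp_inl, cmp_inl] at h
    exact congrArg Prod.fst h
  · rw [cmp_snd] at h
    rw [cmp_inl, ← h]
  · rintro ⟨x, rfl⟩
    rw [cmp_inl, cmp_snd]

end Ext

section DirectSum

variable (X Y : 𝒜.Tw)

/-- The direct sum of twisted objects. -/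
@[reducible] def sum : 𝒜.Tw := ext X Y 0 (by simp)

/-- The projection to the first summand. -/
def sumFst : sum X Y ⟶ X where
  hom := 𝒜.strict (HomD.fst X.obj Y.obj)
  mem := by
    rw [mem_homs_iff, tot_ext_u]
    simp [Preadditive.add_comp]

/-- The inclusion of the first summand. -/
def sumInl : X ⟶ sum X Y := inl X Y 0 (by simp)

/-- The inclusion of the second summand. -/
def sumInr : Y ⟶ sum X Y where
  hom := 𝒜.strict (HomD.inr X.obj Y.obj)
  mem := by
    rw [mem_homs_iff, tot_ext_u]
    simp [Preadditive.comp_add]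

/-- The projection to the second summand. -/
def sumSnd : sum X Y ⟶ Y := snd X Y 0 (by simp)

lemma sumInl_fst : sumInl X Y ≫ sumFst X Y = 𝟙 X := tot_ext (by simp [sumInl, sumFst])
lemma sumInl_snd : sumInl X Y ≫ sumSnd X Y = 0 := inl_snd _

lemma sum_total : sumFst X Y ≫ sumInl X Y + sumSnd X Y ≫ sumInr X Y = 𝟙 (sum X Y) :=
  tot_ext (by simpa [sumInl, sumFst, sumSnd, sumInr] using 𝒜.st_prod X.obj Y.obj)

@[simp] lemma cmp_sumSnd (x : (sum X Y).obj) : cmp (sumSnd X Y) x = x.2 := cmp_snd _ x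
@[simp] lemma cmp_sumFst (x : (sum X Y).obj) : cmp (sumFst X Y) x = x.1 := by
  unfold cmp; rw [sumFst, 𝒜.fst_strict]; rfl

end DirectSum

section Contractible

lemma sigInv_mc (X : 𝒜.Tw) : 𝒜.dtot (𝒜.strict (HomD.sigInv X.obj 1)) +
    𝒜.tot (𝒜.strict (HomD.sigInv X.obj 1)) ≫ 𝒜.tot X.u +
    𝒜.tot (X.shift 1).u ≫ 𝒜.tot (𝒜.strict (HomD.sigInv X.obj 1)) = 0 := by simp

lemma snd_J (X : 𝒜.Tw) : snd X (X.shift 1) _ (sigInv_mc X) = β X := rfl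

lemma tot_J_u (X : 𝒜.Tw) : 𝒜.tot (J X).u =
    𝒜.st (HomD.fst X.obj (X.obj.shift 1)) ≫ 𝒜.tot X.u ≫ 𝒜.st (HomD.inl X.obj (X.obj.shift 1)) +
    𝒜.st (HomD.snd X.obj (X.obj.shift 1)) ≫ 𝒜.st (HomD.sigInv X.obj 1) ≫
      𝒜.st (HomD.inl X.obj (X.obj.shift 1)) -
    𝒜.st (HomD.snd X.obj (X.obj.shift 1)) ≫ 𝒜.st (HomD.sigInv X.obj 1) ≫ 𝒜.tot X.u ≫
      𝒜.st (HomD.sig X.obj 1) ≫ 𝒜.st (HomD.inr X.obj (X.obj.shift 1)) := by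
  refine (tot_ext_u X (X.shift 1) _ (sigInv_mc X)).trans ?_
  simp [sub_eq_add_neg]

@[simp] lemma tot_α (X : 𝒜.Tw) : 𝒜.tot (α X).hom = 𝒜.st (HomD.inl X.obj (X.obj.shift 1)) := rfl
@[simp] lemma tot_β (X : 𝒜.Tw) : 𝒜.tot (β X).hom = 𝒜.st (HomD.snd X.obj (X.obj.shift 1)) := rfl

/-- The morphism to `J X` given by a map `a : W → X`. -/
def toJ (a : 𝒜.Hom W.obj X.obj 0) : W ⟶ J X :=
  lift (Y := X.shift 1) (sigInv_mc X) a
    ⟨𝒜.comp (𝒜.comp W.u a (add_zero 1) - 𝒜.comp a X.u (zero_add 1) - 𝒜.D a (zero_add 1))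
      (𝒜.strict (HomD.sig X.obj 1)) (by norm_num), by
      rw [mem_homs_iff, tot_shift_u]
      simp [Preadditive.add_comp, Preadditive.sub_comp, Preadditive.comp_sub, dtot_u, sgn_neg_one]
      abel⟩ (by
      simp [Preadditive.sub_comp])

@[simp] lemma pr_toJ (a : 𝒜.Hom W.obj X.obj 0) :
    pr (Y := X.shift 1) (sigInv_mc X) (toJ a) = a :=
  𝒜.tot_injective (by rw [tot_pr, toJ, tot_lift]; simp [Preadditive.add_comp])

lemma tot_comp_β (e : W ⟶ J X) : 𝒜.tot (e ≫ β X).hom =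
    (𝒜.tot W.u ≫ 𝒜.tot (pr (Y := X.shift 1) (sigInv_mc X) e) -
      𝒜.tot (pr (Y := X.shift 1) (sigInv_mc X) e) ≫ 𝒜.tot X.u -
      𝒜.dtot (pr (Y := X.shift 1) (sigInv_mc X) e)) ≫ 𝒜.st (HomD.sig X.obj 1) := by
  rw [dtot_pr, snd_J]
  simp only [tot_strict, sub_sub_cancel, Category.assoc, st_sigInv_sig]
  exact (Category.comp_id _).symm

lemma J_hom_ext {e e' : W ⟶ J X}
    (h : pr (Y := X.shift 1) (sigInv_mc X) e = pr (Y := X.shift 1) (sigInv_mc X) e') : e = e' := by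
  apply tot_ext
  have h1 := tot_comp_β e
  rw [h, ← tot_comp_β e'] at h1
  have h2 := congrArg 𝒜.tot h
  rw [tot_pr, tot_pr] at h2
  rw [tot_comp_hom, tot_comp_hom, tot_β] at h1
  replace h2 : 𝒜.tot e.hom ≫ 𝒜.st (HomD.fst X.obj (X.obj.shift 1)) =
    𝒜.tot e'.hom ≫ 𝒜.st (HomD.fst X.obj (X.obj.shift 1)) := h2
  replace h1 : 𝒜.tot e.hom ≫ 𝒜.st (HomD.snd X.obj (X.obj.shift 1)) =
    𝒜.tot e'.hom ≫ 𝒜.st (HomD.snd X.obj (X.obj.shift 1)) := h1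
  rw [← Category.comp_id (𝒜.tot e.hom), ← Category.comp_id (𝒜.tot e'.hom), ← st_prod,
    Preadditive.comp_add, Preadditive.comp_add]
  simp only [← Category.assoc, h1, h2]

lemma pr_comp (f : W ⟶ Z) (e : Z ⟶ J X) : pr (Y := X.shift 1) (sigInv_mc X) (f ≫ e) =
    𝒜.comp f.hom (pr (Y := X.shift 1) (sigInv_mc X) e) (add_zero 0) :=
  𝒜.tot_injective (by simp)

lemma pr_α : pr (Y := X.shift 1) (sigInv_mc X) (α X) = 𝒜.strict (HomD.id X.obj) :=
  𝒜.tot_injective (by simp [st_id])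

lemma comp_toJ {f : X ⟶ W} {a : 𝒜.Hom W.obj X.obj 0}
    (h : 𝒜.comp f.hom a (add_zero 0) = 𝒜.strict (HomD.id X.obj)) : f ≫ toJ a = α X :=
  J_hom_ext ((pr_comp f (toJ a)).trans ((congrArg (fun z => 𝒜.comp f.hom z (add_zero 0))
    (pr_toJ a)).trans (h.trans pr_α.symm)))

/-- The morphism `J X → J Y` induced by `f : X → Y`. -/
def Jmap (f : X ⟶ Y) : J X ⟶ J Y :=
  toJ (𝒜.comp (𝒜.strict (HomD.fst X.obj (X.obj.shift 1))) f.hom (add_zero 0))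

lemma α_Jmap (f : X ⟶ Y) : α X ≫ Jmap f = f ≫ α Y := J_hom_ext <| by
  rw [pr_comp, pr_comp, Jmap, pr_toJ, pr_α]
  exact 𝒜.tot_injective (by simp [st_id])

lemma Jmap_β (f : X ⟶ Y) : Jmap f ≫ β Y = β X ≫ f⟦(1 : ℤ)⟧' := tot_ext <| by
  rw [tot_comp_β, Jmap, pr_toJ, tot_J_u]
  refine Eq.trans ?_ (tot_comp_hom (β X) (f⟦(1 : ℤ)⟧')).symm
  refine Eq.trans ?_ (congrArg (𝒜.st (HomD.snd X.obj (X.obj.shift 1)) ≫ ·)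
    (tot_shift_hom f 1)).symm
  simp [Preadditive.add_comp, dtot_hom, Preadditive.sub_comp, Preadditive.comp_sub]
  rfl

/-- The morphism `J X → Y` given by a map `h : X → Y` of degree `-1`. -/
def fromJ (h : 𝒜.Hom X.obj Y.obj (-1)) : J X ⟶ Y where
  hom := 𝒜.comp (𝒜.strict (HomD.fst X.obj (X.obj.shift 1)))
      (𝒜.D h (neg_add_cancel 1) + 𝒜.comp h Y.u (neg_add_cancel 1) +
        𝒜.comp X.u h (add_neg_cancel 1)) (add_zero 0) +
    𝒜.comp (𝒜.strict (HomD.snd X.obj (X.obj.shift 1)))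
      (𝒜.comp (𝒜.strict (HomD.sigInv X.obj 1)) h (add_neg_cancel 1)) (add_zero 0)
  mem := by
    rw [mem_homs_iff, tot_J_u]
    simp [Preadditive.add_comp, Preadditive.comp_add, dtot_u, sgn_neg_one]
    abel

lemma tot_α_fromJ (h : 𝒜.Hom X.obj Y.obj (-1)) : 𝒜.tot (α X ≫ fromJ h).hom =
    𝒜.dtot h + 𝒜.tot h ≫ 𝒜.tot Y.u + 𝒜.tot X.u ≫ 𝒜.tot h := by
  simp [fromJ, Preadditive.comp_add]

lemma homotopic_zero_iff (f : X ⟶ Y) : homotopic 𝒜 f 0 ↔ ∃ k : J X ⟶ Y, f = α X ≫ k := by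
  constructor
  · rintro ⟨h, e⟩
    refine ⟨fromJ h, tot_ext ?_⟩
    rw [tot_α_fromJ]
    rw [zero_hom, sub_zero] at e
    rw [e]; simp
  · rintro ⟨k, rfl⟩
    refine ⟨𝒜.comp (𝒜.strict (HomD.sig X.obj 1))
      (𝒜.comp (𝒜.strict (HomD.inr X.obj (X.obj.shift 1))) k.hom (add_zero 0)) (add_zero (-1)), ?_⟩
    apply 𝒜.tot_injective
    rw [zero_hom, sub_zero, tot_comp_hom, tot_add, tot_add, tot_D, dtot_comp, dtot_comp, dtot_hom,
      tot_J_u]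
    simp [Preadditive.add_comp, Preadditive.comp_add, Preadditive.comp_sub]

lemma map_eq_zero_iff (f : X ⟶ Y) : (toHo 𝒜).map f = 0 ↔ ∃ k : J X ⟶ Y, f = α X ≫ k := by
  rw [← homotopic_zero_iff, ← (toHo 𝒜).map_zero]
  exact Quotient.functor_map_eq_iff _ _ _

lemma map_eq_iff (f g : X ⟶ Y) :
    (toHo 𝒜).map f = (toHo 𝒜).map g ↔ ∃ k : J X ⟶ Y, f - g = α X ≫ k := by
  rw [← map_eq_zero_iff, Functor.map_sub, sub_eq_zero]

lemma isZero_J (X : 𝒜.Tw) : Limits.IsZero ((toHo 𝒜).obj (J X)) := by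
  rw [Limits.IsZero.iff_id_eq_zero, ← (toHo 𝒜).map_id, ← (toHo 𝒜).map_zero]
  refine (Quotient.functor_map_eq_iff _ _ _).2 ⟨𝒜.conj (HomD.fst X.obj (X.obj.shift 1))
    (HomD.inr X.obj (X.obj.shift 1)) (𝒜.strict (HomD.sig X.obj 1)) (by norm_num), ?_⟩
  apply 𝒜.tot_injective
  rw [tot_add, tot_add, tot_D, tot_comp, tot_comp, tot_J_u, zero_hom, sub_zero, id_hom, tot_strict,
    st_id, ← st_prod]
  simp [Preadditive.add_comp, Preadditive.comp_add]
  abel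

lemma map_to_J (f : W ⟶ J X) : (toHo 𝒜).map f = 0 := (isZero_J X).eq_of_tgt _ _

end Contractible

end Tw

end DGMod

end AInfty

namespace AInfty

section GradedSplitting

variable {S : Type u} [Ring S]

namespace GRMod.HomD

variable {M N : GRMod.{v} S}

/-- The component of degree `0` of a linear map between graded modules. -/
noncomputable def part (φ : M →ₗ[Sᵐᵒᵖ] N) : M →ₗ[Sᵐᵒᵖ] N :=
  (DirectSum.toModule Sᵐᵒᵖ ℤ N fun i => (N.grd.gr i).subtype ∘ₗ
    DirectSum.component Sᵐᵒᵖ ℤ (fun i => N.grd.gr i) i ∘ₗ N.grd.dec.toLinearMap ∘ₗ φ ∘ₗ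
    (M.grd.gr i).subtype) ∘ₗ M.grd.dec.toLinearMap

lemma part_of_mem (φ : M →ₗ[Sᵐᵒᵖ] N) {i : ℤ} {x : M} (hx : x ∈ M.grd.gr i) :
    part φ x = (N.grd.dec (φ x) i : N) := by
  change DirectSum.toModule _ _ _ _ (M.grd.dec x) = _
  rw [M.grd.dec_of_mem hx]
  exact DirectSum.toModule_lof Sᵐᵒᵖ i _

/-- An injective homogeneous map of degree `0` of graded modules which has a linear retraction has a
homogeneous retraction of degree `0`. -/
lemma exists_retraction (f : HomD M N 0) (r : N →ₗ[Sᵐᵒᵖ] M) (hr : ∀ x, r (f.1 x) = x) :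
    ∃ r' : HomD N M 0, ∀ x, r'.1 (f.1 x) = x := by
  refine ⟨⟨part r, fun i x hx => ?_⟩, fun x => ?_⟩
  · rw [part_of_mem r hx, add_zero]
    exact Subtype.property _
  · change part r (f.1 x) = x
    induction x using M.grd.induction with
    | mem i x hx =>
      have h1 := f.2 i x hx
      rw [add_zero] at h1
      rw [part_of_mem r h1, hr, M.grd.dec_of_mem hx, DirectSum.of_eq_same]
    | add x y hx hy => rw [map_add, map_add, hx, hy]

lemma exists_retraction_of_injective [IsSemisimpleRing S] (f : HomD M N 0)
    (hf : Function.Injective f.1) : ∃ r : HomD N M 0, ∀ x, r.1 (f.1 x) = x := by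
  obtain ⟨r, hr⟩ := IsSemisimpleModule.extension_property f.1 hf LinearMap.id
  exact exists_retraction f r fun x => LinearMap.congr_fun hr x

lemma exists_inverse_of_bijective (f : HomD M N 0) (hf : Function.Bijective f.1) :
    ∃ r : HomD N M 0, (∀ x, r.1 (f.1 x) = x) ∧ ∀ y, f.1 (r.1 y) = y := by
  obtain ⟨r, hr⟩ := exists_retraction f (LinearEquiv.ofBijective f.1 hf).symm.toLinearMap
    fun x => (LinearEquiv.ofBijective f.1 hf).symm_apply_apply x
  refine ⟨r, hr, fun y => ?_⟩
  obtain ⟨x, rfl⟩ := hf.2 y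
  rw [hr]

end GRMod.HomD

end GradedSplitting

namespace DGMod

open GRMod

variable {S : Type u} [Ring S] {𝒜 : DGMod.{w, v, u} S}

/-- The endomorphisms of degree `0` whose first component is the identity are invertible. -/
class Unipotent (𝒜 : DGMod.{w, v, u} S) : Prop where
  exists_inverse {M : GRMod.{v} S} (f : 𝒜.Hom M M 0) (hf : 𝒜.fst f = HomD.id M) :
    ∃ g : 𝒜.Hom M M 0, 𝒜.comp f g (add_zero 0) = 𝒜.strict (HomD.id M) ∧
      𝒜.comp g f (add_zero 0) = 𝒜.strict (HomD.id M)

lemma exists_inverse [Unipotent 𝒜] {M N : GRMod.{v} S} (f : 𝒜.Hom M N 0)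
    (hf : Function.Bijective (𝒜.fst f).1) : ∃ g : 𝒜.Hom N M 0,
      𝒜.tot f ≫ 𝒜.tot g = 𝟙 _ ∧ 𝒜.tot g ≫ 𝒜.tot f = 𝟙 _ := by
  obtain ⟨r, hr, hr'⟩ := HomD.exists_inverse_of_bijective _ hf
  obtain ⟨k, hk, -⟩ := Unipotent.exists_inverse (𝒜.comp f (𝒜.strict r) (add_zero 0)) (by
    rw [𝒜.fst_comp, 𝒜.fst_strict]; exact HomD.ext hr)
  obtain ⟨k', -, hk'⟩ := Unipotent.exists_inverse (𝒜.comp (𝒜.strict r) f (add_zero 0)) (by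
    rw [𝒜.fst_comp, 𝒜.fst_strict]; exact HomD.ext hr')
  have h1 := congrArg 𝒜.tot hk
  have h2 := congrArg 𝒜.tot hk'
  simp only [tot_comp, tot_strict, st_id] at h1 h2
  have h3 : 𝒜.st r ≫ 𝒜.tot k = 𝒜.tot k' ≫ 𝒜.st r := by
    rw [← Category.id_comp (𝒜.st r ≫ 𝒜.tot k), ← h2]
    simp only [Category.assoc] at h1 ⊢
    rw [h1, Category.comp_id]
  refine ⟨𝒜.comp (𝒜.strict r) k (add_zero 0), ?_, ?_⟩
  · rw [tot_comp, tot_strict, ← Category.assoc, h1]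
  · rw [tot_comp, tot_strict, h3, Category.assoc, h2]

namespace Tw

variable {X E Y W : 𝒜.Tw}

/-- A splitting of a conflation in `𝒜`. -/
structure Splitting (f : X ⟶ E) (g : E ⟶ Y) where
  r : 𝒜.Hom E.obj X.obj 0
  s : 𝒜.Hom Y.obj E.obj 0
  f_r : 𝒜.tot f.hom ≫ 𝒜.tot r = 𝟙 _
  s_g : 𝒜.tot s ≫ 𝒜.tot g.hom = 𝟙 _
  total : 𝒜.tot r ≫ 𝒜.tot f.hom + 𝒜.tot g.hom ≫ 𝒜.tot s = 𝟙 _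

lemma IsConflation.splitting [IsSemisimpleRing S] [Unipotent 𝒜] {f : X ⟶ E} {g : E ⟶ Y}
    (h : IsConflation f g) : Nonempty (Splitting f g) := by
  obtain ⟨r, hr⟩ := HomD.exists_retraction_of_injective (𝒜.fst f.hom) h.injective
  obtain ⟨k, hk, -⟩ := Unipotent.exists_inverse (𝒜.comp f.hom (𝒜.strict r) (add_zero 0)) (by
    rw [𝒜.fst_comp, 𝒜.fst_strict]; exact HomD.ext hr)
  have hk0 : ∀ x, (𝒜.fst k).1 x = x := by
    intro x
    have := congrArg (fun φ => (𝒜.fst φ).1 x) hk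
    simp only [𝒜.fst_comp, 𝒜.fst_strict, HomD.comp_apply, hr, HomD.id_apply] at this
    exact this
  have hk1 := congrArg 𝒜.tot hk
  simp only [tot_comp, tot_strict, st_id, Category.assoc] at hk1
  have hfg := congrArg (fun φ => 𝒜.tot (Mor.hom φ)) h.comp_eq_zero
  simp only [tot_comp_hom, zero_hom, tot_zero] at hfg
  let φ : 𝒜.Hom E.obj (X.obj.prod Y.obj) 0 :=
    𝒜.comp (𝒜.comp (𝒜.strict r) k (add_zero 0)) (𝒜.strict (HomD.inl X.obj Y.obj)) (add_zero 0) +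
      𝒜.comp g.hom (𝒜.strict (HomD.inr X.obj Y.obj)) (add_zero 0)
  have hφ0 : ∀ x, (𝒜.fst φ).1 x = (r.1 x, (𝒜.fst g.hom).1 x) := by
    intro x
    simp only [φ, map_add, 𝒜.fst_comp, 𝒜.fst_strict]
    refine Prod.ext ?_ ?_
    · refine (add_zero _).trans ?_
      exact hk0 (r.1 x)
    · exact zero_add _
  obtain ⟨ψ, h1, h2⟩ := exists_inverse φ (by
    constructor
    · rw [← LinearMap.ker_eq_bot, LinearMap.ker_eq_bot']
      intro x hx
      rw [hφ0] at hx
      obtain ⟨y, rfl⟩ := (h.exact x).1 (congrArg Prod.snd hx)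
      have h3 := congrArg Prod.fst hx
      rw [hr] at h3
      change y = 0 at h3
      rw [h3, map_zero]
    · rintro ⟨a, b⟩
      obtain ⟨y, hy⟩ := h.surjective b
      refine ⟨y + (𝒜.fst f.hom).1 (a - r.1 y), ?_⟩
      rw [hφ0, map_add, map_add, hr, hy, add_sub_cancel, (h.exact _).2 ⟨_, rfl⟩, add_zero])
  have hφ : 𝒜.tot φ = 𝒜.st r ≫ 𝒜.tot k ≫ 𝒜.st (HomD.inl X.obj Y.obj) +
      𝒜.tot g.hom ≫ 𝒜.st (HomD.inr X.obj Y.obj) := by simp [φ]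
  have hφg : 𝒜.tot φ ≫ 𝒜.st (HomD.snd X.obj Y.obj) = 𝒜.tot g.hom := by
    rw [hφ]; simp [Preadditive.add_comp]
  have hφr : 𝒜.tot φ ≫ 𝒜.st (HomD.fst X.obj Y.obj) = 𝒜.st r ≫ 𝒜.tot k := by
    rw [hφ]; simp [Preadditive.add_comp]
  have hfφ : 𝒜.tot f.hom ≫ 𝒜.tot φ = 𝒜.st (HomD.inl X.obj Y.obj) := by
    have e1 : 𝒜.tot f.hom ≫ 𝒜.st r ≫ 𝒜.tot k ≫ 𝒜.st (HomD.inl X.obj Y.obj) =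
        𝒜.st (HomD.inl X.obj Y.obj) := by
      rw [← Category.assoc (𝒜.st r), ← Category.assoc, hk1, Category.id_comp]
    rw [hφ, Preadditive.comp_add, e1, ← Category.assoc, hfg, Limits.zero_comp, add_zero]
  have hf : 𝒜.tot f.hom = 𝒜.st (HomD.inl X.obj Y.obj) ≫ 𝒜.tot ψ := by
    rw [← hfφ, Category.assoc, h1, Category.comp_id]
  refine ⟨⟨𝒜.comp (𝒜.strict r) k (add_zero 0),
    𝒜.comp (𝒜.strict (HomD.inr X.obj Y.obj)) ψ (add_zero 0), ?_, ?_, ?_⟩⟩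
  · simpa using hk1
  · rw [← hφg, tot_comp, tot_strict, Category.assoc, ← Category.assoc (𝒜.tot ψ), h2,
      Category.id_comp, st_inr_snd]
  · rw [tot_comp, tot_strict, ← hφr, hf, ← hφg, tot_comp, tot_strict, Category.assoc,
      Category.assoc, ← Preadditive.comp_add, ← Category.assoc (𝒜.st (HomD.fst _ _)),
      ← Category.assoc (𝒜.st (HomD.snd _ _)), ← Preadditive.add_comp, st_prod, Category.id_comp,
      h1]

namespace Splitting

variable {f : X ⟶ E} {g : E ⟶ Y}

lemma hom_ext (σ : Splitting f g) {a b : Y ⟶ W} (h : g ≫ a = g ≫ b) : a = b := by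
  apply tot_ext
  have := congrArg (fun φ => 𝒜.tot (Mor.hom φ)) h
  simp only [tot_comp_hom] at this
  rw [← Category.id_comp (𝒜.tot a.hom), ← σ.s_g, Category.assoc, this, ← Category.assoc, σ.s_g,
    Category.id_comp]

lemma exists_desc (σ : Splitting f g) (φ : E ⟶ W) (h : f ≫ φ = 0) : ∃ c : Y ⟶ W, g ≫ c = φ := by
  have h1 := congrArg (fun φ => 𝒜.tot (Mor.hom φ)) h
  simp only [tot_comp_hom, zero_hom, tot_zero] at h1
  have h2 : 𝒜.tot g.hom ≫ 𝒜.tot σ.s ≫ 𝒜.tot φ.hom = 𝒜.tot φ.hom := by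
    rw [← Category.assoc, ← sub_eq_of_eq_add' σ.total.symm, Preadditive.sub_comp, Category.assoc,
      h1, Limits.comp_zero, sub_zero, Category.id_comp]
  refine ⟨⟨𝒜.comp σ.s φ.hom (add_zero 0), ?_⟩, tot_ext (by
    rw [tot_comp_hom]; simpa using h2)⟩
  rw [mem_homs_iff]
  have h3 : 𝒜.tot g.hom ≫ 𝒜.dtot (𝒜.comp σ.s φ.hom (add_zero 0)) =
      𝒜.tot g.hom ≫ (𝒜.tot Y.u ≫ 𝒜.tot (𝒜.comp σ.s φ.hom (add_zero 0)) -
        𝒜.tot (𝒜.comp σ.s φ.hom (add_zero 0)) ≫ 𝒜.tot W.u) := by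
    have h4 := 𝒜.dtot_comp g.hom (𝒜.comp σ.s φ.hom (add_zero 0)) (add_zero 0)
    rw [show 𝒜.comp g.hom (𝒜.comp σ.s φ.hom (add_zero 0)) (add_zero 0) = φ.hom from
      𝒜.tot_injective (by simpa using h2), dtot_hom, dtot_hom] at h4
    simp only [sgn_zero, one_smul, Preadditive.sub_comp, tot_comp, Category.assoc, h2] at h4
    rw [Preadditive.comp_sub, tot_comp]
    simp only [Category.assoc]
    rw [← Category.assoc (𝒜.tot g.hom) (𝒜.tot σ.s), ← Category.assoc _ _ (𝒜.tot W.u),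
      Category.assoc (𝒜.tot g.hom), h2, ← sub_eq_zero, ← sub_eq_zero.2 h4.symm]
    abel
  rw [← Category.id_comp (𝒜.dtot _), ← σ.s_g, Category.assoc, h3, ← Category.assoc, σ.s_g,
    Category.id_comp]

lemma exists_extension (σ : Splitting f g) (φ : X ⟶ J W) : ∃ e : E ⟶ J W, f ≫ e = φ := by
  refine ⟨toJ (𝒜.comp σ.r (pr (Y := W.shift 1) (sigInv_mc W) φ) (add_zero 0)), J_hom_ext ?_⟩
  rw [pr_comp, pr_toJ]
  apply 𝒜.tot_injective
  rw [tot_comp, tot_comp, ← Category.assoc, σ.f_r, Category.id_comp]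

end Splitting

end Tw

end DGMod

end AInfty

namespace AInfty

namespace DGMod

open GRMod

namespace Tw

variable {S : Type u} [Ring S] {𝒜 : DGMod.{w, v, u} S} {X X' E E' Y Y' Z W : 𝒜.Tw}

/-- The morphism to a direct sum with components `a` and `b`. -/
def sumLift (a : W ⟶ X) (b : W ⟶ Y) : W ⟶ sum X Y :=
  lift _ a.hom b (by rw [dtot_hom, tot_zero, Limits.comp_zero, sub_zero])

lemma sumLift_fst (a : W ⟶ X) (b : W ⟶ Y) : sumLift a b ≫ sumFst X Y = a :=
  tot_ext (by simp [sumLift, sumFst, Preadditive.add_comp])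

lemma sumLift_snd (a : W ⟶ X) (b : W ⟶ Y) : sumLift a b ≫ sumSnd X Y = b := lift_snd _ _ _ _

lemma sumLift_desc (a : W ⟶ X) (b : W ⟶ Y) (c : X ⟶ Z) (d : Y ⟶ Z) :
    sumLift a b ≫ (sumFst X Y ≫ c + sumSnd X Y ≫ d) = a ≫ c + b ≫ d := by
  rw [Preadditive.comp_add, ← Category.assoc, ← Category.assoc, sumLift_fst, sumLift_snd]

lemma cmp_sumLift (a : W ⟶ X) (b : W ⟶ Y) (x : W.obj) :
    cmp (sumLift a b) x = (cmp a x, cmp b x) := cmp_lift _ _ _ _ _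

lemma ext_hom_ext {t : 𝒜.Hom Y.obj X.obj 1}
    (ht : 𝒜.dtot t + 𝒜.tot t ≫ 𝒜.tot X.u + 𝒜.tot Y.u ≫ 𝒜.tot t = 0) {a b : W ⟶ ext X Y t ht}
    (h₁ : pr ht a = pr ht b) (h₂ : a ≫ snd X Y t ht = b ≫ snd X Y t ht) : a = b := by
  apply tot_ext
  have h₁' := congrArg 𝒜.tot h₁
  have h₂' := congrArg (fun f => 𝒜.tot (Mor.hom f)) h₂
  simp only [tot_pr, tot_comp_hom, tot_snd] at h₁' h₂'
  rw [← Category.comp_id (𝒜.tot a.hom), ← Category.comp_id (𝒜.tot b.hom), ← st_prod,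
    Preadditive.comp_add, Preadditive.comp_add]
  simp only [← Category.assoc, h₁', h₂']

lemma pr_lift {t : 𝒜.Hom Y.obj X.obj 1}
    (ht : 𝒜.dtot t + 𝒜.tot t ≫ 𝒜.tot X.u + 𝒜.tot Y.u ≫ 𝒜.tot t = 0)
    (a : 𝒜.Hom W.obj X.obj 0) (b : W ⟶ Y) (h) : pr ht (lift ht a b h) = a :=
  𝒜.tot_injective (by rw [tot_pr, tot_lift]; simp [Preadditive.add_comp])

section Cone

variable (f : X ⟶ Y)

lemma cone_mc : 𝒜.dtot (𝒜.comp (𝒜.strict (HomD.sigInv X.obj 1)) f.hom (add_zero 1)) +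
    𝒜.tot (𝒜.comp (𝒜.strict (HomD.sigInv X.obj 1)) f.hom (add_zero 1)) ≫ 𝒜.tot Y.u +
    𝒜.tot (X.shift 1).u ≫
      𝒜.tot (𝒜.comp (𝒜.strict (HomD.sigInv X.obj 1)) f.hom (add_zero 1)) = 0 := by
  simp [dtot_hom, Preadditive.comp_sub]

/-- The cone of a morphism. -/
@[reducible] def cone : 𝒜.Tw :=
  ext Y (X.shift 1) (𝒜.comp (𝒜.strict (HomD.sigInv X.obj 1)) f.hom (add_zero 1)) (cone_mc f)

/-- The inclusion in the cone. -/
def coneIn : Y ⟶ cone f :=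
  inl Y (X.shift 1) (𝒜.comp (𝒜.strict (HomD.sigInv X.obj 1)) f.hom (add_zero 1)) (cone_mc f)

/-- The projection from the cone. -/
def coneOut : cone f ⟶ X⟦(1 : ℤ)⟧ :=
  snd Y (X.shift 1) (𝒜.comp (𝒜.strict (HomD.sigInv X.obj 1)) f.hom (add_zero 1)) (cone_mc f)

/-- The morphism `J X → cone f` induced by `f`. -/
def coneMap : J X ⟶ cone f :=
  lift (Y := X.shift 1) (cone_mc f)
    (𝒜.comp (𝒜.strict (HomD.fst X.obj (X.obj.shift 1))) f.hom (add_zero 0))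
    ⟨𝒜.strict (HomD.snd X.obj (X.obj.shift 1)), (β X).mem⟩ (by
      rw [tot_J_u]
      simp [Preadditive.add_comp, Preadditive.sub_comp, Preadditive.comp_sub, dtot_hom]
      abel)

@[simp] lemma cmp_coneIn (y : Y.obj) : cmp (coneIn f) y = (y, 0) := cmp_inl _ _

lemma coneIn_coneOut : coneIn f ≫ coneOut f = 0 :=
  tot_ext ((tot_comp_hom _ _).trans ((𝒜.st_inl_snd Y.obj (X.obj.shift 1)).trans 𝒜.tot_zero.symm))

lemma α_coneMap : α X ≫ coneMap f = f ≫ coneIn f := by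
  refine tot_ext ?_
  rw [tot_comp_hom, tot_comp_hom, coneMap, tot_lift]
  simp only [tot_α, Preadditive.comp_add, coneIn, tot_inl]
  simp

lemma coneMap_coneOut : coneMap f ≫ coneOut f = β X := by
  refine tot_ext ?_
  rw [tot_comp_hom, coneMap, tot_lift, tot_β]
  change (_ + _) ≫ 𝒜.st (HomD.snd Y.obj (X.obj.shift 1)) = _
  simp [Preadditive.add_comp]

lemma cmp_coneMap (x : (J X).obj) : cmp (coneMap f) x = (cmp f x.1, x.2) := by
  refine (cmp_lift (Y := X.shift 1) (cone_mc f) _ _ _ _).trans (Prod.ext ?_ (cmp_β x))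
  rw [𝒜.fst_comp, 𝒜.fst_strict]
  rfl

/-- The mapping cone triangle is canonical, up to contractible summands. -/
lemma isCanonical_cone : IsCanonical (sumLift f (α X))
    (sumFst Y (J X) ≫ coneIn f - sumSnd Y (J X) ≫ coneMap f) (-coneOut f) := by
  refine ⟨?_, sumSnd Y (J X), sumLift_snd _ _, ?_⟩
  · have hc (z : (sum Y (J X)).obj) :
        cmp (sumFst Y (J X) ≫ coneIn f - sumSnd Y (J X) ≫ coneMap f) z =
          ((z.1, 0) - (cmp f z.2.1, z.2.2) : Y.obj × X.obj) := by
      rw [cmp_sub, cmp_comp, cmp_comp, cmp_sumFst, cmp_sumSnd, cmp_coneIn, cmp_coneMap]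
    rw [isConflation_iff]
    refine ⟨?_, fun x y h => ?_, fun z => ⟨fun h => ⟨z.2.1, ?_⟩, ?_⟩, fun z => ?_⟩
    · rw [Preadditive.comp_sub, ← Category.assoc, ← Category.assoc, sumLift_fst, sumLift_snd,
        α_coneMap, sub_self]
    · rw [cmp_sumLift, cmp_sumLift, cmp_α, cmp_α] at h
      exact congrArg (fun p => p.2.1) h
    · have h' := sub_eq_zero.1 ((hc z).symm.trans h)
      rw [cmp_sumLift, cmp_α]
      refine Prod.ext (congrArg Prod.fst h').symm (?_ : ((z.2.1, 0) : X.obj × X.obj) = z.2)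
      have h'' : (0 : X.obj) = z.2.2 := congrArg Prod.snd h'
      exact Prod.ext rfl h''
    · rintro ⟨x, rfl⟩
      refine (hc _).trans ?_
      rw [cmp_sumLift, cmp_α]
      exact sub_self _
    · refine ⟨(z.1, (0, -z.2)), (hc _).trans ?_⟩
      refine Prod.ext ?_ ?_
      · exact (congrArg (z.1 - ·) (map_zero (cmp f))).trans (sub_zero _)
      · exact (zero_sub _).trans (neg_neg _)
  · rw [Preadditive.comp_neg, Preadditive.sub_comp, Category.assoc, Category.assoc, coneIn_coneOut,
      coneMap_coneOut, Limits.comp_zero, zero_sub, neg_neg]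

end Cone

lemma isCanonical_id (X : 𝒜.Tw) : IsCanonical (𝟙 X) (0 : X ⟶ Ho.zero 𝒜) 0 := by
  refine ⟨?_, α X, Category.id_comp _, ?_⟩
  · rw [isConflation_iff]
    refine ⟨Limits.comp_zero, fun x y h => ?_, fun z => ⟨fun _ => ⟨z, ?_⟩, ?_⟩, fun z => ⟨0, ?_⟩⟩
    · rwa [cmp_id, cmp_id] at h
    · rw [cmp_id]
    · rintro ⟨x, rfl⟩
      rw [cmp_zero]
    · exact Subsingleton.elim (α := PUnit) _ _
  · rw [Limits.comp_zero]
    exact inl_snd (sigInv_mc X)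

namespace IsCanonical

variable {f : X ⟶ E} {g : E ⟶ Y} {h : Y ⟶ X⟦(1 : ℤ)⟧} {f' : X' ⟶ E'} {g' : E' ⟶ Y'}
  {h' : Y' ⟶ X'⟦(1 : ℤ)⟧}

lemma comp_eq_zero (H : IsCanonical f g h) : f ≫ g = 0 := H.conflation.comp_eq_zero

variable [IsSemisimpleRing S] [Unipotent 𝒜]

lemma hom_ext (H : IsCanonical f g h) {a b : Y ⟶ W} (e : g ≫ a = g ≫ b) : a = b :=
  H.conflation.splitting.some.hom_ext e

lemma exists_desc (H : IsCanonical f g h) (φ : E ⟶ W) (e : f ≫ φ = 0) : ∃ c : Y ⟶ W, g ≫ c = φ :=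
  H.conflation.splitting.some.exists_desc φ e

lemma exists_extension (H : IsCanonical f g h) (φ : X ⟶ J W) : ∃ e : E ⟶ J W, f ≫ e = φ :=
  H.conflation.splitting.some.exists_extension φ

/-- The rotation of a canonical triangle is canonical, up to contractible summands. -/
lemma rotate (H : IsCanonical f g h) : ∃ e : E ⟶ J X, IsCanonical (sumLift g e)
    (sumFst Y (J X) ≫ h - sumSnd Y (J X) ≫ β X) (-f⟦(1 : ℤ)⟧') := by
  obtain ⟨e, h1, h2⟩ := H.exists_lift
  obtain ⟨w, hw⟩ := H.exists_desc (α E - e ≫ Jmap f) (by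
    rw [Preadditive.comp_sub, ← Category.assoc, h1, α_Jmap, sub_self])
  have hwβ : w ≫ β E = -(h ≫ f⟦(1 : ℤ)⟧') := by
    apply H.hom_ext
    have h4 : α E ≫ β E = 0 := inl_snd (sigInv_mc E)
    rw [← Category.assoc, hw, Preadditive.sub_comp, h4, zero_sub, Category.assoc, Jmap_β,
      Preadditive.comp_neg, ← Category.assoc, h2, Category.assoc]
  refine ⟨e, ?_, sumFst Y (J X) ≫ w + sumSnd Y (J X) ≫ Jmap f, ?_, ?_⟩
  · have hzero := (isConflation_iff f g).1 H.conflation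
    obtain ⟨-, -, hex, hsurj⟩ := hzero
    have he (x : X.obj) : cmp e (cmp f x) = (x, 0) := by rw [← cmp_comp, h1, cmp_α]
    have hc : sumLift g e ≫ (sumFst Y (J X) ≫ h - sumSnd Y (J X) ≫ β X) = 0 := by
      rw [Preadditive.comp_sub, ← Category.assoc, ← Category.assoc, sumLift_fst, sumLift_snd, h2,
        sub_self]
    rw [isConflation_iff]
    refine ⟨hc, ?_, fun z => ⟨fun h => ?_, ?_⟩, fun z => ?_⟩
    · rw [← LinearMap.ker_eq_bot, LinearMap.ker_eq_bot']
      intro x hx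
      rw [cmp_sumLift] at hx
      obtain ⟨z, rfl⟩ := (hex x).1 (congrArg Prod.fst hx)
      have := congrArg (fun p => p.2.1) hx
      simp only [he] at this
      rw [show z = 0 from this, map_zero]
    · rw [cmp_sub, cmp_comp, cmp_comp, cmp_sumFst, cmp_sumSnd, sub_eq_zero] at h
      obtain ⟨x, hx⟩ := hsurj z.1
      have h5 : (cmp e x).2 = z.2.2 := by
        rw [← cmp_β, ← cmp_β, ← cmp_comp, h2, cmp_comp, hx, h]
      refine ⟨x - cmp f ((cmp e x).1 - z.2.1), ?_⟩
      rw [cmp_sumLift, map_sub (cmp g), map_sub (cmp e), he, ← cmp_comp, H.comp_eq_zero, cmp_zero, sub_zero, hx]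
      exact Prod.ext rfl (Prod.ext (sub_sub_cancel _ _) ((sub_zero _).trans h5))
    · rintro ⟨x, rfl⟩
      rw [← cmp_comp, hc, cmp_zero]
    · refine ⟨(0, (0, -z)), ?_⟩
      rw [cmp_sub, cmp_comp, cmp_comp, cmp_sumFst, cmp_sumSnd, map_zero, cmp_β, zero_sub]
      exact neg_neg z
  · rw [sumLift_desc, hw, sub_add_cancel]
  · rw [Preadditive.add_comp, Category.assoc, Category.assoc, hwβ, Jmap_β, Preadditive.comp_neg,
      Preadditive.comp_neg, Preadditive.sub_comp, Category.assoc, Category.assoc]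
    abel

lemma exists_hom (H : IsCanonical f g h) (H' : IsCanonical f' g' h') (a : X ⟶ X') (b : E ⟶ E')
    (e : (toHo 𝒜).map (f ≫ b) = (toHo 𝒜).map (a ≫ f')) : ∃ c : Y ⟶ Y',
      (toHo 𝒜).map (g ≫ c) = (toHo 𝒜).map (b ≫ g') ∧
      (toHo 𝒜).map (h ≫ a⟦(1 : ℤ)⟧') = (toHo 𝒜).map (c ≫ h') := by
  obtain ⟨k, hk⟩ := (map_eq_iff _ _).1 e
  obtain ⟨j, hj⟩ := H.exists_extension (α X)
  obtain ⟨e₁, h1, h2⟩ := H.exists_lift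
  obtain ⟨e₂, h1', h2'⟩ := H'.exists_lift
  have hb : f ≫ (b - e₁ ≫ k) = a ≫ f' := by
    rw [Preadditive.comp_sub, ← Category.assoc f, h1, ← hk]; abel
  obtain ⟨c, hc⟩ := H.exists_desc ((b - e₁ ≫ k) ≫ g') (by
    rw [← Category.assoc, hb, Category.assoc, H'.comp_eq_zero, Limits.comp_zero])
  obtain ⟨w, hw⟩ := H.exists_desc (e₁ ≫ Jmap a - (b - e₁ ≫ k) ≫ e₂) (by
    rw [Preadditive.comp_sub, ← Category.assoc, ← Category.assoc, h1, hb, α_Jmap, Category.assoc,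
      h1', sub_self])
  refine ⟨c, ?_, ?_⟩
  · rw [hc, Preadditive.sub_comp, Functor.map_sub, sub_eq_self, Category.assoc, Functor.map_comp,
      map_to_J, Limits.zero_comp]
  · have h3 : h ≫ a⟦(1 : ℤ)⟧' - c ≫ h' = w ≫ β X' := by
      apply H.hom_ext
      rw [Preadditive.comp_sub, ← Category.assoc, ← h2, Category.assoc, ← Jmap_β,
        ← Category.assoc g w, hw, Preadditive.sub_comp, Category.assoc, Category.assoc _ e₂, h2',
        ← Category.assoc g c, hc, Category.assoc]
    rw [← sub_eq_zero, ← Functor.map_sub, h3, Functor.map_comp, map_to_J, Limits.zero_comp]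

/-- The data of the octahedral axiom for canonical triangles. -/
lemma exists_octahedron {A B Z : 𝒜.Tw} {f : X ⟶ Y} {p : Y ⟶ A} {h : A ⟶ X⟦(1 : ℤ)⟧}
    {g : Y ⟶ Z} {q : Z ⟶ B} {l : B ⟶ Y⟦(1 : ℤ)⟧} (H : IsCanonical f p h) (H' : IsCanonical g q l) :
    ∃ (C : 𝒜.Tw) (r : Z ⟶ C) (m : C ⟶ X⟦(1 : ℤ)⟧) (m₁ : A ⟶ C) (m₃ : C ⟶ B),
      IsCanonical (f ≫ g) r m ∧ p ≫ m₁ = g ≫ r ∧ m₁ ≫ m = h ∧ r ≫ m₃ = q ∧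
      (toHo 𝒜).map (m ≫ f⟦(1 : ℤ)⟧') = (toHo 𝒜).map (m₃ ≫ l) ∧
      IsCanonical m₁ m₃ (l ≫ p⟦(1 : ℤ)⟧') := by
  obtain ⟨e₁, h1, h2⟩ := H.exists_lift
  obtain ⟨e₂, h1', h2'⟩ := H'.exists_lift
  obtain ⟨-, hfi, hfe, hfs⟩ := (isConflation_iff f p).1 H.conflation
  obtain ⟨-, hgi, hge, hgs⟩ := (isConflation_iff g q).1 H'.conflation
  let ll : 𝒜.Hom B.obj (Y.obj.shift 1) 0 := l.hom
  have hll : 𝒜.dtot ll = 𝒜.tot B.u ≫ 𝒜.tot ll - 𝒜.tot ll ≫ 𝒜.tot (Y.shift 1).u :=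
    dtot_hom (Y := Y.shift 1) l
  let ρ : 𝒜.Hom Z.obj Y.obj 0 := pr (Y := Y.shift 1) (sigInv_mc Y) e₂
  have hρ : 𝒜.dtot ρ = 𝒜.tot Z.u ≫ 𝒜.tot ρ - 𝒜.tot ρ ≫ 𝒜.tot Y.u -
      𝒜.tot q.hom ≫ 𝒜.tot ll ≫ 𝒜.st (HomD.sigInv Y.obj 1) := by
    refine (dtot_pr (Y := Y.shift 1) (sigInv_mc Y) e₂).trans ?_
    congr 1
    have h3 : 𝒜.tot (e₂ ≫ β Y).hom = 𝒜.tot q.hom ≫ 𝒜.tot ll := by rw [h2']; exact tot_comp_hom q l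
    exact (congrArg (· ≫ 𝒜.tot (𝒜.strict (HomD.sigInv Y.obj 1))) h3).trans (Category.assoc _ _ _)
  have hgρ : 𝒜.tot g.hom ≫ 𝒜.tot ρ = 𝟙 _ := by
    have h3 := congrArg (fun e => 𝒜.tot (pr (Y := Y.shift 1) (sigInv_mc Y) e)) h1'
    simp only [pr_comp, tot_comp, pr_α] at h3
    exact h3
  let t : 𝒜.Hom B.obj A.obj 1 := 𝒜.comp (𝒜.comp ll (𝒜.strict (HomD.sigInv Y.obj 1)) (zero_add 1))
    p.hom (add_zero 1)
  have ht : 𝒜.dtot t + 𝒜.tot t ≫ 𝒜.tot A.u + 𝒜.tot B.u ≫ 𝒜.tot t = 0 := by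
    simp [t, hll, dtot_hom, Preadditive.comp_sub]
    abel
  let r : Z ⟶ ext A B t ht := lift ht (𝒜.comp ρ p.hom (add_zero 0)) q (by
    simp [t, hρ, dtot_hom, Preadditive.comp_sub, Preadditive.sub_comp]
    abel)
  have hgr : g ≫ r = p ≫ inl A B t ht := ext_hom_ext ht
    (𝒜.tot_injective (by
      rw [tot_pr, tot_pr, tot_comp_hom, tot_comp_hom, Category.assoc, ← tot_pr, pr_lift, tot_comp,
        ← Category.assoc, hgρ]
      simp))
    (by
      rw [Category.assoc, Category.assoc, lift_snd, inl_snd, H'.comp_eq_zero, Limits.comp_zero])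
  obtain ⟨e, he⟩ := H'.exists_extension e₁
  have hcr (z : Z.obj) : cmp r z = ((cmp p) ((𝒜.fst ρ).1 z), cmp q z) := by
    refine (cmp_lift _ _ _ _ _).trans ?_
    rw [𝒜.fst_comp]
    rfl
  have hgρ' (y : Y.obj) : (𝒜.fst ρ).1 (cmp g y) = y := by
    have h3 : 𝒜.comp g.hom ρ (add_zero 0) = 𝒜.strict (HomD.id Y.obj) :=
      𝒜.tot_injective (by rw [tot_comp, hgρ]; rfl)
    have h4 := congrArg (fun φ => (𝒜.fst φ).1 y) h3
    simp only [𝒜.fst_comp, 𝒜.fst_strict] at h4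
    exact h4
  have hconf : IsConflation (f ≫ g) r := by
    rw [isConflation_iff]
    have h0 : (f ≫ g) ≫ r = 0 := by
      rw [Category.assoc, hgr, ← Category.assoc, H.comp_eq_zero, Limits.zero_comp]
    refine ⟨h0, fun x y hxy => ?_, fun z => ⟨fun hz => ?_, ?_⟩, fun z => ?_⟩
    · rw [cmp_comp, cmp_comp] at hxy
      exact hfi (hgi hxy)
    · rw [hcr] at hz
      obtain ⟨y, rfl⟩ := (hge z).1 (congrArg Prod.snd hz)
      rw [hgρ'] at hz
      obtain ⟨x, rfl⟩ := (hfe y).1 (congrArg Prod.fst hz)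
      exact ⟨x, cmp_comp _ _ _⟩
    · rintro ⟨x, rfl⟩
      rw [← cmp_comp, h0, cmp_zero]
    · obtain ⟨z₀, hz₀⟩ := hgs z.2
      obtain ⟨y, hy⟩ := hfs (z.1 - cmp p ((𝒜.fst ρ).1 z₀))
      refine ⟨z₀ + cmp g y, ?_⟩
      rw [hcr, map_add, map_add, map_add, hgρ', hy, hz₀, ← cmp_comp, H'.comp_eq_zero, cmp_zero,
        add_zero, add_sub_cancel]
  obtain ⟨m, hm⟩ := hconf.splitting.some.exists_desc (e ≫ β X) (by
    rw [Category.assoc, ← Category.assoc g, he, ← Category.assoc, h1]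
    exact inl_snd (sigInv_mc X))
  have hC : IsCanonical (f ≫ g) r m := ⟨hconf, e, by rw [Category.assoc, he, h1], hm.symm⟩
  obtain ⟨w, hw⟩ := hC.exists_desc (e ≫ Jmap f - e₂) (by
    rw [Preadditive.comp_sub, Category.assoc, Category.assoc, ← Category.assoc g, he,
      ← Category.assoc, h1, h1', α_Jmap, sub_self])
  refine ⟨ext A B t ht, r, m, inl A B t ht, snd A B t ht, hC, hgr.symm, H.hom_ext ?_,
    lift_snd _ _ _ _, ?_, isConflation_ext ht,
    toJ (𝒜.strict (HomD.fst A.obj B.obj)), J_hom_ext ?_, tot_ext ?_⟩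
  · rw [← Category.assoc, ← hgr, Category.assoc, hm, ← Category.assoc, he, h2]
  · have h3 : m ≫ f⟦(1 : ℤ)⟧' - snd A B t ht ≫ l = w ≫ β Y := by
      apply hC.hom_ext
      rw [Preadditive.comp_sub, ← Category.assoc, hm, ← Category.assoc r, lift_snd, Category.assoc,
        ← Jmap_β, ← Category.assoc r, hw, Preadditive.sub_comp, h2', Category.assoc]
    rw [← sub_eq_zero, ← Functor.map_sub, h3, Functor.map_comp, map_to_J, Limits.zero_comp]
  · rw [pr_comp, pr_toJ, pr_α]
    exact 𝒜.tot_injective (by simp)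
  · rw [tot_comp_β, pr_toJ, tot_ext_u]
    rw [tot_comp_hom, tot_comp_hom]
    refine Eq.trans ?_ (congrArg (fun z => 𝒜.st (HomD.snd A.obj B.obj) ≫ 𝒜.tot ll ≫ z)
      (tot_shift_hom p 1)).symm
    simp [t, Preadditive.add_comp]
    rfl

end IsCanonical

end Tw

end DGMod

end AInfty

namespace AInfty

namespace DGMod

open GRMod Pretriangulated

variable {S : Type u} [Ring S] {𝒜 : DGMod.{w, v, u} S}

namespace Tw

variable {X Y Z W E : 𝒜.Tw}

lemma shiftFunctorAdd'_hom_app_hom (X : 𝒜.Tw) (n m p : ℤ) (h : n + m = p) :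
    ((shiftFunctorAdd' 𝒜.Tw n m p h).hom.app X).hom = 𝒜.strict (HomD.shiftAdd X.obj n m p h) := by
  subst h
  rw [shiftFunctorAdd'_eq_shiftFunctorAdd]
  rfl

lemma shiftFunctorComm_hom_app_hom (X : 𝒜.Tw) (n : ℤ) :
    ((shiftFunctorComm 𝒜.Tw 1 n).hom.app X).hom = 𝒜.strict (HomD.shiftSwap X.obj 1 n) := by
  refine Eq.trans ?_ (𝒜.strict_comp (HomD.shiftAddInv X.obj 1 n (1 + n) rfl)
    (HomD.shiftAdd X.obj n 1 (1 + n) (add_comm _ _)) (add_zero 0)).symm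
  exact congrArg (fun z => 𝒜.comp (𝒜.strict (HomD.shiftAddInv X.obj 1 n (1 + n) rfl)) z (add_zero 0))
    (shiftFunctorAdd'_hom_app_hom X n 1 (1 + n) (add_comm _ _))

lemma cmp_shift (f : X ⟶ Y) (n : ℤ) (x : X.obj) : cmp (f⟦n⟧') x = cmp f x := by
  have h : 𝒜.fst (𝒜.shiftHom f.hom n) =
      ((HomD.sigInv X.obj n).comp (𝒜.fst f.hom) rfl).comp (HomD.sig Y.obj n) (by omega) := by
    rw [shiftHom, conj, 𝒜.fst_comp, 𝒜.fst_comp, 𝒜.fst_strict, 𝒜.fst_strict]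
  exact congrArg (fun φ => φ.1 x) h

/-- The shift of a canonical triangle is canonical. -/
lemma IsCanonical.shift {f : X ⟶ E} {g : E ⟶ Y} {h : Y ⟶ X⟦(1 : ℤ)⟧} (H : IsCanonical f g h)
    (n : ℤ) : IsCanonical (f⟦n⟧') (g⟦n⟧')
      (sgn n • (h⟦n⟧' ≫ (shiftFunctorComm 𝒜.Tw 1 n).hom.app X)) := by
  obtain ⟨hz, hi, he, hs⟩ := (isConflation_iff f g).1 H.conflation
  obtain ⟨e, h1, h2⟩ := H.exists_lift
  let a : 𝒜.Hom E.obj X.obj 0 := pr (Y := X.shift 1) (sigInv_mc X) e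
  have ha : 𝒜.tot E.u ≫ 𝒜.tot a - 𝒜.tot a ≫ 𝒜.tot X.u - 𝒜.dtot a =
      𝒜.tot (g ≫ h).hom ≫ 𝒜.st (HomD.sigInv X.obj 1) := by
    rw [← h2]
    refine Eq.trans ?_ (congrArg (· ≫ 𝒜.st (HomD.sigInv X.obj 1)) (tot_comp_β e)).symm
    rw [Category.assoc, st_sig_sigInv, Category.comp_id]
  refine ⟨(isConflation_iff _ _).2 ⟨?_, fun x y hxy => ?_, fun y => ?_, fun y => ?_⟩,
    toJ (X := X.shift n) (W := E.shift n) (𝒜.shiftHom a n), ?_, ?_⟩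
  · rw [← Functor.map_comp, hz, Functor.map_zero]
  · exact hi ((cmp_shift f n x).symm.trans (hxy.trans (cmp_shift f n y)))
  · exact (Iff.of_eq (congrArg (· = 0) (cmp_shift g n y))).trans <| (he y).trans ⟨fun ⟨x, hx⟩ => ⟨x, (cmp_shift f n x).trans hx⟩,
      fun ⟨x, hx⟩ => ⟨x, (cmp_shift f n x).symm.trans hx⟩⟩
  · obtain ⟨x, hx⟩ := hs y
    exact ⟨x, (cmp_shift g n x).trans hx⟩
  · refine J_hom_ext (X := X.shift n) ?_
    refine (pr_comp (W := X.shift n) (f⟦n⟧') _).trans ?_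
    refine (congrArg (fun z => 𝒜.comp (𝒜.shiftHom f.hom n) z (add_zero 0))
      (pr_toJ (X := X.shift n) (W := E.shift n) _)).trans
      (Eq.trans ?_ (pr_α (X := X.shift n)).symm)
    refine (𝒜.shiftHom_comp f.hom a n (add_zero 0)).trans ?_
    have h3 : 𝒜.comp f.hom a (add_zero 0) = 𝒜.strict (HomD.id X.obj) := by
      rw [← pr_comp, h1, pr_α]
    rw [h3, 𝒜.shiftHom_id]
  · refine tot_ext ((tot_comp_β (X := X.shift n) (W := E.shift n) _).trans ?_)
    have h3 : g⟦n⟧' ≫ (sgn n • (h⟦n⟧' ≫ (shiftFunctorComm 𝒜.Tw 1 n).hom.app X)) =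
        sgn n • ((g ≫ h)⟦n⟧' ≫ (shiftFunctorComm 𝒜.Tw 1 n).hom.app X) := by
      rw [Preadditive.comp_zsmul, Functor.map_comp, Category.assoc]
    have h4 : 𝒜.tot ((g ≫ h)⟦n⟧' ≫ (shiftFunctorComm 𝒜.Tw 1 n).hom.app X).hom =
        (𝒜.st (HomD.sigInv E.obj n) ≫ 𝒜.tot (g ≫ h).hom ≫
          𝒜.st (HomD.sig (X.obj.shift 1) n)) ≫ 𝒜.st (HomD.shiftSwap X.obj 1 n) :=
      (tot_comp_hom _ _).trans (congrArg₂ (· ≫ ·) (tot_shift_hom (g ≫ h) n)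
        (congrArg 𝒜.tot (shiftFunctorComm_hom_app_hom X n)))
    have h5 : 𝒜.tot (sgn n • ((g ≫ h)⟦n⟧' ≫ (shiftFunctorComm 𝒜.Tw 1 n).hom.app X)).hom =
        sgn n • 𝒜.tot ((g ≫ h)⟦n⟧' ≫ (shiftFunctorComm 𝒜.Tw 1 n).hom.app X).hom :=
      𝒜.tot_zsmul _ _
    have h6 : 𝒜.st (HomD.sigInv X.obj 1) ≫ 𝒜.st (HomD.sig X.obj n) ≫
        𝒜.st (HomD.sig (X.obj.shift n) 1) =
        𝒜.st (HomD.sig (X.obj.shift 1) n) ≫ 𝒜.st (HomD.shiftSwap X.obj 1 n) := by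
      rw [𝒜.st_comp _ _ rfl, 𝒜.st_comp _ _ rfl, 𝒜.st_comp _ _ rfl]
      exact 𝒜.st_congr _ _ (by omega) fun _ => rfl
    refine Eq.trans ?_ (congrArg (fun z => 𝒜.tot (Mor.hom z)) h3).symm
    refine Eq.trans ?_ (h5.trans (congrArg (sgn n • ·) h4)).symm
    refine (congrArg (fun z => (𝒜.tot (E.shift n).u ≫ 𝒜.tot z - 𝒜.tot z ≫ 𝒜.tot (X.shift n).u -
      𝒜.dtot z) ≫ 𝒜.st (HomD.sig (X.obj.shift n) 1))
      (pr_toJ (X := X.shift n) (W := E.shift n) (𝒜.shiftHom a n))).trans ?_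
    rw [tot_shift_u, tot_shift_u, tot_shiftHom, dtot_shiftHom, Category.assoc, Category.assoc]
    refine Eq.trans ?_ (congrArg (sgn n • ·) ((Category.assoc _ _ _).trans
      (congrArg (𝒜.st (HomD.sigInv E.obj n) ≫ ·) (Category.assoc _ _ _))).symm)
    refine Eq.trans ?_ (congrArg (fun z => sgn n • (𝒜.st (HomD.sigInv E.obj n) ≫ z))
      ((congrArg (· ≫ 𝒜.st (HomD.sig X.obj n) ≫ 𝒜.st (HomD.sig (X.obj.shift n) 1)) ha).trans
        ((Category.assoc _ _ _).trans (congrArg (𝒜.tot (g ≫ h).hom ≫ ·) h6))))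
    simp [Preadditive.sub_comp, Preadditive.comp_sub, smul_sub]

/-- A twisted object is homotopy equivalent to its sum with a contractible object. -/
noncomputable def sumJIso (X Y : 𝒜.Tw) : (toHo 𝒜).obj (sum X (J Y)) ≅ (toHo 𝒜).obj X where
  hom := (toHo 𝒜).map (sumFst X (J Y))
  inv := (toHo 𝒜).map (sumInl X (J Y))
  hom_inv_id := by
    rw [← Functor.map_comp, ← CategoryTheory.Functor.map_id, ← sum_total X (J Y), Functor.map_add,
      Functor.map_comp _ (sumSnd X (J Y)), map_to_J, Limits.zero_comp, add_zero]
  inv_hom_id := by rw [← Functor.map_comp, sumInl_fst, CategoryTheory.Functor.map_id]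

end Tw

lemma mem_triangles_of_iso {t t' : Triangle 𝒜.Ho} (h : t ∈ 𝒜.triangles) (e : t' ≅ t) :
    t' ∈ 𝒜.triangles := by
  obtain ⟨X, E, Y, f, g, h, H, ⟨i⟩⟩ := h
  exact ⟨X, E, Y, f, g, h, H, ⟨e ≪≫ i⟩⟩

lemma Tw.IsCanonical.mem_triangles {X E Y : 𝒜.Tw} {f : X ⟶ E} {g : E ⟶ Y} {h : Y ⟶ X⟦(1 : ℤ)⟧}
    (H : IsCanonical f g h) : (toHo 𝒜).mapTriangle.obj (Triangle.mk f g h) ∈ 𝒜.triangles :=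
  ⟨X, E, Y, f, g, h, H, ⟨Iso.refl _⟩⟩

lemma contractibleTriangle_mem_triangles (X : 𝒜.Ho) : contractibleTriangle X ∈ 𝒜.triangles := by
  refine mem_triangles_of_iso (Tw.isCanonical_id X.as).mem_triangles
    (Triangle.isoMk _ _ (Iso.refl _) (Iso.refl _)
      (Limits.IsZero.iso (Limits.isZero_zero 𝒜.Ho) Ho.isZero_zero) ?_ ?_ ?_)
  · refine (Category.comp_id _).trans ?_
    exact ((Category.id_comp _).trans ((toHo 𝒜).map_id X.as)).symm
  · exact Ho.isZero_zero.eq_of_tgt _ _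
  · exact (Limits.isZero_zero 𝒜.Ho).eq_of_src _ _

/-- Triangles which are canonical up to a contractible summand of the middle term. -/
lemma mem_triangles_of_sum {X Y W Z : 𝒜.Tw} {f : X ⟶ Tw.sum Y (Tw.J W)} {g : Tw.sum Y (Tw.J W) ⟶ Z}
    {h : Z ⟶ X⟦(1 : ℤ)⟧} (H : Tw.IsCanonical f g h) :
    (toHo 𝒜).mapTriangle.obj (Triangle.mk (f ≫ Tw.sumFst Y (Tw.J W)) (Tw.sumInl Y (Tw.J W) ≫ g) h) ∈
      𝒜.triangles := by
  refine mem_triangles_of_iso H.mem_triangles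
    (Triangle.isoMk _ _ (Iso.refl _) (Tw.sumJIso Y W).symm (Iso.refl _) ?_ ?_ ?_)
  · refine Eq.trans ?_ (Category.id_comp _).symm
    change (toHo 𝒜).map (f ≫ Tw.sumFst Y (Tw.J W)) ≫ (Tw.sumJIso Y W).inv = (toHo 𝒜).map f
    rw [Functor.map_comp, Category.assoc]
    exact (congrArg ((toHo 𝒜).map f ≫ ·) (Tw.sumJIso Y W).hom_inv_id).trans (Category.comp_id _)
  · change (toHo 𝒜).map (Tw.sumInl Y (Tw.J W) ≫ g) ≫ 𝟙 _ = (Tw.sumJIso Y W).inv ≫ (toHo 𝒜).map g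
    rw [Category.comp_id]
    exact (toHo 𝒜).map_comp _ _
  · refine (congrArg (_ ≫ ·) (CategoryTheory.Functor.map_id _ _)).trans ?_
    exact (Category.comp_id _).trans (Category.id_comp _).symm

lemma exists_triangle {X Y : 𝒜.Ho} (f : X ⟶ Y) : ∃ (Z : 𝒜.Ho) (g : Y ⟶ Z) (h : Z ⟶ X⟦(1 : ℤ)⟧),
    Triangle.mk f g h ∈ 𝒜.triangles := by
  obtain ⟨X⟩ := X
  obtain ⟨Y⟩ := Y
  obtain ⟨f, rfl⟩ := (toHo 𝒜).map_surjective (X := X) (Y := Y) f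
  have := mem_triangles_of_sum (Tw.isCanonical_cone f)
  rw [Tw.sumLift_fst] at this
  exact ⟨_, _, _, this⟩

lemma rotate_mem_triangles [IsSemisimpleRing S] [Unipotent 𝒜] {t : Triangle 𝒜.Ho}
    (ht : t ∈ 𝒜.triangles) : t.rotate ∈ 𝒜.triangles := by
  obtain ⟨X, E, Y, f, g, h, H, ⟨i⟩⟩ := ht
  obtain ⟨e, He⟩ := H.rotate
  have := mem_triangles_of_sum He
  rw [Tw.sumLift_fst] at this
  have h1 : Tw.sumInl Y (Tw.J X) ≫ (Tw.sumFst Y (Tw.J X) ≫ h - Tw.sumSnd Y (Tw.J X) ≫ Tw.β X) =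
      h := by
    rw [Preadditive.comp_sub, ← Category.assoc, ← Category.assoc, Tw.sumInl_fst, Tw.sumInl_snd,
      Category.id_comp, Limits.zero_comp, sub_zero]
  rw [h1] at this
  exact mem_triangles_of_iso this
    ((rotate 𝒜.Ho).mapIso i ≪≫ (toHo 𝒜).mapTriangleRotateIso.app (Triangle.mk f g h))

lemma shift_mem_triangles {t : Triangle 𝒜.Ho} (ht : t ∈ 𝒜.triangles) (n : ℤ) :
    (Triangle.shiftFunctor 𝒜.Ho n).obj t ∈ 𝒜.triangles := by
  obtain ⟨X, E, Y, f, g, h, H, ⟨i⟩⟩ := ht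
  have e1 : (Triangle.shiftFunctor 𝒜.Tw n).obj (Triangle.mk f g h) ≅ Triangle.mk (f⟦n⟧') (g⟦n⟧')
      (sgn n • (h⟦n⟧' ≫ (shiftFunctorComm 𝒜.Tw 1 n).hom.app X)) := by
    refine Triangle.isoMk _ _ (Iso.refl _) (n.negOnePow • Iso.refl _) (Iso.refl _) ?_ ?_ ?_
    · change (n.negOnePow • f⟦n⟧') ≫ (n.negOnePow • 𝟙 _) = 𝟙 _ ≫ f⟦n⟧'
      simp [smul_smul]
    · change (n.negOnePow • g⟦n⟧') ≫ 𝟙 _ = (n.negOnePow • 𝟙 _) ≫ g⟦n⟧'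
      simp
    · change (n.negOnePow • (h⟦n⟧' ≫ (shiftFunctorComm 𝒜.Tw 1 n).hom.app X)) ≫ (𝟙 _)⟦(1 : ℤ)⟧' =
        𝟙 _ ≫ (sgn n • (h⟦n⟧' ≫ (shiftFunctorComm 𝒜.Tw 1 n).hom.app X))
      rw [CategoryTheory.Functor.map_id, Category.id_comp]
      exact Category.comp_id _
  exact mem_triangles_of_iso (H.shift n).mem_triangles
    ((Triangle.shiftFunctor 𝒜.Ho n).mapIso i ≪≫
      ((toHo 𝒜).mapTriangleCommShiftIso n).symm.app (Triangle.mk f g h) ≪≫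
      (toHo 𝒜).mapTriangle.mapIso e1)

lemma mem_triangles_of_rotate [IsSemisimpleRing S] [Unipotent 𝒜] {t : Triangle 𝒜.Ho}
    (ht : t.rotate ∈ 𝒜.triangles) : t ∈ 𝒜.triangles := by
  have h1 : (Triangle.shiftFunctor 𝒜.Ho 1).obj t ∈ 𝒜.triangles :=
    mem_triangles_of_iso (rotate_mem_triangles (rotate_mem_triangles ht))
      ((rotateRotateRotateIso 𝒜.Ho).symm.app t)
  exact mem_triangles_of_iso (shift_mem_triangles h1 (-1))
    (((Triangle.shiftFunctorZero 𝒜.Ho).symm.app t) ≪≫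
      (Triangle.shiftFunctorAdd' 𝒜.Ho 1 (-1) 0 (by norm_num)).app t)

lemma Tw.IsCanonical.exists_triangle_hom [IsSemisimpleRing S] [Unipotent 𝒜] {X E Y X' E' Y' : 𝒜.Tw}
    {f : X ⟶ E} {g : E ⟶ Y} {h : Y ⟶ X⟦(1 : ℤ)⟧} {f' : X' ⟶ E'} {g' : E' ⟶ Y'}
    {h' : Y' ⟶ X'⟦(1 : ℤ)⟧} (H : IsCanonical f g h) (H' : IsCanonical f' g' h')
    (a : (toHo 𝒜).obj X ⟶ (toHo 𝒜).obj X') (b : (toHo 𝒜).obj E ⟶ (toHo 𝒜).obj E')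
    (e : (toHo 𝒜).map f ≫ b = a ≫ (toHo 𝒜).map f') : ∃ c : (toHo 𝒜).obj Y ⟶ (toHo 𝒜).obj Y',
      (toHo 𝒜).map g ≫ c = b ≫ (toHo 𝒜).map g' ∧
      ((toHo 𝒜).map h ≫ ((toHo 𝒜).commShiftIso (1 : ℤ)).hom.app X) ≫ a⟦(1 : ℤ)⟧' =
        c ≫ (toHo 𝒜).map h' ≫ ((toHo 𝒜).commShiftIso (1 : ℤ)).hom.app X' := by
  obtain ⟨a, rfl⟩ := (toHo 𝒜).map_surjective a
  obtain ⟨b, rfl⟩ := (toHo 𝒜).map_surjective b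
  rw [← Functor.map_comp, ← Functor.map_comp] at e
  obtain ⟨c, hc, hc'⟩ := H.exists_hom H' a b e
  rw [Functor.map_comp, Functor.map_comp] at hc hc'
  refine ⟨(toHo 𝒜).map c, hc, ?_⟩
  rw [Category.assoc, ← Category.assoc _ ((toHo 𝒜).map h'), ← hc', Category.assoc]
  exact congrArg ((toHo 𝒜).map h ≫ ·) ((toHo 𝒜).commShiftIso_hom_naturality a 1).symm

lemma exists_triangle_hom_of_iso {C : Type*} [Category* C] [HasShift C ℤ] {t t' s s' : Triangle C}
    (i : t ≅ s) (i' : t' ≅ s') (a : t.obj₁ ⟶ t'.obj₁) (b : t.obj₂ ⟶ t'.obj₂)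
    (e : t.mor₁ ≫ b = a ≫ t'.mor₁) (H : ∀ (a : s.obj₁ ⟶ s'.obj₁) (b : s.obj₂ ⟶ s'.obj₂),
      s.mor₁ ≫ b = a ≫ s'.mor₁ → ∃ c : s.obj₃ ⟶ s'.obj₃,
        s.mor₂ ≫ c = b ≫ s'.mor₂ ∧ s.mor₃ ≫ a⟦(1 : ℤ)⟧' = c ≫ s'.mor₃) :
    ∃ c : t.obj₃ ⟶ t'.obj₃, t.mor₂ ≫ c = b ≫ t'.mor₂ ∧ t.mor₃ ≫ a⟦(1 : ℤ)⟧' = c ≫ t'.mor₃ := by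
  obtain ⟨c, hc, hc'⟩ := H (i.inv.hom₁ ≫ a ≫ i'.hom.hom₁) (i.inv.hom₂ ≫ b ≫ i'.hom.hom₂) (by
    rw [← Category.assoc, i.inv.comm₁, Category.assoc, ← Category.assoc t.mor₁, e, Category.assoc,
      i'.hom.comm₁]
    simp only [Category.assoc])
  refine ⟨i.hom.hom₃ ≫ c ≫ i'.inv.hom₃, ?_, ?_⟩
  · rw [← Category.assoc, i.hom.comm₂, Category.assoc, ← Category.assoc s.mor₂, hc]
    simp only [Category.assoc]
    rw [i'.inv.comm₂]
    simp
  · rw [Category.assoc, Category.assoc, ← i'.inv.comm₃, ← Category.assoc c, ← hc']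
    simp only [Functor.map_comp, Category.assoc]
    rw [← Category.assoc i.hom.hom₃, ← i.hom.comm₃]
    simp only [Category.assoc, ← Functor.map_comp]
    simp

lemma exists_triangle_hom [IsSemisimpleRing S] [Unipotent 𝒜] (t t' : Triangle 𝒜.Ho)
    (ht : t ∈ 𝒜.triangles) (ht' : t' ∈ 𝒜.triangles) (a : t.obj₁ ⟶ t'.obj₁) (b : t.obj₂ ⟶ t'.obj₂)
    (e : t.mor₁ ≫ b = a ≫ t'.mor₁) : ∃ c : t.obj₃ ⟶ t'.obj₃,
      t.mor₂ ≫ c = b ≫ t'.mor₂ ∧ t.mor₃ ≫ a⟦(1 : ℤ)⟧' = c ≫ t'.mor₃ := by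
  obtain ⟨X, E, Y, f, g, h, H, ⟨i⟩⟩ := ht
  obtain ⟨X', E', Y', f', g', h', H', ⟨i'⟩⟩ := ht'
  exact exists_triangle_hom_of_iso i i' a b e fun a b e => H.exists_triangle_hom H' a b e

/-- The homotopy category is pretriangulated. -/
@[reducible] noncomputable def pretriangulated (𝒜 : DGMod.{w, v, u} S) [IsSemisimpleRing S] [Unipotent 𝒜] :
    Pretriangulated 𝒜.Ho where
  distinguishedTriangles := 𝒜.triangles
  isomorphic_distinguished _ h _ e := mem_triangles_of_iso h e
  contractible_distinguished := contractibleTriangle_mem_triangles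
  distinguished_cocone_triangle := exists_triangle
  rotate_distinguished_triangle _ := ⟨rotate_mem_triangles, mem_triangles_of_rotate⟩
  complete_distinguished_triangle_morphism := exists_triangle_hom

/-- The connecting morphism in the homotopy category of a triangle of twisted objects. -/
noncomputable abbrev connecting {X Y : 𝒜.Tw} (h : Y ⟶ X⟦(1 : ℤ)⟧) :
    (toHo 𝒜).obj Y ⟶ ((toHo 𝒜).obj X)⟦(1 : ℤ)⟧ :=
  (toHo 𝒜).map h ≫ ((toHo 𝒜).commShiftIso (1 : ℤ)).hom.app X

lemma Tw.IsCanonical.mk_mem_triangles {X E Y : 𝒜.Tw} {f : X ⟶ E} {g : E ⟶ Y}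
    {h : Y ⟶ X⟦(1 : ℤ)⟧} (H : IsCanonical f g h) :
    Triangle.mk ((toHo 𝒜).map f) ((toHo 𝒜).map g) (connecting h) ∈ 𝒜.triangles :=
  H.mem_triangles

lemma connecting_comp {X Y Z : 𝒜.Tw} (h : Y ⟶ X⟦(1 : ℤ)⟧) (f : X ⟶ Z) :
    connecting h ≫ ((toHo 𝒜).map f)⟦(1 : ℤ)⟧' = connecting (h ≫ f⟦(1 : ℤ)⟧') := by
  unfold connecting
  rw [Category.assoc, Functor.map_comp, Category.assoc]
  exact congrArg ((toHo 𝒜).map h ≫ ·) ((toHo 𝒜).commShiftIso_hom_naturality f 1).symm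

lemma comp_connecting {X Y Z : 𝒜.Tw} (f : Z ⟶ Y) (h : Y ⟶ X⟦(1 : ℤ)⟧) :
    (toHo 𝒜).map f ≫ connecting h = connecting (f ≫ h) := by
  unfold connecting
  rw [← Category.assoc, Functor.map_comp]

lemma Tw.IsCanonical.octahedron [IsSemisimpleRing S] [Unipotent 𝒜] {X Y Z A B : 𝒜.Tw}
    {f : X ⟶ Y} {p : Y ⟶ A} {h : A ⟶ X⟦(1 : ℤ)⟧} {g : Y ⟶ Z} {q : Z ⟶ B} {l : B ⟶ Y⟦(1 : ℤ)⟧}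
    (H : IsCanonical f p h) (H' : IsCanonical g q l) :
    letI := 𝒜.pretriangulated
    ∃ (C : 𝒜.Tw) (r : Z ⟶ C) (m : C ⟶ X⟦(1 : ℤ)⟧) (H'' : Triangle.mk
      ((toHo 𝒜).map f ≫ (toHo 𝒜).map g) ((toHo 𝒜).map r) (connecting m) ∈ distTriang 𝒜.Ho),
      Nonempty (Triangulated.Octahedron rfl H.mk_mem_triangles H'.mk_mem_triangles H'') := by
  let _ := 𝒜.pretriangulated
  obtain ⟨C, r, m, m₁, m₃, H'', e₁, e₂, e₃, e₄, H₀⟩ := H.exists_octahedron H'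
  have K := H''.mk_mem_triangles
  rw [Functor.map_comp] at K
  refine ⟨C, r, m, K, ⟨⟨(toHo 𝒜).map m₁, (toHo 𝒜).map m₃, ?_, ?_, ?_, ?_, ?_⟩⟩⟩
  · rw [← Functor.map_comp, e₁, Functor.map_comp]
  · rw [comp_connecting, e₂]
  · rw [← Functor.map_comp, e₃]
  · rw [comp_connecting, connecting_comp, connecting, e₄]
  · have := H₀.mk_mem_triangles
    rw [← connecting_comp] at this
    exact this

/-- The homotopy category is triangulated. -/
lemma isTriangulated (𝒜 : DGMod.{w, v, u} S) [IsSemisimpleRing S] [Unipotent 𝒜] :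
    letI := 𝒜.pretriangulated
    IsTriangulated 𝒜.Ho := by
  let _ := 𝒜.pretriangulated
  refine IsTriangulated.mk' fun X Y Z a b => ?_
  obtain ⟨X⟩ := X
  obtain ⟨Y⟩ := Y
  obtain ⟨Z⟩ := Z
  obtain ⟨a, rfl⟩ := (toHo 𝒜).map_surjective (X := X) (Y := Y) a
  obtain ⟨b, rfl⟩ := (toHo 𝒜).map_surjective (X := Y) (Y := Z) b
  have H := Tw.isCanonical_cone a
  have H' := Tw.isCanonical_cone (Tw.sumFst Y (Tw.J X) ≫ b)
  obtain ⟨C, r, m, H'', h⟩ := H.octahedron H'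
  refine ⟨_, _, _, _, _, _, _, _, Iso.refl _, (Tw.sumJIso Y X).symm, (Tw.sumJIso Z _).symm, ?_, ?_,
    _, _, H.mk_mem_triangles, _, _, H'.mk_mem_triangles, _, _, H'', h⟩
  · have e : (toHo 𝒜).map a = (toHo 𝒜).map (Tw.sumLift a (Tw.α X)) ≫ (Tw.sumJIso Y X).hom := by
      refine Eq.trans ?_ ((toHo 𝒜).map_comp _ _)
      rw [Tw.sumLift_fst]
    rw [Iso.refl_hom, Category.id_comp, Iso.symm_hom, Iso.comp_inv_eq, e]
  · have e : (Tw.sumJIso Y X).hom ≫ (toHo 𝒜).map b = (toHo 𝒜).map (Tw.sumLift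
        (Tw.sumFst Y (Tw.J X) ≫ b) (Tw.α (Tw.sum Y (Tw.J X)))) ≫ (Tw.sumJIso Z _).hom := by
      refine Eq.trans ((toHo 𝒜).map_comp _ _).symm (Eq.trans ?_ ((toHo 𝒜).map_comp _ _))
      rw [Tw.sumLift_fst]
    rw [Iso.symm_hom, Iso.symm_hom, Iso.comp_inv_eq, Category.assoc, ← e, Iso.inv_hom_id_assoc]

end DGMod

end AInfty

namespace AInfty

namespace AInfAlg

open DGMod GRMod BalTensor

section

variable {k : Type w} [Field k] {S : Type u} [Ring S] [Algebra k S] {A : AInfAlg k S}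
variable {M N L : GRMod.{v} S}

lemma comp_congr {d e n : ℤ} {f f' : A.GHom M N d} {g : A.GHom N L e} (h : d + e = n) {p : ℕ}
    (H : ∀ q ≤ p, f.1 q = f'.1 q) : (comp f g h).1 p = (comp f' g h).1 p := by
  refine tmul_ext fun m w => ?_
  rw [comp_tmul, comp_tmul]
  refine Finset.sum_congr rfl fun q hq => ?_
  rw [H q.1 (by rw [Finset.HasAntidiagonal.mem_antidiagonal] at hq; omega)]

lemma comp_vanish {d e n : ℤ} {f : A.GHom M N d} {g : A.GHom N L e} (h : d + e = n) {j p : ℕ}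
    (hf : ∀ q < j, f.1 q = 0) (hg : g.1 0 = 0) (hp : p < j + 1) : (comp f g h).1 p = 0 := by
  refine tmul_ext fun m w => ?_
  rw [comp_tmul]
  refine Finset.sum_eq_zero fun q hq => ?_
  rw [Finset.HasAntidiagonal.mem_antidiagonal] at hq
  by_cases hq' : q.1 < j
  · have e : tmap (curry (f.1 q.1) m) (BiHom.id S (TP S A.carrier q.2)) = 0 := by
      refine tmul_ext fun x y => ?_
      change tmul S (f.1 q.1 (tmul S m x)) y = 0
      rw [hf _ hq', LinearMap.zero_apply, zero_tmul]
    rw [e, LinearMap.zero_apply, map_zero, smul_zero]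
  · have e : q.2 = 0 := by omega
    have e' : g.1 q.2 = 0 := by rw [e, hg]
    rw [e', LinearMap.zero_apply, smul_zero]

lemma component_zero_eq {d : ℤ} {f g : A.GHom M N d} (h : fst f = fst g) : f.1 0 = g.1 0 := by
  refine tmul_ext fun m w => ?_
  have e : ∀ f : A.GHom M N d, f.1 0 (tmul S m w) =
      (fst f).1 (MulOpposite.op (TP.unnil A.carrier w) • m) := fun f => by
    change _ = f.1 0 (tmul S _ (TP.nil A.carrier 1))
    rw [smul_tmul, ← (TP.nil A.carrier).map_lsmul, smul_eq_mul, mul_one]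
    rfl
  rw [e, e, h]

/-- The powers of an endomorphism of degree `0`. -/
noncomputable def pow (n : A.GHom M M 0) : ℕ → A.GHom M M 0
  | 0 => strict (HomD.id M)
  | j + 1 => comp (pow n j) n (add_zero 0)

lemma pow_vanish {n : A.GHom M M 0} (hn : n.1 0 = 0) (j : ℕ) : ∀ q < j, (pow n j).1 q = 0 := by
  induction j with
  | zero => simp
  | succ j ih => exact fun q hq => comp_vanish (add_zero 0) ih hn hq

/-- The partial sums of the geometric series. -/
noncomputable def geom (n : A.GHom M M 0) (j : ℕ) : A.GHom M M 0 := ∑ i ∈ Finset.range j, pow n i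

lemma geom_succ (n : A.GHom M M 0) (j : ℕ) : geom n (j + 1) = geom n j + pow n j :=
  Finset.sum_range_succ _ _

lemma geom_stable {n : A.GHom M M 0} (hn : n.1 0 = 0) {q j : ℕ} (h : q < j) :
    (geom n j).1 q = (geom n (q + 1)).1 q := by
  induction j, h using Nat.le_induction with
  | base => rfl
  | succ j hj ih =>
    rw [geom_succ, AddSubgroup.coe_add, Pi.add_apply, ih, pow_vanish hn j q hj, add_zero]

lemma comp_geom (n : A.GHom M M 0) (j : ℕ) :
    comp (geom n j) (strict (HomD.id M) - n) (add_zero 0) = strict (HomD.id M) - pow n j := by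
  have hs : ∀ a : A.GHom M M 0,
      comp a (strict (HomD.id M) - n) (add_zero 0) = a - comp a n (add_zero 0) := fun a => by
    have h1 := (A.GMod : DGMod.{max u v, v, u} S).comp_add a (strict (HomD.id M)) (-n) (add_zero 0)
    have h3 := (A.GMod : DGMod.{max u v, v, u} S).comp_neg a n (add_zero 0)
    have h2 := (A.GMod : DGMod.{max u v, v, u} S).comp_id a (add_zero 0)
    rw [sub_eq_add_neg, sub_eq_add_neg]
    exact h1.trans (congrArg₂ (· + ·) h2 h3)
  induction j with
  | zero =>
    have h1 := (A.GMod : DGMod.{max u v, v, u} S).zero_comp (M := M)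
      (strict (HomD.id M) - n) (add_zero 0)
    exact h1.trans (sub_self _).symm
  | succ j ih =>
    rw [geom_succ]
    refine ((A.GMod : DGMod.{max u v, v, u} S).add_comp (geom n j) (pow n j)
      (strict (HomD.id M) - n) (add_zero 0)).trans ?_
    refine (congrArg₂ (· + ·) ih (hs (pow n j))).trans ?_
    exact sub_add_sub_cancel _ _ _

/-- A morphism of degree `0` whose first component is the identity has a left inverse. -/
lemma exists_left_inverse (f : A.GHom M M 0) (hf : fst f = HomD.id M) :
    ∃ g : A.GHom M M 0, comp g f (add_zero 0) = strict (HomD.id M) := by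
  obtain ⟨n, rfl⟩ : ∃ n, f = strict (HomD.id M) - n := ⟨strict (HomD.id M) - f, by abel⟩
  have hn : n.1 0 = 0 := by
    refine component_zero_eq (g := 0) ?_
    rw [map_sub, show fst (strict (HomD.id M)) = HomD.id M from
      (A.GMod : DGMod.{max u v, v, u} S).fst_strict (HomD.id M), sub_eq_self] at hf
    rw [hf, map_zero]
  refine ⟨⟨fun p => (geom n (p + 1)).1 p, fun p => (geom n (p + 1)).2 p⟩, Subtype.ext (funext fun p => ?_)⟩
  rw [comp_congr (f' := geom n (p + 1)) (add_zero 0) fun q hq =>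
    (geom_stable hn (Nat.lt_succ_of_le hq)).symm, comp_geom, AddSubgroup.coe_sub, Pi.sub_apply,
    pow_vanish hn _ p p.lt_succ_self, sub_zero]

instance (A : AInfAlg k S) : Unipotent (A.GMod : DGMod.{max u v, v, u} S) where
  exists_inverse {M} f hf := by
    obtain ⟨g, hg⟩ := exists_left_inverse (A := A) f hf
    have hg' : fst g = HomD.id M := by
      have h1 := congrArg fst hg
      have h2 : fst (strict (A := A) (HomD.id M)) = HomD.id M :=
        (A.GMod : DGMod.{max u v, v, u} S).fst_strict (HomD.id M)
      have h3 : fst (comp g f (add_zero 0)) = (fst g).comp (HomD.id M) (add_zero 0) :=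
        ((A.GMod : DGMod.{max u v, v, u} S).fst_comp g f (add_zero 0)).trans (by
          exact congrArg (fun a => (fst g).comp a (add_zero 0)) hf)
      exact h3.symm.trans (h1.trans h2)
    obtain ⟨h, hh⟩ := exists_left_inverse g hg'
    refine ⟨g, ?_, hg⟩
    have e : h = f := by
      have h1 := (A.GMod : DGMod.{max u v, v, u} S).assoc h g f (add_zero 0) (add_zero 0)
        (add_zero 0) (add_zero 0)
      have h2 : comp (comp h g (add_zero 0)) f (add_zero 0) = f := by
        rw [hh]; exact (A.GMod : DGMod.{max u v, v, u} S).id_comp f (add_zero 0)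
      have h3 : comp h (comp g f (add_zero 0)) (add_zero 0) = h := by
        rw [hg]; exact (A.GMod : DGMod.{max u v, v, u} S).comp_id h (add_zero 0)
      exact h3.symm.trans (h1.symm.trans h2)
    rw [← e]
    exact hh

lemma hat_surjective {d : ℤ} : Function.Surjective (hat (A := A) (M := M) (N := N) (d := d)) := by
  intro g
  refine ⟨⟨fun p => g.1 ∘ₗ tmap LinearMap.id (T.ι p) ∘ₗ suspM A M p, fun p => ?_⟩,
    hat_ext fun m p w => ?_⟩
  · refine homog_tensor fun i m hm j w hw => ?_
    have hw' : T.ι p (susp A.grd p w) ∈ (T.grd (A.grd.shift 1)).gr (j - p) :=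
      T.ι_mem ((mem_shift_iff A.grd p _ _).2 (by
        rw [sub_add_cancel]
        exact susp_mem A.grd p hw))
    have hm' : M.grd.par p m ∈ (M.shift 1).grd.gr (i - 1) := by
      change _ ∈ M.grd.gr _
      rw [sub_add_cancel]
      exact M.grd.par_mem p hm
    have h1 := g.2 _ _ (Grd.tmul_mem hm' hw' rfl)
    change _ ∈ N.grd.gr _ at h1
    have e : i - 1 + (j - p) + d + 1 = i + j + (d - p) := by ring
    rw [e] at h1
    exact h1
  · rw [hat_ι]
    exact congrArg (fun z => g.1 (tmap LinearMap.id (T.ι p) z)) (suspM_suspM (M := M) p (tmul S m w))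

end

end AInfAlg

end AInfty

namespace AInfty

namespace DGMod

open GRMod Pretriangulated Tw

variable {S : Type u} [Ring S] {𝒜 ℬ : DGMod.{w, v, u} S}

namespace DGFun

/-- Differential graded functors that are bijective on morphisms and preserve first components. -/
class FullyFaithful (F : DGFun 𝒜 ℬ) : Prop where
  bijective (M N : GRMod.{v} S) (d : ℤ) :
    Function.Bijective (F.map : 𝒜.Hom M N d → ℬ.Hom (M.shift 1) (N.shift 1) d)
  fst_map {M N : GRMod.{v} S} {d : ℤ} (f : 𝒜.Hom M N d) (x : M) :
    (ℬ.fst (F.map f)).1 x = (𝒜.fst f).1 x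

variable (F : DGFun 𝒜 ℬ)

section

variable [FullyFaithful F]

lemma map_injective {M N : GRMod.{v} S} {d : ℤ} {f g : 𝒜.Hom M N d} (h : F.map f = F.map g) :
    f = g := (FullyFaithful.bijective (F := F) M N d).1 h

lemma exists_map_eq {M N : GRMod.{v} S} {d : ℤ} (g : ℬ.Hom (M.shift 1) (N.shift 1) d) :
    ∃ f : 𝒜.Hom M N d, F.map f = g := (FullyFaithful.bijective (F := F) M N d).2 g

lemma unipotent (F : DGFun 𝒜 ℬ) [FullyFaithful F] [Unipotent 𝒜] : Unipotent ℬ where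
  exists_inverse {M} f hf := by
    let i : HomD M ((M.shift (-1)).shift 1) 0 :=
      (HomD.shiftZeroInv M).comp (HomD.shiftAdd M (-1) 1 0 rfl) (add_zero 0)
    let j : HomD ((M.shift (-1)).shift 1) M 0 :=
      (HomD.shiftAddInv M (-1) 1 0 rfl).comp (HomD.shiftZero M) (add_zero 0)
    have hij : ℬ.st i ≫ ℬ.st j = 𝟙 _ := ℬ.st_comp_eq_id i j rfl fun _ => rfl
    obtain ⟨f', hf'⟩ := F.exists_map_eq (ℬ.conj j i f (e := 0) (by omega))
    obtain ⟨g, h1, h2⟩ := Unipotent.exists_inverse f' (HomD.ext fun x => by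
      rw [← FullyFaithful.fst_map (F := F) f' x, hf', conj, ℬ.fst_comp, ℬ.fst_comp, ℬ.fst_strict,
        ℬ.fst_strict, hf]
      rfl)
    have h1' := congrArg (fun z => ℬ.tot (F.map z)) h1
    have h2' := congrArg (fun z => ℬ.tot (F.map z)) h2
    simp only [F.map_comp, hf', tot_comp, tot_conj, F.map_strict, tot_strict] at h1' h2'
    have hid : ℬ.st ((HomD.id (M.shift (-1))).shiftMap 1) = 𝟙 _ := rfl
    rw [hid] at h1' h2'
    refine ⟨ℬ.conj i j (F.map g) (by omega), ℬ.tot_injective ?_, ℬ.tot_injective ?_⟩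
    · rw [tot_comp, tot_conj, tot_strict, st_id]
      have := congrArg (fun z => ℬ.st i ≫ z ≫ ℬ.st j) h1'
      simp only [Category.assoc, Category.id_comp, hij] at this
      rw [← Category.assoc, hij, Category.id_comp] at this
      exact this
    · rw [tot_comp, tot_conj, tot_strict, st_id]
      have := congrArg (fun z => ℬ.st i ≫ z ≫ ℬ.st j) h2'
      simp only [Category.assoc, Category.id_comp, hij, Category.comp_id] at this
      simp only [Category.assoc]
      exact this

instance : F.tw.Full where
  map_surjective {X Y} f := by
    obtain ⟨g, hg⟩ := F.exists_map_eq f.hom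
    refine ⟨⟨g, ?_⟩, Tw.hom_ext hg⟩
    have h := f.mem
    rw [Tw.mem_homs] at h ⊢
    apply F.map_injective
    rw [map_sub, map_add, F.map_D, F.map_comp, F.map_comp, hg, map_zero]
    exact h

lemma homotopic_of_tw {X Y : 𝒜.Tw} {f g : X ⟶ Y}
    (h : Tw.homotopic ℬ (F.tw.map f) (F.tw.map g)) : Tw.homotopic 𝒜 f g := by
  obtain ⟨h, e⟩ := h
  obtain ⟨h, rfl⟩ := F.exists_map_eq h
  refine ⟨h, F.map_injective ?_⟩
  rw [map_sub, map_add, map_add, F.map_D, F.map_comp, F.map_comp]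
  exact e

instance : F.tw.EssSurj where
  mem_essImage Y := by
    let Y' : ℬ.Tw := (Y.shift (-1)).shift 1
    obtain ⟨u, hu⟩ := F.exists_map_eq (M := Y.obj.shift (-1)) (N := Y.obj.shift (-1)) Y'.u
    refine ⟨⟨Y.obj.shift (-1), u, ?_⟩, ⟨?_ ≪≫ (shiftAddIso Y (-1) 1).symm ≪≫
      eqToIso (congrArg Y.shift (neg_add_cancel 1)) ≪≫ shiftZeroIso Y⟩⟩
    · apply F.map_injective
      rw [map_add, F.map_D, F.map_comp, hu, map_zero]
      exact Y'.mc
    · refine eqToIso ?_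
      change Tw.mk _ _ _ = Y'
      congr 1

instance : F.ho.Full where
  map_surjective {X Y} f := by
    obtain ⟨f, rfl⟩ := (toHo ℬ).map_surjective (X := F.tw.obj X.as) (Y := F.tw.obj Y.as) f
    obtain ⟨f, rfl⟩ := F.tw.map_surjective f
    exact ⟨(toHo 𝒜).map f, rfl⟩

instance : F.ho.Faithful where
  map_injective {X Y} f g h := by
    obtain ⟨f, rfl⟩ := (toHo 𝒜).map_surjective f
    obtain ⟨g, rfl⟩ := (toHo 𝒜).map_surjective g
    refine CategoryTheory.Quotient.sound _ (F.homotopic_of_tw ?_)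
    exact (CategoryTheory.Quotient.functor_map_eq_iff (Tw.homotopic ℬ) _ _).1 h

instance : F.ho.EssSurj where
  mem_essImage Y :=
    ⟨(toHo 𝒜).obj (F.tw.objPreimage Y.as), ⟨(toHo ℬ).mapIso (F.tw.objObjPreimageIso Y.as)⟩⟩

instance : F.ho.IsEquivalence where

lemma isCanonical_map {X E Y : 𝒜.Tw} {f : X ⟶ E} {g : E ⟶ Y} {h : Y ⟶ X⟦(1 : ℤ)⟧}
    (H : IsCanonical f g h) :
    IsCanonical (F.tw.map f) (F.tw.map g) (F.tw.map h ≫ (F.tw.commShiftIso (1 : ℤ)).hom.app X) := by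
  obtain ⟨hz, hi, he, hs⟩ := (isConflation_iff f g).1 H.conflation
  obtain ⟨e, h1, h2⟩ := H.exists_lift
  have hc {X Y : 𝒜.Tw} (f : X ⟶ Y) (x : X.obj) : cmp (F.tw.map f) x = cmp f x :=
    FullyFaithful.fst_map (F := F) f.hom x
  let a : 𝒜.Hom E.obj X.obj 0 := pr (Y := X.shift 1) (sigInv_mc X) e
  have ha : 𝒜.comp E.u a (add_zero 1) - 𝒜.comp a X.u (zero_add 1) - 𝒜.D a (zero_add 1) =
      𝒜.comp (g ≫ h).hom (𝒜.strict (HomD.sigInv X.obj 1)) (zero_add 1) := by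
    apply 𝒜.tot_injective
    rw [← h2]
    refine Eq.trans ?_ ((𝒜.tot_comp _ _ _).trans
      (congrArg (· ≫ 𝒜.st (HomD.sigInv X.obj 1)) (tot_comp_β e))).symm
    rw [Category.assoc, st_sig_sigInv, Category.comp_id]
    simp [a]
  refine ⟨(isConflation_iff _ _).2 ⟨?_, fun x y hxy => ?_, fun y => ?_, fun y => ?_⟩,
    toJ (X := F.obj X) (W := F.obj E) (F.map a), ?_, ?_⟩
  · rw [← Functor.map_comp, hz, Functor.map_zero]
  · exact hi ((hc f x).symm.trans (hxy.trans (hc f y)))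
  · exact (Iff.of_eq (congrArg (· = 0) (hc g y))).trans <| (he y).trans
      ⟨fun ⟨x, hx⟩ => ⟨x, (hc f x).trans hx⟩, fun ⟨x, hx⟩ => ⟨x, (hc f x).symm.trans hx⟩⟩
  · obtain ⟨x, hx⟩ := hs y
    exact ⟨x, (hc g x).trans hx⟩
  · refine comp_toJ (X := F.obj X) (W := F.obj E) ?_
    refine (F.map_comp f.hom a (add_zero 0)).symm.trans ?_
    rw [← pr_comp, h1, pr_α, F.map_strict]
    rfl
  · have ha' := congrArg (fun z => ℬ.tot (F.map z)) ha
    replace ha' : ℬ.tot (F.map E.u) ≫ ℬ.tot (F.map a) - ℬ.tot (F.map a) ≫ ℬ.tot (F.map X.u) -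
        ℬ.dtot (F.map a) =
        ℬ.tot (F.map (g ≫ h).hom) ≫ ℬ.st ((HomD.sigInv X.obj 1).shiftMap 1) := by
      refine Eq.trans ?_ (ha'.trans ?_)
      · simp only [map_sub, F.map_comp, F.map_D, tot_sub, tot_comp, tot_D]
      · refine (congrArg ℬ.tot (F.map_comp _ _ _)).trans ((ℬ.tot_comp _ _ _).trans ?_)
        exact congrArg (fun z => ℬ.tot (F.map (g ≫ h).hom) ≫ ℬ.tot z) (F.map_strict _)
    refine tot_ext ((tot_comp_β (X := F.obj X) (W := F.obj E) _).trans ?_)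
    refine (congrArg (fun z => (ℬ.tot (F.obj E).u ≫ ℬ.tot z - ℬ.tot z ≫ ℬ.tot (F.obj X).u -
      ℬ.dtot z) ≫ ℬ.st (HomD.sig (X.obj.shift 1) 1))
      (pr_toJ (X := F.obj X) (W := F.obj E) (F.map a))).trans ?_
    refine (congrArg (· ≫ ℬ.st (HomD.sig (X.obj.shift 1) 1)) ha').trans ?_
    refine (Category.assoc _ _ _).trans ?_
    refine Eq.trans (b := ℬ.tot (F.map (g ≫ h).hom) ≫ ℬ.st (HomD.shiftSwap X.obj 1 1)) ?_ ?_
    · refine congrArg (ℬ.tot (F.map (g ≫ h).hom) ≫ ·) ?_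
      refine (ℬ.st_comp _ _ rfl).trans (ℬ.st_congr _ _ (by omega) fun _ => rfl)
    · have h3 : F.tw.map g ≫ F.tw.map h ≫ (F.tw.commShiftIso (1 : ℤ)).hom.app X =
          F.tw.map (g ≫ h) ≫ (F.tw.commShiftIso (1 : ℤ)).hom.app X := by
        rw [← Category.assoc, Functor.map_comp]
      refine Eq.trans ?_ (congrArg (fun z => ℬ.tot (Mor.hom z)) h3).symm
      exact (ℬ.tot_comp _ _ _).symm

lemma mapTriangle_mem_triangles {t : Triangle 𝒜.Ho} (ht : t ∈ 𝒜.triangles) :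
    F.ho.mapTriangle.obj t ∈ ℬ.triangles := by
  obtain ⟨X, E, Y, f, g, h, H, ⟨i⟩⟩ := ht
  have : NatTrans.CommShift (CategoryTheory.Quotient.lift.isLift (Tw.homotopic 𝒜) (F.tw ⋙ toHo ℬ)
    fun _ _ _ _ h => CategoryTheory.Quotient.sound _ (F.tw_homotopic h)).hom ℤ :=
      CategoryTheory.Quotient.liftCommShift_compatibility _ _ ℤ _
  exact mem_triangles_of_iso (F.isCanonical_map H).mem_triangles
    (F.ho.mapTriangle.mapIso i ≪≫
      ((Functor.mapTriangleCompIso (toHo 𝒜) F.ho).symm.app _) ≪≫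
      (Functor.mapTriangleIso (CategoryTheory.Quotient.lift.isLift (Tw.homotopic 𝒜) (F.tw ⋙ toHo ℬ)
        fun _ _ _ _ h => CategoryTheory.Quotient.sound _ (F.tw_homotopic h))).app _ ≪≫
      (Functor.mapTriangleCompIso F.tw (toHo ℬ)).app _)

lemma ho_isTriangulated [IsSemisimpleRing S] [Unipotent 𝒜] [Unipotent ℬ] :
    let _ := 𝒜.pretriangulated
    let _ := ℬ.pretriangulated
    F.ho.IsTriangulated :=
  let _ := 𝒜.pretriangulated
  let _ := ℬ.pretriangulated
  ⟨fun _ ht => F.mapTriangle_mem_triangles ht⟩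

end

end DGFun

end DGMod

namespace AInfAlg

open DGMod

variable {k : Type w} [Field k] {S : Type u} [Ring S] [Algebra k S]

instance (A : AInfAlg k S) : (hatFun.{w, v, u} A).FullyFaithful where
  bijective _ _ _ := ⟨fun _ _ h => hat_injective h, hat_surjective⟩
  fst_map := fst_hat

instance (A : AInfAlg k S) : Unipotent (A.bar.GMod : DGMod.{max u v, v, u} S) :=
  (hatFun.{w, v, u} A).unipotent

end AInfAlg

end AInfty

theorem mainTheorem10 {k : Type w} [Field k] {S : Type u} [Ring S] [Algebra k S]
    [FiniteDimensional k S] [IsSemisimpleRing S] [IsSemisimpleRing (S ⊗[k] Sᵐᵒᵖ)]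
    (A : AInfty.AInfAlg k S) :
    ∃ (P₁ : Pretriangulated (A.GMod : AInfty.DGMod.{max u v, v, u} S).Ho)
      (P₂ : Pretriangulated (A.bar.GMod : AInfty.DGMod.{max u v, v, u} S).Ho),
      P₁.distinguishedTriangles = A.GMod.triangles ∧
      P₂.distinguishedTriangles = A.bar.GMod.triangles ∧
      IsTriangulated (A.GMod : AInfty.DGMod.{max u v, v, u} S).Ho ∧
      IsTriangulated (A.bar.GMod : AInfty.DGMod.{max u v, v, u} S).Ho ∧
      (AInfty.AInfAlg.GHo.{w, v, u} A).IsTriangulated ∧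
      (AInfty.AInfAlg.GHo.{w, v, u} A).IsEquivalence :=
  ⟨A.GMod.pretriangulated, A.bar.GMod.pretriangulated, rfl, rfl, A.GMod.isTriangulated,
    A.bar.GMod.isTriangulated, A.hatFun.ho_isTriangulated, inferInstance⟩
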